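/- Let $\mathrm{Herm}(2)$ be the space of Hermitian $2\times 2$ matrices with the Lorentz form $\langle X,X\rangle=-\det X$, let $\mathbb{S}^3_1=\{X\in \mathrm{Herm}(2):\det X=-1\}$ be de Sitter 3-space with the induced metric, $J=\begin{pmatrix}0&-i\\ i&0\end{pmatrix}$, $I\subset\mathbb{R}$ an open interval and $m\in\mathbb{R}$. A smooth curve $\gamma:I\to\mathbb{S}^3_1$ is null if $\langle\gamma',\gamma'\rangle=0$, and has no flex points if $\gamma'(t)$ and the covariant derivative of $\gamma'$ at $t$ are linearly independent for every $t\in I$. A canonical frame along $\gamma$, with spin $\varepsilon\in\{1,-1\}$, is a smooth map $\Gamma:I\to \mathrm{SL}(2,\mathbb{C})$ with $\gamma=\Gamma J\Gamma^*$ and $$\Gamma^{-1}d\Gamma=\begin{pmatrix}0&\varepsilon\\ k+i&0\end{pmatrix}\omega ,$$ where $\omega$ is a nowhere vanishing 1-form (the pseudo-arc element) and $k:I\to\mathbb{R}$ is the curvature. Denote by $'$ the derivative with respect to $\omega$, so that $dk=k'\omega$, $dk'=k''\omega$, $dk''=k'''\omega$. A null curve $\gamma$ without flex points is an extremal trajectory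 of $\mathcal{L}_m=\int(m+k)\omega$ if, for every smooth variation $\gamma_u$ ($|u|<\delta$) of $\gamma=\gamma_0$ through null curves without flex points that agrees with $\gamma$ outside a compact interval $[a,b]\subset I$, one has $\frac{d}{du}\big|_{u=0}\int_a^b(m+k_{\gamma_u})\omega_{\gamma_u}=0$. Write $\alpha+i\beta$ for the Maurer--Cartan form of $\mathrm{SL}(2,\mathbb{C})$ and, on $M=\mathrm{SL}(2,\mathbb{C})\times\mathbb{R}$ with $k$ the coordinate on $\mathbb{R}$, put $\omega=\beta^2_1$, $\eta^1=\beta^1_1$, $\eta^2=\beta^1_2$, $\eta^3=\alpha^1_2-\varepsilon\omega$, $\eta^4=\alpha^1_1$, $\eta^5=\alpha^2_1-k\omega$. On $Z=M\times\mathbb{R}^5$ let $\mu=(m+k)\omega+\sum_j x_j\eta^j$, and consider the Cartan system generated by the 1-forms $i_\xi d\mu$, $\xi$ a vector field on $Z$, with independence condition $\omega\ne0$. Its involutive prolongation is obtained by putting $Z_0=Z$, letting $Z_{n+1}$ be the set of points of $Z_n$ at which the Cartan system has an integral element tangent to $Z_n$, and $Y=\bigcap_n Z_n$. The Euler--Lagrange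 system is the restriction of the Cartan system to the momentum space $Y$, with independence condition $\omega\neq 0$. Every null curve $\gamma:I\to\mathbb{S}^3_1$ without flex points has a canonical frame, and for each canonical frame $\Gamma$ of $\gamma$, with spin $\varepsilon$ and curvature $k$, the following are equivalent: 1. $\gamma$ is an extremal trajectory of $\mathcal{L}_m$; 2. $k'''-6\varepsilon kk'+2\varepsilon mk'=0$ on $I$; 3. the lift $y_\gamma=\big((\Gamma,k);x_1,\dots,x_5\big)$ with $x_1=-\frac{\varepsilon}{2}k'$, $x_2=\frac14k''-\frac{\varepsilon}{2}(k^2-mk+2)$, $x_3=\frac{\varepsilon}{2}(m+k)$, $x_4=0$, $x_5=1$ is an integral curve of the Euler--Lagrange system. Conversely, for $\varepsilon=\pm1$ and every integral curve $y=((\Gamma,k);x):I\to Y$ of the Euler--Lagrange system, $\gamma=\Gamma J\Gamma^*$ is a null curve without flex points, $\Gamma$ is a canonical frame along $\gamma$ with spin $\varepsilon$, $\gamma$ is an extremal trajectory of $\mathcal{L}_m$, and $y$ is the lift $y_\gamma$ of $\gamma$. -/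

import Mathlib

open Set Filter Topology
open scoped ContDiff Matrix.Norms.Elementwise

/-- Complex `2 × 2` matrices; `SL(2,ℂ)` and `Herm(2)` are regarded as subsets of this space. -/
abbrev Mat2 : Type := Matrix (Fin 2) (Fin 2) ℂ

/-- The Lorentz scalar product on Hermitian matrices, the polarization of the quadratic form
`⟨X, X⟩ = - det X` (the determinant of a Hermitian matrix is real). -/
noncomputable def lorentz (X Y : Mat2) : ℝ :=
  QuadraticMap.polar (fun Z : Mat2 => -(Z.det).re) X Y / 2

/-- De Sitter 3-space: Hermitian matrices of determinant `-1`. -/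
def deSitter : Set Mat2 := {X | X.IsHermitian ∧ X.det = -1}

/-- The covariant derivative of `γ'` along a curve `γ` in de Sitter space: the component of the
second derivative tangent to de Sitter space, whose unit normal at `γ t` is `γ t`. -/
noncomputable def covAccel (γ : ℝ → Mat2) (t : ℝ) : Mat2 :=
  deriv (deriv γ) t - lorentz (deriv (deriv γ) t) (γ t) • γ t

/-- `γ` is a smooth null curve without flex points in de Sitter space, defined on `I`. -/
structure IsNullCurve (I : Set ℝ) (γ : ℝ → Mat2) : Prop where
  smooth : ContDiffOn ℝ ∞ γ I
  mem : ∀ t ∈ I, γ t ∈ deSitter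
  null : ∀ t ∈ I, lorentz (deriv γ t) (deriv γ t) = 0
  noFlex : ∀ t ∈ I, LinearIndependent ℝ ![deriv γ t, covAccel γ t]

/-- The base point `J` of de Sitter space. -/
def baseJ : Mat2 := !![0, -Complex.I; Complex.I, 0]

/-- The projection `A ↦ A J A*` of `SL(2,ℂ)` onto de Sitter space. -/
def proj (A : Mat2) : Mat2 := A * baseJ * A.conjTranspose

/-- The Maurer–Cartan form `A⁻¹ dA` of `SL(2,ℂ)`, at `A`, on the tangent vector `V`
(the adjugate is the inverse since `det A = 1`). -/
def maurerCartan (A V : Mat2) : Mat2 := A.adjugate * V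

/-- The inverse in `SL(2,ℂ)` is the adjugate. -/
theorem maurerCartan_eq_inv_mul {A : Mat2} (hA : A.det = 1) (V : Mat2) :
    maurerCartan A V = A⁻¹ * V := by
  simp [maurerCartan, Matrix.inv_def, hA]

/-- The pull-back of the Maurer–Cartan form by `Γ`, as the coefficient of `dt`. -/
noncomputable def frameForm (Γ : ℝ → Mat2) (t : ℝ) : Mat2 :=
  maurerCartan (Γ t) (deriv Γ t)

/-- `Γ` is a canonical frame field along the curve `γ` on `I`, and `γ` has spin `ε`.
With `Γ⁻¹ dΓ = φ + i θ` one has `θ¹₁ = θ¹₂ = 0`, `θ²₁ ≠ 0` (first order),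
`φ¹₂ = ε θ²₁` (second order) and `φ¹₁ = 0`. -/
structure IsCanonicalFrame (I : Set ℝ) (γ : ℝ → Mat2) (ε : ℝ) (Γ : ℝ → Mat2) : Prop where
  spin : ε = 1 ∨ ε = -1
  smooth : ContDiffOn ℝ ∞ Γ I
  det_eq_one : ∀ t ∈ I, (Γ t).det = 1
  frame : ∀ t ∈ I, γ t = proj (Γ t)
  theta11 : ∀ t ∈ I, (frameForm Γ t 0 0).im = 0
  theta12 : ∀ t ∈ I, (frameForm Γ t 0 1).im = 0
  theta21 : ∀ t ∈ I, (frameForm Γ t 1 0).im ≠ 0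
  phi12 : ∀ t ∈ I, (frameForm Γ t 0 1).re = ε * (frameForm Γ t 1 0).im
  phi11 : ∀ t ∈ I, (frameForm Γ t 0 0).re = 0

/-- The canonical pseudo-arc element `ω = θ²₁` read off a canonical frame, as the coefficient
of `dt`. -/
noncomputable def arcElt (Γ : ℝ → Mat2) (t : ℝ) : ℝ := (frameForm Γ t 1 0).im

/-- The curvature `k` read off a canonical frame: `φ²₁ = k ω`. -/
noncomputable def frameCurv (Γ : ℝ → Mat2) (t : ℝ) : ℝ := (frameForm Γ t 1 0).re / arcElt Γ t

/-- The derivative `f'` of a function with respect to the pseudo-arc: `df = f' ω`. -/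
noncomputable def arcDeriv (Γ : ℝ → Mat2) (f : ℝ → ℝ) (t : ℝ) : ℝ := deriv f t / arcElt Γ t

open Classical in
/-- A canonical frame of `γ` on `I` (if there is one; it is unique up to sign). -/
noncomputable def canonicalFrame (I : Set ℝ) (γ : ℝ → Mat2) : ℝ → Mat2 :=
  if h : ∃ Γ : ℝ → Mat2, ∃ ε : ℝ, IsCanonicalFrame I γ ε Γ then h.choose else fun _ => 1

/-- The part over `[a, b] ⊆ I` of the action `∫ (m + k_γ) ω_γ` of the curve `γ` on `I`. -/
noncomputable def action (m : ℝ) (I : Set ℝ) (γ : ℝ → Mat2) (a b : ℝ) : ℝ :=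
  ∫ t in a..b, (m + frameCurv (canonicalFrame I γ) t) * arcElt (canonicalFrame I γ) t

/-- `V (t, u)`, `|u| < δ`, is a variation of `γ` through null curves without flex points,
supported in the compact interval `[a, b] ⊆ I`. -/
structure IsCompactVariation (I : Set ℝ) (γ : ℝ → Mat2) (δ : ℝ) (V : ℝ × ℝ → Mat2)
    (a b : ℝ) : Prop where
  pos : 0 < δ
  smooth : ContDiffOn ℝ ∞ V (I ×ˢ Ioo (-δ) δ)
  nullCurve : ∀ u ∈ Ioo (-δ) δ, IsNullCurve I (fun t => V (t, u))
  initial : ∀ t ∈ I, V (t, 0) = γ t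
  le : a ≤ b
  subset : Icc a b ⊆ I
  support : ∀ t ∈ I, t ∉ Icc a b → ∀ u ∈ Ioo (-δ) δ, V (t, u) = γ t

/-- `γ` is an extremal trajectory with Lagrange multiplier `m`: the first variation of the action
vanishes for all compactly supported variations. (Any `[a, b]` containing the support may be used,
as the integrand does not depend on `u` outside the support.) -/
def IsExtremal (m : ℝ) (I : Set ℝ) (γ : ℝ → Mat2) : Prop :=
  ∀ (δ : ℝ) (V : ℝ × ℝ → Mat2) (a b : ℝ), IsCompactVariation I γ δ V a b →
    HasDerivAt (fun u : ℝ => action m I (fun t => V (t, u)) a b) 0 0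

/-- The Euler–Lagrange equation `k''' - 6 ε k k' + 2 ε m k' = 0` on `I`, for the curvature
and the pseudo-arc derivative given by the canonical frame `Γ`. -/
def EulerLagrangeEq (m ε : ℝ) (I : Set ℝ) (Γ : ℝ → Mat2) : Prop :=
  ∀ t ∈ I,
    arcDeriv Γ (arcDeriv Γ (arcDeriv Γ (frameCurv Γ))) t
      - 6 * ε * frameCurv Γ t * arcDeriv Γ (frameCurv Γ) t
      + 2 * ε * m * arcDeriv Γ (frameCurv Γ) t = 0

/-! ### The Cartan system, the momentum space and the Euler–Lagrange system -/

/-- The vector space of triples `(A, k, x)`, which contains `Z ≅ SL(2,ℂ) × ℝ × ℝ⁵`. -/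
abbrev Ambient : Type := Mat2 × ℝ × (Fin 5 → ℝ)

/-- The affine bundle `Z = (m + k) ω + I ⊆ T*M` over `M = SL(2,ℂ) × ℝ` in its trivialization
`((A, k); x) ↦ (m + k) ω + ∑ xⱼ ηʲ`. -/
def bundleZ : Set Ambient := {p | p.1.det = 1}

/-- The component `αⁱⱼ` (real part) of the Maurer–Cartan form, as a 1-form. -/
noncomputable def alphaForm (i j : Fin 2) (p : Ambient) : Ambient →L[ℝ] ℝ :=
  LinearMap.toContinuousLinearMap
    { toFun := fun v => (maurerCartan p.1 v.1 i j).re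
      map_add' := fun v w => by simp [maurerCartan, Matrix.mul_add]
      map_smul' := fun c v => by simp [maurerCartan] }

/-- The component `βⁱⱼ` (imaginary part) of the Maurer–Cartan form, as a 1-form. -/
noncomputable def betaForm (i j : Fin 2) (p : Ambient) : Ambient →L[ℝ] ℝ :=
  LinearMap.toContinuousLinearMap
    { toFun := fun v => (maurerCartan p.1 v.1 i j).im
      map_add' := fun v w => by simp [maurerCartan, Matrix.mul_add]
      map_smul' := fun c v => by simp [maurerCartan] }

/-- The independence form `ω = β²₁`. -/
noncomputable def omegaForm (p : Ambient) : Ambient →L[ℝ] ℝ := betaForm 1 0 p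

/-- The generators `η¹, …, η⁵` of the canonical Pfaffian system. -/
noncomputable def etaForm (ε : ℝ) (p : Ambient) : Fin 5 → (Ambient →L[ℝ] ℝ) :=
  ![betaForm 0 0 p,
    betaForm 0 1 p,
    alphaForm 0 1 p - ε • omegaForm p,
    alphaForm 0 0 p,
    alphaForm 1 0 p - p.2.1 • omegaForm p]

/-- The Liouville form `μ = (m + k) ω + ∑ xⱼ ηʲ`. -/
noncomputable def muForm (m ε : ℝ) (p : Ambient) : Ambient →L[ℝ] ℝ :=
  (m + p.2.1) • omegaForm p + ∑ j : Fin 5, p.2.2 j • etaForm ε p j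

/-- The 2-form `dμ`; on vectors tangent to `Z` it is the exterior derivative of `μ` restricted
to `Z`. -/
noncomputable def dMu (m ε : ℝ) (p v w : Ambient) : ℝ :=
  extDeriv (fun q : Ambient =>
    ContinuousAlternatingMap.ofSubsingleton ℝ Ambient ℝ (0 : Fin 1) (muForm m ε q)) p ![v, w]

/-- `v` is tangent to `S` at `p`: the velocity at `p` of a smooth curve in `S`. -/
def IsTangent (S : Set Ambient) (p v : Ambient) : Prop :=
  ∃ c : ℝ → Ambient, ContDiff ℝ ∞ c ∧ (∀ᶠ t in 𝓝 (0 : ℝ), c t ∈ S) ∧ c 0 = p ∧ HasDerivAt c v 0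

/-- `v` spans an integral element at `p` of the Cartan system generated by the 1-forms `i_ξ dμ`,
`ξ` a vector field on `Z`, with the independence condition `ω ≠ 0`. -/
def IsIntegralElement (m ε : ℝ) (p v : Ambient) : Prop :=
  IsTangent bundleZ p v ∧ omegaForm p v ≠ 0 ∧ ∀ w : Ambient, IsTangent bundleZ p w → dMu m ε p w v = 0

/-- One step of the involutive prolongation: the points of `S` at which the Cartan system,
restricted to `S`, has an integral element. -/
def prolong (m ε : ℝ) (S : Set Ambient) : Set Ambient :=
  {p | p ∈ S ∧ ∃ v : Ambient, IsTangent S p v ∧ IsIntegralElement m ε p v}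

/-- The momentum space `Y ⊆ Z`, the result of the involutive prolongation `Z ⊇ Z₁ ⊇ Z₂ ⊇ ⋯`. -/
def momentumSpace (m ε : ℝ) : Set Ambient := ⋂ n : ℕ, (prolong m ε)^[n] bundleZ

/-- `y` is an integral curve on `I` of the Euler–Lagrange system, that is, of the restriction of
the Cartan system to the momentum space, with the independence condition `ω ≠ 0`. -/
structure IsELCurve (m ε : ℝ) (I : Set ℝ) (y : ℝ → Ambient) : Prop where
  smooth : ContDiffOn ℝ ∞ y I
  mem : ∀ t ∈ I, y t ∈ momentumSpace m ε
  integral : ∀ t ∈ I, IsIntegralElement m ε (y t) (deriv y t)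

/-- The lift of a null curve with canonical frame `Γ` to the momentum space: the point with
coordinates `x₁ = -ε k'/2`, `x₂ = k''/4 - ε (k² - m k + 2)/2` of
`Y = {x₃ = ε (m + k)/2, x₄ = 0, x₅ = 1}`. -/
noncomputable def momentumLift (m ε : ℝ) (Γ : ℝ → Mat2) (t : ℝ) : Ambient :=
  (Γ t, frameCurv Γ t,
    ![-(ε / 2) * arcDeriv Γ (frameCurv Γ) t,
      1 / 4 * arcDeriv Γ (arcDeriv Γ (frameCurv Γ)) t
        - ε / 2 * (frameCurv Γ t ^ 2 - m * frameCurv Γ t + 2),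
      ε / 2 * (m + frameCurv Γ t),
      0,
      1])

/-! ### Calculus of matrix-valued maps -/

theorem hasDerivAt_matrix_iff {A : ℝ → Mat2} {A' : Mat2} {t : ℝ} :
    HasDerivAt A A' t ↔ ∀ i j, HasDerivAt (fun s => A s i j) (A' i j) t := by
  refine ⟨fun h i j => ?_, fun h => ?_⟩
  · exact hasDerivAt_pi.1 (hasDerivAt_pi.1 h i) j
  · exact hasDerivAt_pi.2 fun i => hasDerivAt_pi.2 fun j => h i j

theorem contDiffOn_matrix_iff {E : Type*} [NormedAddCommGroup E] [NormedSpace ℝ E]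
    {A : E → Mat2} {s : Set E} {n : ℕ∞ω} :
    ContDiffOn ℝ n A s ↔ ∀ i j, ContDiffOn ℝ n (fun x => A x i j) s := by
  refine ⟨fun h i j => ?_, fun h => ?_⟩
  · exact contDiffOn_pi.1 (contDiffOn_pi.1 h i) j
  · exact contDiffOn_pi.2 fun i => contDiffOn_pi.2 fun j => h i j

theorem HasDerivAt.matrix_mul {A B : ℝ → Mat2} {A' B' : Mat2} {t : ℝ}
    (hA : HasDerivAt A A' t) (hB : HasDerivAt B B' t) :
    HasDerivAt (fun s => A s * B s) (A' * B t + A t * B') t := by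
  rw [hasDerivAt_matrix_iff] at *
  intro i j
  simp only [Matrix.mul_apply, Matrix.add_apply, Fin.sum_univ_two]
  have h := ((hA i 0).mul (hB 0 j)).add ((hA i 1).mul (hB 1 j))
  exact h.congr_deriv (by ring)

theorem hasDerivAt_conj {f : ℝ → ℂ} {f' : ℂ} {t : ℝ} (h : HasDerivAt f f' t) :
    HasDerivAt (fun s => (starRingEnd ℂ) (f s)) ((starRingEnd ℂ) f') t :=
  (Complex.conjCLE.toContinuousLinearMap.hasFDerivAt.comp_hasDerivAt t h)

theorem HasDerivAt.complex_re {f : ℝ → ℂ} {f' : ℂ} {t : ℝ} (h : HasDerivAt f f' t) :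
    HasDerivAt (fun s => (f s).re) f'.re t :=
  Complex.reCLM.hasFDerivAt.comp_hasDerivAt t h

theorem HasDerivAt.complex_im {f : ℝ → ℂ} {f' : ℂ} {t : ℝ} (h : HasDerivAt f f' t) :
    HasDerivAt (fun s => (f s).im) f'.im t :=
  Complex.imCLM.hasFDerivAt.comp_hasDerivAt t h

theorem HasDerivAt.conjTranspose {A : ℝ → Mat2} {A' : Mat2} {t : ℝ} (hA : HasDerivAt A A' t) :
    HasDerivAt (fun s => (A s).conjTranspose) A'.conjTranspose t := by
  rw [hasDerivAt_matrix_iff] at *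
  intro i j
  simpa [Matrix.conjTranspose_apply] using hasDerivAt_conj (hA j i)

theorem HasDerivAt.adjugate {A : ℝ → Mat2} {A' : Mat2} {t : ℝ} (hA : HasDerivAt A A' t) :
    HasDerivAt (fun s => (A s).adjugate) A'.adjugate t := by
  rw [hasDerivAt_matrix_iff] at *
  intro i j
  fin_cases i <;> fin_cases j <;> simp [Matrix.adjugate_fin_two]
  · exact hA 1 1
  · exact (hA 0 1).neg
  · exact (hA 1 0).neg
  · exact hA 0 0

section ContDiff

variable {E : Type*} [NormedAddCommGroup E] [NormedSpace ℝ E] {s : Set E} {n : ℕ∞ω}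

theorem ContDiffOn.matrix_mul {A B : E → Mat2} (hA : ContDiffOn ℝ n A s)
    (hB : ContDiffOn ℝ n B s) : ContDiffOn ℝ n (fun x => A x * B x) s := by
  rw [contDiffOn_matrix_iff] at *
  intro i j
  simp only [Matrix.mul_apply, Fin.sum_univ_two]
  exact ((hA i 0).mul (hB 0 j)).add ((hA i 1).mul (hB 1 j))

theorem contDiffOn_conj {f : E → ℂ} (h : ContDiffOn ℝ n f s) :
    ContDiffOn ℝ n (fun x => (starRingEnd ℂ) (f x)) s :=
  Complex.conjCLE.contDiff.comp_contDiffOn h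

theorem ContDiffOn.complex_re {f : E → ℂ} (h : ContDiffOn ℝ n f s) :
    ContDiffOn ℝ n (fun x => (f x).re) s :=
  Complex.reCLM.contDiff.comp_contDiffOn h

theorem ContDiffOn.complex_im {f : E → ℂ} (h : ContDiffOn ℝ n f s) :
    ContDiffOn ℝ n (fun x => (f x).im) s :=
  Complex.imCLM.contDiff.comp_contDiffOn h

theorem ContDiffOn.complex_ofReal {f : E → ℝ} (h : ContDiffOn ℝ n f s) :
    ContDiffOn ℝ n (fun x => (f x : ℂ)) s :=
  Complex.ofRealCLM.contDiff.comp_contDiffOn h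

theorem ContDiffOn.conjTranspose {A : E → Mat2} (hA : ContDiffOn ℝ n A s) :
    ContDiffOn ℝ n (fun x => (A x).conjTranspose) s := by
  rw [contDiffOn_matrix_iff] at *
  intro i j
  simpa [Matrix.conjTranspose_apply] using contDiffOn_conj (hA j i)

theorem ContDiffOn.adjugate {A : E → Mat2} (hA : ContDiffOn ℝ n A s) :
    ContDiffOn ℝ n (fun x => (A x).adjugate) s := by
  rw [contDiffOn_matrix_iff] at *
  intro i j
  fin_cases i <;> fin_cases j <;> simp [Matrix.adjugate_fin_two]
  · exact hA 1 1
  · exact (hA 0 1).neg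
  · exact (hA 1 0).neg
  · exact hA 0 0

theorem ContDiffOn.proj {A : E → Mat2} (hA : ContDiffOn ℝ n A s) :
    ContDiffOn ℝ n (fun x => proj (A x)) s :=
  (hA.matrix_mul contDiffOn_const).matrix_mul hA.conjTranspose

end ContDiff

/-- A smooth map on an open set of the line has a smooth derivative. -/
theorem ContDiffOn.deriv_infty {F : Type*} [NormedAddCommGroup F] [NormedSpace ℝ F]
    {f : ℝ → F} {U : Set ℝ} (hU : IsOpen U) (hf : ContDiffOn ℝ ∞ f U) :
    ContDiffOn ℝ ∞ (deriv f) U :=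
  ((contDiffOn_infty_iff_deriv_of_isOpen hU).1 hf).2

theorem ContDiffOn.hasDerivAt_infty {F : Type*} [NormedAddCommGroup F] [NormedSpace ℝ F]
    {f : ℝ → F} {U : Set ℝ} (hU : IsOpen U) (hf : ContDiffOn ℝ ∞ f U) {t : ℝ} (ht : t ∈ U) :
    HasDerivAt f (deriv f t) t :=
  ((hf.differentiableOn (by simp)).differentiableAt (hU.mem_nhds ht)).hasDerivAt

/-! ### Partial derivatives of maps of two variables -/

section Partial

variable {F : Type*} [NormedAddCommGroup F] [NormedSpace ℝ F]

/-- The derivative with respect to the first variable. -/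
noncomputable def pderivFst (f : ℝ × ℝ → F) (p : ℝ × ℝ) : F := fderiv ℝ f p (1, 0)

/-- The derivative with respect to the second variable. -/
noncomputable def pderivSnd (f : ℝ × ℝ → F) (p : ℝ × ℝ) : F := fderiv ℝ f p (0, 1)

variable {f : ℝ × ℝ → F} {O : Set (ℝ × ℝ)}

theorem ContDiffOn.pderivFst (hO : IsOpen O) (hf : ContDiffOn ℝ ∞ f O) :
    ContDiffOn ℝ ∞ (pderivFst f) O :=
  (hf.fderiv_of_isOpen hO (by simp)).clm_apply contDiffOn_const

theorem ContDiffOn.pderivSnd (hO : IsOpen O) (hf : ContDiffOn ℝ ∞ f O) :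
    ContDiffOn ℝ ∞ (pderivSnd f) O :=
  (hf.fderiv_of_isOpen hO (by simp)).clm_apply contDiffOn_const

theorem ContDiffOn.hasDerivAt_slice_fst (hO : IsOpen O) (hf : ContDiffOn ℝ ∞ f O) {t u : ℝ}
    (h : (t, u) ∈ O) : HasDerivAt (fun s => f (s, u)) (_root_.pderivFst f (t, u)) t := by
  have h1 : HasFDerivAt f (fderiv ℝ f (t, u)) (t, u) :=
    ((hf.differentiableOn (by simp)).differentiableAt (hO.mem_nhds h)).hasFDerivAt
  have h2 : HasDerivAt (fun s : ℝ => (s, u)) ((1 : ℝ), (0 : ℝ)) t :=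
    (hasDerivAt_id t).prodMk (hasDerivAt_const t u)
  exact h1.comp_hasDerivAt t h2

theorem ContDiffOn.hasDerivAt_slice_snd (hO : IsOpen O) (hf : ContDiffOn ℝ ∞ f O) {t u : ℝ}
    (h : (t, u) ∈ O) : HasDerivAt (fun s => f (t, s)) (_root_.pderivSnd f (t, u)) u := by
  have h1 : HasFDerivAt f (fderiv ℝ f (t, u)) (t, u) :=
    ((hf.differentiableOn (by simp)).differentiableAt (hO.mem_nhds h)).hasFDerivAt
  have h2 : HasDerivAt (fun s : ℝ => (t, s)) ((0 : ℝ), (1 : ℝ)) u :=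
    (hasDerivAt_const u t).prodMk (hasDerivAt_id u)
  exact h1.comp_hasDerivAt u h2

theorem pderivFst_pderivSnd_comm (hO : IsOpen O) (hf : ContDiffOn ℝ ∞ f O) {p : ℝ × ℝ}
    (h : p ∈ O) : pderivFst (pderivSnd f) p = pderivSnd (pderivFst f) p := by
  have hd : DifferentiableAt ℝ (fderiv ℝ f) p :=
    ((hf.fderiv_of_isOpen (m := ∞) hO (by simp)).differentiableOn (by simp)).differentiableAt
      (hO.mem_nhds h)
  have hs : IsSymmSndFDerivAt ℝ f p :=
    (hf.contDiffAt (hO.mem_nhds h)).isSymmSndFDerivAt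
      (by rw [minSmoothness_of_isRCLikeNormedField]; exact WithTop.coe_le_coe.2 (le_top : (2 : ℕ∞) ≤ ⊤))
  have e (a b : ℝ × ℝ) : fderiv ℝ (fun q => fderiv ℝ f q a) p b = fderiv ℝ (fderiv ℝ f) p b a := by
    rw [fderiv_clm_apply hd (differentiableAt_const a)]
    simp
  unfold pderivFst pderivSnd
  rw [e, e]
  exact hs _ _

theorem isOpen_slice (hO : IsOpen O) (u : ℝ) : IsOpen {t | (t, u) ∈ O} :=
  hO.preimage (by fun_prop)

theorem ContDiffOn.slice_fst (hf : ContDiffOn ℝ ∞ f O) (u : ℝ) :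
    ContDiffOn ℝ ∞ (fun t => f (t, u)) {t | (t, u) ∈ O} :=
  hf.comp (by fun_prop) fun _ h => h

theorem ContDiffOn.comp_fst {f : ℝ → F} {U : Set ℝ} (hf : ContDiffOn ℝ ∞ f U)
    (h : ∀ p ∈ O, p.1 ∈ U) : ContDiffOn ℝ ∞ (fun p : ℝ × ℝ => f p.1) O :=
  hf.comp contDiffOn_fst h

end Partial

/-! ### Frames adapted to null curves -/

theorem lorentz_apply (X Y : Mat2) :
    lorentz X Y = -(X 0 0 * Y 1 1 + X 1 1 * Y 0 0 - X 0 1 * Y 1 0 - X 1 0 * Y 0 1).re / 2 := by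
  simp only [lorentz, QuadraticMap.polar, Matrix.det_fin_two, Matrix.add_apply, Complex.sub_re,
    Complex.mul_re, Complex.add_re, Complex.add_im]
  ring

theorem lorentz_congr {A : Mat2} (hA : A.det = 1) (X Y : Mat2) :
    lorentz (A * X * A.conjTranspose) (A * Y * A.conjTranspose) = lorentz X Y := by
  have h (Z : Mat2) : (A * Z * A.conjTranspose).det = Z.det := by
    simp [Matrix.det_mul, Matrix.det_conjTranspose, hA]
  simp only [lorentz, QuadraticMap.polar, h, ← Matrix.add_mul, ← Matrix.mul_add]

theorem adjugate_mul_of_det {A : Mat2} (hA : A.det = 1) : A.adjugate * A = 1 := by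
  rw [Matrix.adjugate_mul, hA, one_smul]

theorem mul_adjugate_of_det {A : Mat2} (hA : A.det = 1) : A * A.adjugate = 1 := by
  rw [Matrix.mul_adjugate, hA, one_smul]

theorem mul_maurerCartan {A : Mat2} (hA : A.det = 1) (V : Mat2) : A * maurerCartan A V = V := by
  rw [maurerCartan, ← Matrix.mul_assoc, mul_adjugate_of_det hA, Matrix.one_mul]

theorem maurerCartan_mul {A : Mat2} (hA : A.det = 1) (X : Mat2) : maurerCartan A (A * X) = X := by
  rw [maurerCartan, ← Matrix.mul_assoc, adjugate_mul_of_det hA, Matrix.one_mul]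

/-- Congruence by a matrix of determinant one is injective. -/
theorem congr_eq_iff {A X Y : Mat2} (hA : A.det = 1) :
    A * X * A.conjTranspose = A * Y * A.conjTranspose ↔ X = Y := by
  refine ⟨fun h => ?_, fun h => by rw [h]⟩
  have h1 : A.adjugate * A = 1 := adjugate_mul_of_det hA
  have h2 : A.conjTranspose * A.adjugate.conjTranspose = 1 := by
    rw [← Matrix.conjTranspose_mul, h1, Matrix.conjTranspose_one]
  have e (Z : Mat2) :
      A.adjugate * (A * Z * A.conjTranspose) * A.adjugate.conjTranspose = Z := by
    calc _ = (A.adjugate * A) * Z * (A.conjTranspose * A.adjugate.conjTranspose) := by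
          simp only [Matrix.mul_assoc]
      _ = Z := by rw [h1, h2, Matrix.one_mul, Matrix.mul_one]
  rw [← e X, h, e]

theorem smul_congr (r : ℝ) (A X : Mat2) :
    r • (A * X * A.conjTranspose) = A * (r • X) * A.conjTranspose := by
  simp

theorem congr_adjugate {A : Mat2} (hA : A.det = 1) (Z : Mat2) :
    A * (A.adjugate * Z * A.adjugate.conjTranspose) * A.conjTranspose = Z := by
  have h1 : A * A.adjugate = 1 := mul_adjugate_of_det hA
  have h2 : A.adjugate.conjTranspose * A.conjTranspose = 1 := by
    rw [← Matrix.conjTranspose_mul, h1, Matrix.conjTranspose_one]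
  calc _ = (A * A.adjugate) * Z * (A.adjugate.conjTranspose * A.conjTranspose) := by
        simp only [Matrix.mul_assoc]
    _ = Z := by rw [h1, h2, Matrix.one_mul, Matrix.mul_one]

theorem baseJ_conjTranspose : baseJ.conjTranspose = baseJ := by
  ext i j; fin_cases i <;> fin_cases j <;> simp [baseJ, Matrix.conjTranspose_apply]

theorem proj_mem_deSitter {A : Mat2} (hA : A.det = 1) : proj A ∈ deSitter := by
  constructor
  · unfold Matrix.IsHermitian proj
    simp [Matrix.conjTranspose_mul, baseJ_conjTranspose, Matrix.mul_assoc]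
  · simp [proj, Matrix.det_mul, Matrix.det_conjTranspose, hA, baseJ, Matrix.det_fin_two]

theorem hasDerivAt_congr_frame {Γ N : ℝ → Mat2} {X N' : Mat2} {t : ℝ}
    (hΓ : HasDerivAt Γ (Γ t * X) t) (hN : HasDerivAt N N' t) :
    HasDerivAt (fun s => Γ s * N s * (Γ s).conjTranspose)
      (Γ t * (X * N t + N t * X.conjTranspose + N') * (Γ t).conjTranspose) t := by
  refine ((hΓ.matrix_mul hN).matrix_mul hΓ.conjTranspose).congr_deriv ?_
  simp only [Matrix.conjTranspose_mul, Matrix.mul_add, Matrix.add_mul, Matrix.mul_assoc]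
  abel

/-- The Maurer–Cartan form takes traceless values on curves in `SL(2,ℂ)`. -/
theorem trace_maurerCartan_eq_zero {Γ : ℝ → Mat2} {Γ' : Mat2} {t : ℝ}
    (hΓ : HasDerivAt Γ Γ' t) (hdet : ∀ᶠ s in 𝓝 t, (Γ s).det = 1) :
    maurerCartan (Γ t) Γ' 0 0 + maurerCartan (Γ t) Γ' 1 1 = 0 := by
  have hc := hasDerivAt_matrix_iff.1 hΓ
  have h1 : HasDerivAt (fun s => (Γ s).det)
      (Γ' 0 0 * Γ t 1 1 + Γ t 0 0 * Γ' 1 1 - (Γ' 0 1 * Γ t 1 0 + Γ t 0 1 * Γ' 1 0)) t := by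
    simp only [Matrix.det_fin_two]
    exact ((hc 0 0).mul (hc 1 1)).sub ((hc 0 1).mul (hc 1 0))
  have h2 : HasDerivAt (fun s => (Γ s).det) 0 t :=
    (hasDerivAt_const t (1 : ℂ)).congr_of_eventuallyEq hdet
  have h3 := h1.unique h2
  simp only [maurerCartan, Matrix.adjugate_fin_two, Matrix.mul_apply, Fin.sum_univ_two,
    Matrix.of_apply, Matrix.cons_val_zero, Matrix.cons_val_one, Matrix.cons_val', Matrix.cons_val_fin_one]
  linear_combination h3

/-- A smooth map `Γ` to `SL(2,ℂ)` with `Γ⁻¹ Γ' = (0, b; c, 0)`, `b` real and nowhere zero. -/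
structure IsAdaptedFrame (U : Set ℝ) (Γ : ℝ → Mat2) (b : ℝ → ℝ) : Prop where
  smooth : ContDiffOn ℝ ∞ Γ U
  det_eq_one : ∀ t ∈ U, (Γ t).det = 1
  form00 : ∀ t ∈ U, frameForm Γ t 0 0 = 0
  form01 : ∀ t ∈ U, frameForm Γ t 0 1 = b t
  ne_zero : ∀ t ∈ U, b t ≠ 0

theorem contDiffOn_frameForm {U : Set ℝ} (hU : IsOpen U) {Γ : ℝ → Mat2}
    (hΓ : ContDiffOn ℝ ∞ Γ U) : ContDiffOn ℝ ∞ (frameForm Γ) U :=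
  hΓ.adjugate.matrix_mul (hΓ.deriv_infty hU)

namespace IsAdaptedFrame

variable {U : Set ℝ} {Γ : ℝ → Mat2} {b : ℝ → ℝ}

theorem mono (h : IsAdaptedFrame U Γ b) {U' : Set ℝ} (hs : U' ⊆ U) : IsAdaptedFrame U' Γ b where
  smooth := h.smooth.mono hs
  det_eq_one t ht := h.det_eq_one t (hs ht)
  form00 t ht := h.form00 t (hs ht)
  form01 t ht := h.form01 t (hs ht)
  ne_zero t ht := h.ne_zero t (hs ht)

theorem frameForm_eq (h : IsAdaptedFrame U Γ b) (hU : IsOpen U) {t : ℝ} (ht : t ∈ U) :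
    frameForm Γ t = !![0, (b t : ℂ); frameForm Γ t 1 0, 0] := by
  have h1 := trace_maurerCartan_eq_zero (h.smooth.hasDerivAt_infty hU ht)
    (Filter.eventually_of_mem (hU.mem_nhds ht) h.det_eq_one)
  change frameForm Γ t 0 0 + frameForm Γ t 1 1 = 0 at h1
  rw [h.form00 t ht, zero_add] at h1
  ext i j
  fin_cases i <;> fin_cases j <;> simp [h.form00 t ht, h.form01 t ht, h1]

theorem hasDerivAt (h : IsAdaptedFrame U Γ b) (hU : IsOpen U) {t : ℝ} (ht : t ∈ U) :
    HasDerivAt Γ (Γ t * !![0, (b t : ℂ); frameForm Γ t 1 0, 0]) t := by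
  rw [← h.frameForm_eq hU ht, frameForm, mul_maurerCartan (h.det_eq_one t ht)]
  exact h.smooth.hasDerivAt_infty hU ht

theorem hasDerivAt_proj (h : IsAdaptedFrame U Γ b) (hU : IsOpen U) {t : ℝ} (ht : t ∈ U) :
    HasDerivAt (fun s => proj (Γ s))
      (Γ t * !![0, 0; 0, ((2 * arcElt Γ t : ℝ) : ℂ)] * (Γ t).conjTranspose) t := by
  refine (hasDerivAt_congr_frame (h.hasDerivAt hU ht) (hasDerivAt_const t baseJ)).congr_deriv ?_
  congr 2
  ext i j
  fin_cases i <;> fin_cases j <;>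
    simp only [Matrix.mul_apply, Matrix.add_apply, Fin.sum_univ_two, Matrix.conjTranspose_apply] <;>
    simp [baseJ, arcElt, Complex.ext_iff]
  ring

theorem deriv_proj (h : IsAdaptedFrame U Γ b) (hU : IsOpen U) {t : ℝ} (ht : t ∈ U) :
    deriv (fun s => proj (Γ s)) t
      = Γ t * !![0, 0; 0, ((2 * arcElt Γ t : ℝ) : ℂ)] * (Γ t).conjTranspose :=
  (h.hasDerivAt_proj hU ht).deriv

theorem hasDerivAt_deriv_proj (h : IsAdaptedFrame U Γ b) (hU : IsOpen U) {t : ℝ} (ht : t ∈ U) :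
    HasDerivAt (deriv fun s => proj (Γ s))
      (Γ t * !![0, ((2 * arcElt Γ t * b t : ℝ) : ℂ); ((2 * arcElt Γ t * b t : ℝ) : ℂ),
        ((2 * deriv (arcElt Γ) t : ℝ) : ℂ)] * (Γ t).conjTranspose) t := by
  have hq : HasDerivAt (arcElt Γ) (deriv (arcElt Γ) t) t :=
    ((contDiffOn_matrix_iff.1 (contDiffOn_frameForm hU h.smooth) 1 0).complex_im).hasDerivAt_infty
      hU ht
  have hN : HasDerivAt (fun s => (!![0, 0; 0, ((2 * arcElt Γ s : ℝ) : ℂ)] : Mat2))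
      !![0, 0; 0, ((2 * deriv (arcElt Γ) t : ℝ) : ℂ)] t := by
    rw [hasDerivAt_matrix_iff]
    intro i j
    fin_cases i <;> fin_cases j <;>
      simp only [Fin.zero_eta, Fin.mk_one, Fin.isValue, Matrix.of_apply, Matrix.cons_val_zero, Matrix.cons_val_one,
        Matrix.cons_val', Matrix.cons_val_fin_one]
    · exact hasDerivAt_const _ _
    · exact hasDerivAt_const _ _
    · exact hasDerivAt_const _ _
    · exact (hq.const_mul 2).ofReal_comp
  have he : deriv (fun s => proj (Γ s)) =ᶠ[𝓝 t] fun s =>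
      Γ s * !![0, 0; 0, ((2 * arcElt Γ s : ℝ) : ℂ)] * (Γ s).conjTranspose :=
    Filter.eventually_of_mem (hU.mem_nhds ht) fun s hs => (h.hasDerivAt_proj hU hs).deriv
  refine ((hasDerivAt_congr_frame (h.hasDerivAt hU ht) hN).congr_of_eventuallyEq he).congr_deriv ?_
  congr 2
  ext i j
  fin_cases i <;> fin_cases j <;>
    simp only [Matrix.mul_apply, Matrix.add_apply, Fin.sum_univ_two, Matrix.conjTranspose_apply] <;>
    simp
  ring

theorem deriv_deriv_proj (h : IsAdaptedFrame U Γ b) (hU : IsOpen U) {t : ℝ} (ht : t ∈ U) :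
    deriv (deriv fun s => proj (Γ s)) t
      = Γ t * !![0, ((2 * arcElt Γ t * b t : ℝ) : ℂ); ((2 * arcElt Γ t * b t : ℝ) : ℂ),
        ((2 * deriv (arcElt Γ) t : ℝ) : ℂ)] * (Γ t).conjTranspose :=
  (h.hasDerivAt_deriv_proj hU ht).deriv

/-- The projection of an adapted frame with `θ²₁ ≠ 0` is a null curve without flex points. -/
theorem isNullCurve (h : IsAdaptedFrame U Γ b) (hU : IsOpen U)
    (hq : ∀ t ∈ U, arcElt Γ t ≠ 0) : IsNullCurve U fun t => proj (Γ t) where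
  smooth := h.smooth.proj
  mem t ht := proj_mem_deSitter (h.det_eq_one t ht)
  null t ht := by
    rw [h.deriv_proj hU ht, lorentz_congr (h.det_eq_one t ht), lorentz_apply]
    simp
  noFlex t ht := by
    have hd := h.det_eq_one t ht
    rw [covAccel, h.deriv_proj hU ht, h.deriv_deriv_proj hU ht]
    have hl : lorentz (Γ t * !![0, ((2 * arcElt Γ t * b t : ℝ) : ℂ);
        ((2 * arcElt Γ t * b t : ℝ) : ℂ), ((2 * deriv (arcElt Γ) t : ℝ) : ℂ)] *
        (Γ t).conjTranspose) (proj (Γ t)) = 0 := by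
      rw [proj, lorentz_congr hd, lorentz_apply]
      simp [baseJ]
    rw [hl, zero_smul, sub_zero, LinearIndependent.pair_iff]
    intro x y hxy
    rw [smul_congr, smul_congr, ← Matrix.add_mul, ← Matrix.mul_add] at hxy
    have h0 : (0 : Mat2) = Γ t * 0 * (Γ t).conjTranspose := by simp
    rw [h0, congr_eq_iff hd] at hxy
    have e01 := congrFun (congrFun hxy 0) 1
    have e11 := congrFun (congrFun hxy 1) 1
    simp [hq t ht, h.ne_zero t ht] at e01
    subst e01
    simp [hq t ht] at e11
    exact ⟨e11, rfl⟩

/-- A curve in de Sitter space whose velocity is proportional to that of the projection of an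
adapted frame is, up to sign, this projection. -/
theorem eq_proj_or_neg (h : IsAdaptedFrame U Γ b) (hU : IsOpen U) {γ : ℝ → Mat2} {g : ℝ → ℝ}
    (hγ : ∀ t ∈ U, γ t ∈ deSitter) (hg : ∀ t ∈ U, g t ≠ 0)
    (hd : ∀ t ∈ U, HasDerivAt γ (Γ t * !![0, 0; 0, (g t : ℂ)] * (Γ t).conjTranspose) t)
    {t : ℝ} (ht : t ∈ U) : γ t = proj (Γ t) ∨ γ t = -proj (Γ t) := by
  set B : ℝ → Mat2 := fun s => (Γ s).adjugate * γ s * (Γ s).adjugate.conjTranspose with hB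
  have hγB (s) (hs : s ∈ U) : γ s = Γ s * B s * (Γ s).conjTranspose :=
    (congr_adjugate (h.det_eq_one s hs) _).symm
  have hBd (s) (hs : s ∈ U) : HasDerivAt B
      (!![0, -(b s : ℂ); -frameForm Γ s 1 0, 0] * B s
        + B s * !![0, -(b s : ℂ); -frameForm Γ s 1 0, 0].conjTranspose
        + !![0, 0; 0, (g s : ℂ)]) s := by
    have h1 := ((h.hasDerivAt hU hs).adjugate.matrix_mul (hd s hs)).matrix_mul
      (h.hasDerivAt hU hs).adjugate.conjTranspose
    refine h1.congr_deriv ?_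
    have e1 : (Γ s * !![0, (b s : ℂ); frameForm Γ s 1 0, 0]).adjugate
        = !![0, -(b s : ℂ); -frameForm Γ s 1 0, 0] * (Γ s).adjugate := by
      rw [Matrix.adjugate_mul_distrib]
      congr 1
      simp [Matrix.adjugate_fin_two]
    have e2 : (Γ s).adjugate * (Γ s * !![0, 0; 0, (g s : ℂ)] * (Γ s).conjTranspose)
        * (Γ s).adjugate.conjTranspose = !![0, 0; 0, (g s : ℂ)] := by
      have := congr_adjugate (h.det_eq_one s hs)
        (Γ s * !![0, 0; 0, (g s : ℂ)] * (Γ s).conjTranspose)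
      rwa [congr_eq_iff (h.det_eq_one s hs)] at this
    rw [e1, Matrix.conjTranspose_mul, Matrix.add_mul, e2]
    simp only [hB, Matrix.mul_assoc]
    abel
  have hherm (s) (hs : s ∈ U) : (B s).conjTranspose = B s := by
    have := (hγ s hs).1
    simp only [hB, Matrix.conjTranspose_mul, Matrix.conjTranspose_conjTranspose]
    rw [this.eq, Matrix.mul_assoc]
  have hdet (s) (hs : s ∈ U) : (B s).det = -1 := by
    have := (hγ s hs).2
    rw [hγB s hs] at this
    simpa [Matrix.det_mul, Matrix.det_conjTranspose, h.det_eq_one s hs] using this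
  have h00 (s) (hs : s ∈ U) : (B s 0 0).im = 0 := by
    have := congrFun (congrFun (hherm s hs) 0) 0
    simpa [Matrix.conjTranspose_apply, Complex.conj_eq_iff_im] using this
  have h11 (s) (hs : s ∈ U) : (B s 1 1).im = 0 := by
    have := congrFun (congrFun (hherm s hs) 1) 1
    simpa [Matrix.conjTranspose_apply, Complex.conj_eq_iff_im] using this
  have h10 (s) (hs : s ∈ U) : B s 1 0 = (starRingEnd ℂ) (B s 0 1) := by
    have := congrFun (congrFun (hherm s hs) 1) 0
    simpa [Matrix.conjTranspose_apply] using this.symm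
  have hre (s) (hs : s ∈ U) : (B s 0 0).re * (B s 1 1).re
      - ((B s 0 1).re ^ 2 + (B s 0 1).im ^ 2) = -1 := by
    have := congrArg Complex.re (hdet s hs)
    rw [Matrix.det_fin_two, h10 s hs] at this
    simp [h00 s hs] at this
    linarith
  have hBe (s) (hs : s ∈ U) := hasDerivAt_matrix_iff.1 (hBd s hs)
  have d00 (s) (hs : s ∈ U) : HasDerivAt (fun r => (B r 0 0).re) (-2 * b s * (B s 0 1).re) s := by
    refine (hBe s hs 0 0).complex_re.congr_deriv ?_
    simp only [Matrix.mul_apply, Matrix.add_apply, Fin.sum_univ_two, Matrix.conjTranspose_apply]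
    simp [h10 s hs]
    ring
  have d01 (s) (hs : s ∈ U) : HasDerivAt (fun r => B r 0 1)
      (-(b s) * B s 1 1 - B s 0 0 * (starRingEnd ℂ) (frameForm Γ s 1 0)) s := by
    refine (hBe s hs 0 1).congr_deriv ?_
    simp only [Matrix.mul_apply, Matrix.add_apply, Fin.sum_univ_two, Matrix.conjTranspose_apply]
    simp
    ring
  have d11 (s) (hs : s ∈ U) : HasDerivAt (fun r => (B r 1 1).re)
      (-2 * (frameForm Γ s 1 0 * B s 0 1).re + g s) s := by
    refine (hBe s hs 1 1).complex_re.congr_deriv ?_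
    simp only [Matrix.mul_apply, Matrix.add_apply, Fin.sum_univ_two, Matrix.conjTranspose_apply]
    simp [h10 s hs]
    ring
  have z00 (s) (hs : s ∈ U) : (B s 0 0).re = 0 := by
    have h1 := ((d00 s hs).mul (d11 s hs)).sub
      (((d01 s hs).complex_re.pow 2).add ((d01 s hs).complex_im.pow 2))
    have h2 : HasDerivAt (fun r => (B r 0 0).re * (B r 1 1).re
      - ((B r 0 1).re ^ 2 + (B r 0 1).im ^ 2)) 0 s :=
      (hasDerivAt_const s (-1 : ℝ)).congr_of_eventuallyEq
        (Filter.eventually_of_mem (hU.mem_nhds hs) hre)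
    have h3 := h1.unique h2
    simp [h00 s hs, h11 s hs] at h3
    have h4 : g s * (B s 0 0).re = 0 := by linear_combination h3
    exact (mul_eq_zero.1 h4).resolve_left (hg s hs)
  have z01 (s) (hs : s ∈ U) : (B s 0 1).re = 0 := by
    have h2 : HasDerivAt (fun r => (B r 0 0).re) 0 s :=
      (hasDerivAt_const s (0 : ℝ)).congr_of_eventuallyEq
        (Filter.eventually_of_mem (hU.mem_nhds hs) z00)
    have h3 := (d00 s hs).unique h2
    simpa [h.ne_zero s hs] using h3
  have i01 (s) (hs : s ∈ U) : (B s 0 1).re ^ 2 + (B s 0 1).im ^ 2 = 1 := by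
    have := hre s hs
    rw [z00 s hs] at this
    linarith
  have z11 : B t 1 1 = 0 := by
    have h1 := (d01 t ht).complex_re
    have h2 : HasDerivAt (fun r => (B r 0 1).re) 0 t :=
      (hasDerivAt_const t (0 : ℝ)).congr_of_eventuallyEq
        (Filter.eventually_of_mem (hU.mem_nhds ht) z01)
    have h3 := h1.unique h2
    simp [h11 t ht, z00 t ht, h00 t ht, h.ne_zero t ht] at h3
    exact Complex.ext h3 (h11 t ht)
  have e00 : B t 0 0 = 0 := Complex.ext (z00 t ht) (h00 t ht)
  have i := i01 t ht
  rw [z01 t ht] at i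
  have i2 : ((B t 0 1).im - 1) * ((B t 0 1).im + 1) = 0 := by linear_combination i
  rcases mul_eq_zero.1 i2 with i3 | i3
  · right
    have e : B t = -baseJ := by
      ext a c
      fin_cases a <;> fin_cases c <;>
        simp [baseJ, e00, z11, h10 t ht, Complex.ext_iff, z01 t ht] <;> linarith
    rw [hγB t ht, e, proj]
    simp
  · left
    have e : B t = baseJ := by
      ext a c
      fin_cases a <;> fin_cases c <;>
        simp [baseJ, e00, z11, h10 t ht, Complex.ext_iff, z01 t ht] <;> linarith
    rw [hγB t ht, e, proj]

end IsAdaptedFrame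

/-! ### Canonical frames -/

theorem sq_eq_one_of_spin {ε : ℝ} (hε : ε = 1 ∨ ε = -1) : ε * ε = 1 := by
  rcases hε with rfl | rfl <;> norm_num

theorem ne_zero_of_spin {ε : ℝ} (hε : ε = 1 ∨ ε = -1) : ε ≠ 0 := by
  rcases hε with rfl | rfl <;> norm_num

namespace IsCanonicalFrame

variable {U : Set ℝ} {γ : ℝ → Mat2} {ε : ℝ} {Γ : ℝ → Mat2}

theorem mono (h : IsCanonicalFrame U γ ε Γ) {U' : Set ℝ} (hs : U' ⊆ U) :
    IsCanonicalFrame U' γ ε Γ where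
  spin := h.spin
  smooth := h.smooth.mono hs
  det_eq_one t ht := h.det_eq_one t (hs ht)
  frame t ht := h.frame t (hs ht)
  theta11 t ht := h.theta11 t (hs ht)
  theta12 t ht := h.theta12 t (hs ht)
  theta21 t ht := h.theta21 t (hs ht)
  phi12 t ht := h.phi12 t (hs ht)
  phi11 t ht := h.phi11 t (hs ht)

theorem isAdaptedFrame (h : IsCanonicalFrame U γ ε Γ) :
    IsAdaptedFrame U Γ fun t => ε * arcElt Γ t where
  smooth := h.smooth
  det_eq_one := h.det_eq_one
  form00 t ht := Complex.ext (h.phi11 t ht) (h.theta11 t ht)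
  form01 t ht := Complex.ext (by rw [h.phi12 t ht, Complex.ofReal_re, arcElt])
    (by rw [h.theta12 t ht, Complex.ofReal_im])
  ne_zero t ht := mul_ne_zero (ne_zero_of_spin h.spin) (h.theta21 t ht)

theorem form10 (h : IsCanonicalFrame U γ ε Γ) {t : ℝ} (ht : t ∈ U) :
    frameForm Γ t 1 0 = (frameCurv Γ t + Complex.I) * arcElt Γ t := by
  have h1 : (frameForm Γ t 1 0).im ≠ 0 := h.theta21 t ht
  apply Complex.ext
  · simp [frameCurv, arcElt, h1]
  · simp [frameCurv, arcElt]

theorem contDiffOn_arcElt (h : IsCanonicalFrame U γ ε Γ) (hU : IsOpen U) :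
    ContDiffOn ℝ ∞ (arcElt Γ) U :=
  (contDiffOn_matrix_iff.1 (contDiffOn_frameForm hU h.smooth) 1 0).complex_im

theorem contDiffOn_frameCurv (h : IsCanonicalFrame U γ ε Γ) (hU : IsOpen U) :
    ContDiffOn ℝ ∞ (frameCurv Γ) U :=
  (contDiffOn_matrix_iff.1 (contDiffOn_frameForm hU h.smooth) 1 0).complex_re.div
    (h.contDiffOn_arcElt hU) h.theta21

theorem contDiffOn_arcDeriv (h : IsCanonicalFrame U γ ε Γ) (hU : IsOpen U) {f : ℝ → ℝ}
    (hf : ContDiffOn ℝ ∞ f U) : ContDiffOn ℝ ∞ (arcDeriv Γ f) U :=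
  (hf.deriv_infty hU).div (h.contDiffOn_arcElt hU) h.theta21

theorem hasDerivAt_arcDeriv (h : IsCanonicalFrame U γ ε Γ) (hU : IsOpen U) {f : ℝ → ℝ}
    (hf : ContDiffOn ℝ ∞ f U) {t : ℝ} (ht : t ∈ U) :
    HasDerivAt f (arcDeriv Γ f t * arcElt Γ t) t := by
  have h1 : arcElt Γ t ≠ 0 := h.theta21 t ht
  rw [arcDeriv, div_mul_cancel₀ _ h1]
  exact hf.hasDerivAt_infty hU ht

end IsCanonicalFrame

theorem IsAdaptedFrame.isCanonicalFrame {U : Set ℝ} {γ : ℝ → Mat2} {ε : ℝ} {Γ : ℝ → Mat2}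
    {σ : ℝ → ℝ} (h : IsAdaptedFrame U Γ fun t => ε * σ t) (hU : IsOpen U)
    (hε : ε = 1 ∨ ε = -1) (hγ : ∀ t ∈ U, γ t = proj (Γ t))
    (hd : ∀ t ∈ U,
      HasDerivAt γ (Γ t * !![0, 0; 0, ((2 * σ t : ℝ) : ℂ)] * (Γ t).conjTranspose) t) :
    IsCanonicalFrame U γ ε Γ ∧ ∀ t ∈ U, arcElt Γ t = σ t := by
  have harc (t) (ht : t ∈ U) : arcElt Γ t = σ t := by
    have h1 := ((h.hasDerivAt_proj hU ht).congr_of_eventuallyEq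
      (Filter.eventually_of_mem (hU.mem_nhds ht) hγ)).unique (hd t ht)
    rw [congr_eq_iff (h.det_eq_one t ht)] at h1
    have h2 := congrFun (congrFun h1 1) 1
    simpa using congrArg Complex.re h2
  refine ⟨?_, harc⟩
  exact {
    spin := hε
    smooth := h.smooth
    det_eq_one := h.det_eq_one
    frame := hγ
    theta11 := fun t ht => by rw [h.form00 t ht, Complex.zero_im]
    theta12 := fun t ht => by rw [h.form01 t ht, Complex.ofReal_im]
    theta21 := fun t ht => by
      change arcElt Γ t ≠ 0
      rw [harc t ht]
      exact right_ne_zero_of_mul (h.ne_zero t ht)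
    phi12 := fun t ht => by
      rw [h.form01 t ht, Complex.ofReal_re, ← harc t ht, arcElt]
    phi11 := fun t ht => by rw [h.form00 t ht, Complex.zero_re] }

/-- The stabilizer of `J` in `SL(2,ℂ)` is `SL(2,ℝ)`. -/
theorem im_eq_zero_of_proj_eq {B : Mat2} (hB : B.det = 1) (h : proj B = baseJ) (i j : Fin 2) :
    (B i j).im = 0 := by
  have h1 : B * baseJ = baseJ * B.adjugate.conjTranspose := by
    have e : B.conjTranspose * B.adjugate.conjTranspose = 1 := by
      rw [← Matrix.conjTranspose_mul, adjugate_mul_of_det hB, Matrix.conjTranspose_one]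
    calc B * baseJ = B * baseJ * (B.conjTranspose * B.adjugate.conjTranspose) := by
          rw [e, Matrix.mul_one]
      _ = proj B * B.adjugate.conjTranspose := by simp only [proj, Matrix.mul_assoc]
      _ = _ := by rw [h]
  rw [← Complex.conj_eq_iff_im]
  have e00 := congrFun (congrFun h1 0) 1
  have e01 := congrFun (congrFun h1 0) 0
  have e10 := congrFun (congrFun h1 1) 1
  have e11 := congrFun (congrFun h1 1) 0
  simp only [Matrix.mul_apply, Fin.sum_univ_two, Matrix.conjTranspose_apply,
    Matrix.adjugate_fin_two] at e00 e01 e10 e11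
  simp [baseJ] at e00 e01 e10 e11
  have hI : Complex.I * -Complex.I = 1 := by simp
  fin_cases i <;> fin_cases j <;> simp
  · linear_combination e00 * Complex.I + (B 0 0 - (starRingEnd ℂ) (B 0 0)) * hI
  · linear_combination e01 * Complex.I + (B 0 1 - (starRingEnd ℂ) (B 0 1)) * hI
  · linear_combination e10 * Complex.I + (B 1 0 - (starRingEnd ℂ) (B 1 0)) * hI
  · linear_combination e11 * Complex.I + (B 1 1 - (starRingEnd ℂ) (B 1 1)) * hI

/-- The pseudo-arc element and the curvature do not depend on the canonical frame. -/
theorem IsCanonicalFrame.arcElt_frameCurv_unique {U U' : Set ℝ} {γ : ℝ → Mat2} {ε ε' : ℝ}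
    {Γ Γ' : ℝ → Mat2} (hU : IsOpen U) (hU' : IsOpen U') (h₀ : IsCanonicalFrame U γ ε Γ)
    (h₀' : IsCanonicalFrame U' γ ε' Γ') {t : ℝ} (ht₀ : t ∈ U) (ht₀' : t ∈ U') :
    arcElt Γ t = arcElt Γ' t ∧ frameCurv Γ t = frameCurv Γ' t := by
  have hO : IsOpen (U ∩ U') := hU.inter hU'
  have h := h₀.mono (inter_subset_left (s := U) (t := U'))
  have h' := h₀'.mono (inter_subset_right (s := U) (t := U'))
  have ht : t ∈ U ∩ U' := ⟨ht₀, ht₀'⟩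
  set B : ℝ → Mat2 := fun s => (Γ s).adjugate * Γ' s with hB
  have hΓB (s) (hs : s ∈ U ∩ U') : Γ' s = Γ s * B s := by
    rw [hB, ← Matrix.mul_assoc, mul_adjugate_of_det (h.det_eq_one s hs), Matrix.one_mul]
  have hdet (s) (hs : s ∈ U ∩ U') : (B s).det = 1 := by
    rw [hB, Matrix.det_mul, Matrix.det_adjugate, h.det_eq_one s hs, h'.det_eq_one s hs]; simp
  have hreal (s) (hs : s ∈ U ∩ U') : ∀ i j, (B s i j).im = 0 := by
    refine im_eq_zero_of_proj_eq (hdet s hs) ?_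
    have e := (h.frame s hs).symm.trans (h'.frame s hs)
    rw [hΓB s hs] at e
    have e2 : proj (Γ s * B s) = Γ s * proj (B s) * (Γ s).conjTranspose := by
      simp only [proj, Matrix.conjTranspose_mul, Matrix.mul_assoc]
    rw [e2, proj, congr_eq_iff (h.det_eq_one s hs)] at e
    exact e.symm
  have hBd (s) (hs : s ∈ U ∩ U') : HasDerivAt B
      (B s * !![0, ((ε' * arcElt Γ' s : ℝ) : ℂ); frameForm Γ' s 1 0, 0]
        - !![0, ((ε * arcElt Γ s : ℝ) : ℂ); frameForm Γ s 1 0, 0] * B s) s := by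
    refine ((h.isAdaptedFrame.hasDerivAt hO hs).adjugate.matrix_mul
      (h'.isAdaptedFrame.hasDerivAt hO hs)).congr_deriv ?_
    rw [Matrix.adjugate_mul_distrib, hB, Matrix.mul_assoc, ← Matrix.mul_assoc _ (Γ' s)]
    have : Matrix.adjugate !![0, ((ε * arcElt Γ s : ℝ) : ℂ); frameForm Γ s 1 0, 0]
        = -!![0, ((ε * arcElt Γ s : ℝ) : ℂ); frameForm Γ s 1 0, 0] := by
      ext i j; fin_cases i <;> fin_cases j <;> simp [Matrix.adjugate_fin_two]
    rw [this, Matrix.neg_mul]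
    abel
  have hBe (s) (hs : s ∈ U ∩ U') := hasDerivAt_matrix_iff.1 (hBd s hs)
  simp only [Matrix.sub_apply, Matrix.mul_apply, Fin.sum_univ_two] at hBe
  have im_zero (i j) (s) (hs : s ∈ U ∩ U') (c : ℂ) (hc : HasDerivAt (fun r => B r i j) c s) :
      c.im = 0 :=
    hc.complex_im.unique ((hasDerivAt_const s (0 : ℝ)).congr_of_eventuallyEq
      (Filter.eventually_of_mem (hO.mem_nhds hs) fun r hr => hreal r hr i j))
  have const_zero (f : ℝ → ℝ) (c d s : ℝ) (hs : s ∈ U ∩ U') (hf : ∀ r ∈ U ∩ U', f r = d)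
      (hc : HasDerivAt f c s) : c = 0 :=
    hc.unique ((hasDerivAt_const s d).congr_of_eventuallyEq
      (Filter.eventually_of_mem (hO.mem_nhds hs) hf))
  have arc (s) (hs : s ∈ U ∩ U') : (frameForm Γ s 1 0).im = arcElt Γ s ∧ arcElt Γ s ≠ 0 :=
    ⟨rfl, h.theta21 s hs⟩
  have arc' (s) (hs : s ∈ U ∩ U') : (frameForm Γ' s 1 0).im = arcElt Γ' s ∧ arcElt Γ' s ≠ 0 :=
    ⟨rfl, h'.theta21 s hs⟩
  have b01 (s) (hs : s ∈ U ∩ U') : (B s 0 1).re = 0 := by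
    have := im_zero 0 0 s hs _ (hBe s hs 0 0)
    simpa [hreal s hs, (arc' s hs).1, (arc' s hs).2] using this
  have det_re (s) (hs : s ∈ U ∩ U') : (B s 0 0).re * (B s 1 1).re = 1 := by
    have := congrArg Complex.re (hdet s hs)
    simpa [Matrix.det_fin_two, hreal s hs, b01 s hs] using this
  have r10 (s) (hs : s ∈ U ∩ U') : (B s 1 1).re * arcElt Γ' s = arcElt Γ s * (B s 0 0).re := by
    have := im_zero 1 0 s hs _ (hBe s hs 1 0)
    simp [hreal s hs, (arc' s hs).1, (arc s hs).1] at this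
    linarith
  have r01 (s) (hs : s ∈ U ∩ U') :
      (B s 0 0).re * (ε' * arcElt Γ' s) = ε * arcElt Γ s * (B s 1 1).re := by
    have := const_zero _ _ 0 s hs b01 (hBe s hs 0 1).complex_re
    simp [hreal s hs] at this
    linarith
  have sq (s) (hs : s ∈ U ∩ U') : (B s 0 0).re ^ 2 = 1 := by
    have e1 : ε' * (B s 0 0).re ^ 4 = ε := by
      apply mul_right_cancel₀ (arc s hs).2
      linear_combination (B s 0 0).re * r01 s hs + ε * arcElt Γ s * det_re s hs
        - ε' * (B s 0 0).re ^ 3 * r10 s hs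
        + ε' * (B s 0 0).re ^ 2 * arcElt Γ' s * det_re s hs
    rcases h.spin with rfl | rfl <;> rcases h'.spin with rfl | rfl <;>
      nlinarith [sq_nonneg ((B s 0 0).re ^ 2), sq_nonneg ((B s 0 0).re)]
  have harc (s) (hs : s ∈ U ∩ U') : arcElt Γ s = arcElt Γ' s := by
    linear_combination -arcElt Γ s * sq s hs - (B s 0 0).re * r10 s hs
      + arcElt Γ' s * det_re s hs
  have b10 (s) (hs : s ∈ U ∩ U') : (B s 1 0).re = 0 := by
    have d := (hBe s hs 0 0).complex_re
    have := const_zero _ _ 1 s hs sq (d.pow 2)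
    have hne : (B s 0 0).re ≠ 0 := left_ne_zero_of_mul (a := (B s 0 0).re) (b := (B s 1 1).re)
      (by rw [det_re s hs]; exact one_ne_zero)
    simpa [hreal s hs, b01 s hs, hne, (arc s hs).2, ne_zero_of_spin h.spin] using this
  have hk : frameCurv Γ t = frameCurv Γ' t := by
    have := const_zero _ _ 0 t ht b10 (hBe t ht 1 0).complex_re
    simp [hreal t ht, h.form10 ht, h'.form10 ht, harc t ht] at this
    have h11 : (B t 1 1).re = (B t 0 0).re := by
      linear_combination (B t 0 0).re * det_re t ht - (B t 1 1).re * sq t ht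
    rw [h11] at this
    have hne : (B t 0 0).re ≠ 0 := left_ne_zero_of_mul (a := (B t 0 0).re) (b := (B t 1 1).re)
      (by rw [det_re t ht]; exact one_ne_zero)
    have : (B t 0 0).re * arcElt Γ' t * (frameCurv Γ t - frameCurv Γ' t) = 0 := by
      linear_combination -this
    have := (mul_eq_zero.1 this).resolve_left (mul_ne_zero hne (arc' t ht).2)
    linarith
  exact ⟨harc t ht, hk⟩

/-! ### The frame determined by its second column -/

/-- The matrix with columns `v' / b` and `v`. -/
noncomputable def colFrame (v v' : Fin 2 → ℂ) (b : ℝ) : Mat2 :=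
  !![v' 0 / b, v 0; v' 1 / b, v 1]

theorem ContDiffOn.colFrame {E : Type*} [NormedAddCommGroup E] [NormedSpace ℝ E] {s : Set E}
    {n : ℕ∞ω} {v v' : E → Fin 2 → ℂ} {b : E → ℝ} (hv : ContDiffOn ℝ n v s)
    (hv' : ContDiffOn ℝ n v' s) (hb : ContDiffOn ℝ n b s) (hb0 : ∀ x ∈ s, b x ≠ 0) :
    ContDiffOn ℝ n (fun x => colFrame (v x) (v' x) (b x)) s := by
  rw [contDiffOn_pi] at hv hv'
  rw [contDiffOn_matrix_iff]
  have hb' : ∀ x ∈ s, ((b x : ℝ) : ℂ) ≠ 0 := fun x hx => by exact_mod_cast hb0 x hx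
  intro i j
  fin_cases i <;> fin_cases j <;> simp [_root_.colFrame]
  · simpa [div_eq_mul_inv] using (hv' 0).mul (hb.complex_ofReal.inv hb')
  · exact hv 0
  · simpa [div_eq_mul_inv] using (hv' 1).mul (hb.complex_ofReal.inv hb')
  · exact hv 1

theorem isAdaptedFrame_colFrame {U : Set ℝ} (hU : IsOpen U) {v v' : ℝ → Fin 2 → ℂ} {b : ℝ → ℝ}
    (hv : ContDiffOn ℝ ∞ v U) (hv' : ContDiffOn ℝ ∞ v' U) (hb : ContDiffOn ℝ ∞ b U)
    (hb0 : ∀ t ∈ U, b t ≠ 0) (hd : ∀ t ∈ U, HasDerivAt v (v' t) t)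
    (hdet : ∀ t ∈ U, v' t 0 * v t 1 - v' t 1 * v t 0 = b t) :
    IsAdaptedFrame U (fun t => colFrame (v t) (v' t) (b t)) b := by
  have hs := hv.colFrame hv' hb hb0
  have hdet1 : ∀ t ∈ U, (colFrame (v t) (v' t) (b t)).det = 1 := by
    intro t ht
    have hb' : (b t : ℂ) ≠ 0 := by exact_mod_cast hb0 t ht
    rw [Matrix.det_fin_two]
    simp only [colFrame, Matrix.of_apply, Matrix.cons_val_zero, Matrix.cons_val_one,
      Matrix.cons_val', Matrix.cons_val_fin_one]
    field_simp
    linear_combination hdet t ht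
  have hcol (t) (ht : t ∈ U) (i : Fin 2) :
      deriv (fun t => colFrame (v t) (v' t) (b t)) t i 1 = v' t i := by
    have h1 := hasDerivAt_matrix_iff.1 (hs.hasDerivAt_infty hU ht) i 1
    have h2 : HasDerivAt (fun s => colFrame (v s) (v' s) (b s) i 1) (v' t i) t := by
      have := hasDerivAt_pi.1 (hd t ht) i
      fin_cases i <;> simpa [colFrame] using this
    exact h1.unique h2
  refine ⟨hs, hdet1, fun t ht => ?_, fun t ht => ?_, hb0⟩
  · have h1 := trace_maurerCartan_eq_zero (hs.hasDerivAt_infty hU ht)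
      (Filter.eventually_of_mem (hU.mem_nhds ht) hdet1)
    have h2 : frameForm (fun t => colFrame (v t) (v' t) (b t)) t 1 1 = 0 := by
      rw [frameForm, maurerCartan, Matrix.mul_apply, Fin.sum_univ_two, hcol t ht, hcol t ht]
      simp only [Matrix.adjugate_fin_two, colFrame, Matrix.of_apply, Matrix.cons_val_zero,
        Matrix.cons_val_one, Matrix.cons_val', Matrix.cons_val_fin_one]
      ring
    exact ((congrArg (_ + ·) h2).trans (add_zero _)).symm.trans h1
  · rw [frameForm, maurerCartan, Matrix.mul_apply, Fin.sum_univ_two, hcol t ht, hcol t ht,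
      ← hdet t ht]
    simp only [Matrix.adjugate_fin_two, colFrame, Matrix.of_apply, Matrix.cons_val_zero,
        Matrix.cons_val_one, Matrix.cons_val', Matrix.cons_val_fin_one]
    ring

/-! ### Existence of canonical frames -/

/-- Rescaling the direction `w` of the velocity of a null curve gives an adapted frame. -/
theorem isAdaptedFrame_smul {U : Set ℝ} (hU : IsOpen U) {γ : ℝ → Mat2} {w w' : ℝ → Fin 2 → ℂ}
    {l l' : ℝ → ℂ} {σ g : ℝ → ℝ} {ε : ℝ} (hε : ε = 1 ∨ ε = -1)
    (hw : ContDiffOn ℝ ∞ w U) (hw' : ContDiffOn ℝ ∞ w' U) (hl : ContDiffOn ℝ ∞ l U)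
    (hl' : ContDiffOn ℝ ∞ l' U) (hσ : ContDiffOn ℝ ∞ σ U) (hσ0 : ∀ t ∈ U, σ t ≠ 0)
    (dw : ∀ t ∈ U, HasDerivAt w (w' t) t) (dl : ∀ t ∈ U, HasDerivAt l (l' t) t)
    (hdet : ∀ t ∈ U, l t ^ 2 * (w' t 0 * w t 1 - w' t 1 * w t 0) = ((ε * σ t : ℝ) : ℂ))
    (hg : ∀ t ∈ U, g t = 2 * σ t * Complex.normSq (l t))
    (hγ : ∀ t ∈ U, HasDerivAt γ
      (Matrix.of fun i j => (g t : ℂ) * (w t i * (starRingEnd ℂ) (w t j))) t) :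
    IsAdaptedFrame U
      (fun t => colFrame (l t • w t) (l' t • w t + l t • w' t) (ε * σ t)) (fun t => ε * σ t) ∧
    ∀ t ∈ U, HasDerivAt γ (colFrame (l t • w t) (l' t • w t + l t • w' t) (ε * σ t)
      * !![0, 0; 0, ((2 * σ t : ℝ) : ℂ)]
      * (colFrame (l t • w t) (l' t • w t + l t • w' t) (ε * σ t)).conjTranspose) t := by
  constructor
  · refine isAdaptedFrame_colFrame hU (hl.smul hw) ((hl'.smul hw).add (hl.smul hw'))
      (contDiffOn_const.mul hσ) (fun t ht => mul_ne_zero (ne_zero_of_spin hε) (hσ0 t ht))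
      (fun t ht => ?_) fun t ht => ?_
    · refine ((dl t ht).smul (dw t ht)).congr_deriv ?_
      rw [add_comm]
    · rw [← hdet t ht]
      simp only [Pi.add_apply, Pi.smul_apply, smul_eq_mul]
      ring
  · intro t ht
    refine (hγ t ht).congr_deriv ?_
    ext i j
    rw [hg t ht]
    have hn : ((Complex.normSq (l t) : ℝ) : ℂ) = l t * (starRingEnd ℂ) (l t) :=
      (Complex.mul_conj _).symm
    fin_cases i <;> fin_cases j <;>
      simp only [Matrix.mul_apply, Fin.sum_univ_two, Matrix.conjTranspose_apply] <;>
      simp [colFrame, hn] <;> ring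

/-- A smooth nowhere zero complex function on an interval has a smooth square root. -/
theorem exists_contDiffOn_sq_eq {I : Set ℝ} (hIo : IsOpen I) (hIc : I.OrdConnected)
    {f : ℝ → ℂ} (hf : ContDiffOn ℝ ∞ f I) (hf0 : ∀ t ∈ I, f t ≠ 0) :
    ∃ l : ℝ → ℂ, ContDiffOn ℝ ∞ l I ∧ ∀ t ∈ I, l t ^ 2 = f t := by
  rcases I.eq_empty_or_nonempty with rfl | ⟨t₀, ht₀⟩
  · exact ⟨fun _ => 0, contDiffOn_const, fun t ht => ht.elim⟩
  have hq : ContDiffOn ℝ ∞ (fun t => deriv f t / f t) I := by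
    simpa [div_eq_mul_inv] using (hf.deriv_infty hIo).mul (hf.inv hf0)
  set L : ℝ → ℂ := fun t => ∫ s in t₀..t, deriv f s / f s with hL
  have dL (t) (ht : t ∈ I) : HasDerivAt L (deriv f t / f t) t := by
    have hsub : uIcc t₀ t ⊆ I := hIc.uIcc_subset ht₀ ht
    refine intervalIntegral.integral_hasDerivAt_right
      ((hq.continuousOn.mono hsub).intervalIntegrable) ?_
      (hq.continuousOn.continuousAt (hIo.mem_nhds ht))
    exact hq.continuousOn.stronglyMeasurableAtFilter hIo _ ht
  have hLs : ContDiffOn ℝ ∞ L I := by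
    rw [contDiffOn_infty_iff_deriv_of_isOpen hIo]
    refine ⟨fun t ht => (dL t ht).differentiableAt.differentiableWithinAt, ?_⟩
    exact hq.congr fun t ht => (dL t ht).deriv
  have hconst (t) (ht : t ∈ I) : f t * Complex.exp (-L t) = f t₀ * Complex.exp (-L t₀) := by
    have hd (s) (hs : s ∈ I) : HasDerivAt (fun t => f t * Complex.exp (-L t)) 0 s := by
      refine ((hf.hasDerivAt_infty hIo hs).mul (dL s hs).neg.cexp).congr_deriv ?_
      have := hf0 s hs
      field_simp
      ring
    exact hIo.is_const_of_deriv_eq_zero hIc.isPreconnected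
      (fun s hs => (hd s hs).differentiableAt.differentiableWithinAt)
      (fun s hs => (hd s hs).deriv) ht ht₀
  obtain ⟨z, hz⟩ := IsAlgClosed.exists_pow_nat_eq (f t₀ * Complex.exp (-L t₀)) (n := 2) two_pos
  refine ⟨fun t => z * Complex.exp (L t / 2), ?_, fun t ht => ?_⟩
  · exact contDiffOn_const.mul (Complex.contDiff_exp.comp_contDiffOn (hLs.div_const 2))
  · rw [mul_pow, hz, ← hconst t ht, ← Complex.exp_nat_mul, mul_assoc, ← Complex.exp_add]
    have : -L t + ((2 : ℕ) : ℂ) * (L t / 2) = 0 := by push_cast; ring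
    rw [this, Complex.exp_zero, mul_one]

/-- A smooth curve of nonzero matrices has a common vector outside all the kernels. -/
theorem exists_mulVec_ne_zero {I : Set ℝ} (hIc : I.OrdConnected) {M : ℝ → Mat2}
    (hM : ContDiffOn ℝ ∞ M I) (hM0 : ∀ t ∈ I, M t ≠ 0) :
    ∃ ξ : Fin 2 → ℂ, ∀ t ∈ I, (M t).mulVec ξ ≠ 0 := by
  have hMe := contDiffOn_matrix_iff.1 (hM.of_le (m := 1) (by exact_mod_cast le_top))
  set F : ℝ × ℂ → Fin 2 → ℂ := fun p => p.2 • ![M p.1 1 1, -M p.1 1 0] with hF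
  set G : ℝ × ℂ → Fin 2 → ℂ := fun p => p.2 • ![-M p.1 0 1, M p.1 0 0] with hG
  have hconv : Convex ℝ (I ×ˢ (univ : Set ℂ)) := (convex_iff_ordConnected.2 hIc).prod convex_univ
  have hc (i j) : ContDiffOn ℝ 1 (fun p : ℝ × ℂ => M p.1 i j) (I ×ˢ univ) :=
    (hMe i j).comp contDiffOn_fst fun p hp => hp.1
  have hFs : ContDiffOn ℝ 1 F (I ×ˢ univ) := by
    refine contDiffOn_snd.smul (contDiffOn_pi.2 fun i => ?_)
    fin_cases i
    · exact hc 1 1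
    · exact (hc 1 0).neg
  have hGs : ContDiffOn ℝ 1 G (I ×ˢ univ) := by
    refine contDiffOn_snd.smul (contDiffOn_pi.2 fun i => ?_)
    fin_cases i
    · exact (hc 0 1).neg
    · exact hc 0 0
  have hdim : dimH (I ×ˢ (univ : Set ℂ)) < (Module.finrank ℝ (Fin 2 → ℂ) : ENNReal) := by
    refine (dimH_mono (subset_univ _)).trans_lt ?_
    rw [Real.dimH_univ_eq_finrank, Module.finrank_prod, Module.finrank_pi_fintype]
    simp only [Module.finrank_self, Complex.finrank_real_complex, Finset.sum_const,
      Finset.card_univ, Fintype.card_fin]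
    norm_num
  have hbad : Dense (F '' (I ×ˢ univ) ∪ G '' (I ×ˢ univ))ᶜ := by
    refine dense_compl_of_dimH_lt_finrank ?_
    rw [dimH_union]
    exact max_lt ((hFs.dimH_image_le hconv Subset.rfl).trans_lt hdim)
      ((hGs.dimH_image_le hconv Subset.rfl).trans_lt hdim)
  obtain ⟨ξ, hξ⟩ := hbad.nonempty
  refine ⟨ξ, fun t ht h0 => hξ ?_⟩
  have r0 : M t 0 0 * ξ 0 + M t 0 1 * ξ 1 = 0 := by
    simpa [Matrix.mulVec, dotProduct, Fin.sum_univ_two] using congrFun h0 0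
  have r1 : M t 1 0 * ξ 0 + M t 1 1 * ξ 1 = 0 := by
    simpa [Matrix.mulVec, dotProduct, Fin.sum_univ_two] using congrFun h0 1
  have inF (r : ℂ) (h1 : ξ 0 = r * M t 1 1) (h2 : ξ 1 = -(r * M t 1 0)) :
      ξ ∈ F '' (I ×ˢ univ) := by
    refine ⟨(t, r), ⟨ht, mem_univ _⟩, ?_⟩
    ext i; fin_cases i <;> simp [hF, h1, h2]
  have inG (r : ℂ) (h1 : ξ 0 = -(r * M t 0 1)) (h2 : ξ 1 = r * M t 0 0) :
      ξ ∈ G '' (I ×ˢ univ) := by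
    refine ⟨(t, r), ⟨ht, mem_univ _⟩, ?_⟩
    ext i; fin_cases i <;> simp [hG, h1, h2]
  by_cases h11 : M t 1 1 = 0
  · by_cases h10 : M t 1 0 = 0
    · by_cases h01 : M t 0 1 = 0
      · have h00 : M t 0 0 ≠ 0 := by
          intro h00
          apply hM0 t ht
          ext i j; fin_cases i <;> fin_cases j <;> simp [h00, h01, h10, h11]
        right
        refine inG (ξ 1 / M t 0 0) ?_ (by field_simp)
        rw [h01] at r0 ⊢
        simpa [h00] using r0
      · right
        refine inG (-ξ 0 / M t 0 1) (by field_simp) ?_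
        field_simp
        linear_combination r0
    · left
      refine inF (-ξ 1 / M t 1 0) ?_ (by field_simp)
      field_simp
      linear_combination r1
  · left
    refine inF (ξ 0 / M t 1 1) (by field_simp) ?_
    field_simp
    linear_combination r1

/-- A singular Hermitian matrix is, up to a factor, the square of any of its values. -/
theorem mulVec_mul_conj {M : Mat2} (hM : M.IsHermitian) (hdet : M.det = 0) (η : Fin 2 → ℂ)
    (i j : Fin 2) :
    M.mulVec η i * (starRingEnd ℂ) (M.mulVec η j) = (star η ⬝ᵥ M.mulVec η) * M i j := by
  have h00 := hM.apply 0 0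
  have h01 := hM.apply 0 1
  have h10 := hM.apply 1 0
  have h11 := hM.apply 1 1
  rw [Matrix.det_fin_two] at hdet
  simp only [Complex.star_def] at h00 h01 h10 h11
  fin_cases i <;> fin_cases j <;>
    simp [Matrix.mulVec, dotProduct, Fin.sum_univ_two, h00, h01, h10, h11]
  · linear_combination -(η 1 * (starRingEnd ℂ) (η 1)) * hdet
  · linear_combination (η 0 * (starRingEnd ℂ) (η 1)) * hdet
  · linear_combination (η 1 * (starRingEnd ℂ) (η 0)) * hdet
  · linear_combination -(η 0 * (starRingEnd ℂ) (η 0)) * hdet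

theorem im_dotProduct_mulVec {M : Mat2} (hM : M.IsHermitian) (η : Fin 2 → ℂ) :
    (star η ⬝ᵥ M.mulVec η).im = 0 := by
  have h := hM.im_star_dotProduct_mulVec_self η
  simpa using h

section MulVec

variable {E : Type*} [NormedAddCommGroup E] [NormedSpace ℝ E] {s : Set E} {n : ℕ∞ω}

theorem ContDiffOn.matrix_mulVec {M : E → Mat2} {η : E → Fin 2 → ℂ} (hM : ContDiffOn ℝ n M s)
    (hη : ContDiffOn ℝ n η s) : ContDiffOn ℝ n (fun x => (M x).mulVec (η x)) s := by
  rw [contDiffOn_matrix_iff] at hM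
  rw [contDiffOn_pi] at hη ⊢
  intro i
  simp only [Matrix.mulVec, dotProduct, Fin.sum_univ_two]
  exact ((hM i 0).mul (hη 0)).add ((hM i 1).mul (hη 1))

theorem ContDiffOn.star_dotProduct_mulVec {M : E → Mat2} {η : E → Fin 2 → ℂ}
    (hM : ContDiffOn ℝ n M s) (hη : ContDiffOn ℝ n η s) :
    ContDiffOn ℝ n (fun x => (star (η x) ⬝ᵥ (M x).mulVec (η x)).re) s := by
  have h := contDiffOn_pi.1 (hM.matrix_mulVec hη)
  rw [contDiffOn_pi] at hη
  simp only [dotProduct, Fin.sum_univ_two]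
  exact (((contDiffOn_conj (hη 0)).mul (h 0)).add ((contDiffOn_conj (hη 1)).mul (h 1))).complex_re

end MulVec

/-- If `η* M η ≠ 0`, the singular Hermitian matrix `M` is `(η* M η)⁻¹ (M η) (M η)*`. -/
theorem eq_inv_mul_mulVec {M : Mat2} (hM : M.IsHermitian) (hdet : M.det = 0) {η : Fin 2 → ℂ}
    (h0 : (star η ⬝ᵥ M.mulVec η).re ≠ 0) :
    M = Matrix.of fun i j => (((star η ⬝ᵥ M.mulVec η).re⁻¹ : ℝ) : ℂ)
      * (M.mulVec η i * (starRingEnd ℂ) (M.mulVec η j)) := by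
  have e : star η ⬝ᵥ M.mulVec η = (((star η ⬝ᵥ M.mulVec η).re : ℝ) : ℂ) :=
    Complex.ext rfl (im_dotProduct_mulVec hM η)
  ext i j
  rw [Matrix.of_apply, mulVec_mul_conj hM hdet, ← mul_assoc, e, Complex.ofReal_re,
    ← Complex.ofReal_mul, inv_mul_cancel₀ h0, Complex.ofReal_one, one_mul]

theorem re_dotProduct_mulVec_ne_zero {M : Mat2} (hM : M.IsHermitian) (hdet : M.det = 0)
    {η : Fin 2 → ℂ} (h0 : M.mulVec η ≠ 0) : (star η ⬝ᵥ M.mulVec η).re ≠ 0 := by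
  intro h
  apply h0
  have e : star η ⬝ᵥ M.mulVec η = 0 := Complex.ext h (im_dotProduct_mulVec hM η)
  ext i
  have := mulVec_mul_conj hM hdet η i i
  rw [e, zero_mul, Complex.mul_conj] at this
  simpa using this

namespace IsNullCurve

variable {I : Set ℝ} {γ : ℝ → Mat2}

theorem hasDerivAt (h : IsNullCurve I γ) (hI : IsOpen I) {t : ℝ} (ht : t ∈ I) :
    HasDerivAt γ (deriv γ t) t :=
  h.smooth.hasDerivAt_infty hI ht

theorem isHermitian_deriv (h : IsNullCurve I γ) (hI : IsOpen I) {t : ℝ} (ht : t ∈ I) :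
    (deriv γ t).IsHermitian := by
  have h1 := (h.hasDerivAt hI ht).conjTranspose
  have h2 : HasDerivAt (fun s => (γ s).conjTranspose) (deriv γ t) t :=
    (h.hasDerivAt hI ht).congr_of_eventuallyEq
      (Filter.eventually_of_mem (hI.mem_nhds ht) fun s hs => (h.mem s hs).1)
  exact h1.unique h2

theorem det_deriv (h : IsNullCurve I γ) (hI : IsOpen I) {t : ℝ} (ht : t ∈ I) :
    (deriv γ t).det = 0 := by
  have hH := h.isHermitian_deriv hI ht
  have h0 := h.null t ht
  have im : (deriv γ t).det.im = 0 := by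
    rw [← Complex.conj_eq_iff_im]
    have := Matrix.det_conjTranspose (deriv γ t)
    rw [hH.eq] at this
    exact this.symm
  refine Complex.ext ?_ im
  rw [lorentz_apply] at h0
  rw [Matrix.det_fin_two]
  simp at h0 ⊢
  linarith

theorem deriv_ne_zero (h : IsNullCurve I γ) {t : ℝ} (ht : t ∈ I) : deriv γ t ≠ 0 :=
  (h.noFlex t ht).ne_zero 0

theorem lorentz_deriv_self (h : IsNullCurve I γ) (hI : IsOpen I) {t : ℝ} (ht : t ∈ I) :
    lorentz (deriv γ t) (γ t) = 0 := by
  have d := hasDerivAt_matrix_iff.1 (h.hasDerivAt hI ht)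
  have h1 := (((d 0 0).mul (d 1 1)).sub ((d 0 1).mul (d 1 0))).complex_re
  have h2 : HasDerivAt (fun s => (γ s 0 0 * γ s 1 1 - γ s 0 1 * γ s 1 0).re) 0 t :=
    (hasDerivAt_const t (-1 : ℝ)).congr_of_eventuallyEq
      (Filter.eventually_of_mem (hI.mem_nhds ht) fun s hs => by
        have := congrArg Complex.re (h.mem s hs).2
        rw [Matrix.det_fin_two] at this
        simpa using this)
  have h3 := h1.unique h2
  rw [lorentz_apply]
  simp at h3 ⊢
  linarith

/-- The direction of the velocity of a null curve without flex points is an immersion. -/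
theorem wronskian_ne_zero (h : IsNullCurve I γ) (hI : IsOpen I) {w : ℝ → Fin 2 → ℂ}
    {w' : Fin 2 → ℂ} {g : ℝ → ℝ} {g' t : ℝ} (ht : t ∈ I)
    (hγ : ∀ s ∈ I, deriv γ s
      = Matrix.of fun i j => (g s : ℂ) * (w s i * (starRingEnd ℂ) (w s j)))
    (dw : HasDerivAt w w' t) (dg : HasDerivAt g g' t) :
    w' 0 * w t 1 - w' 1 * w t 0 ≠ 0 := by
  intro h0
  have hne := h.deriv_ne_zero ht
  have hg : g t ≠ 0 := by
    intro hg
    apply hne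
    rw [hγ t ht]
    ext i j
    simp [hg]
  have hw : ∃ r : ℂ, w' = r • w t := by
    by_cases h00 : w t 0 = 0
    · have h11 : w t 1 ≠ 0 := by
        intro h11
        apply hne
        rw [hγ t ht]
        ext i j
        fin_cases i <;> simp [h00, h11]
      refine ⟨w' 1 / w t 1, ?_⟩
      ext i
      fin_cases i
      · rw [h00, mul_zero, sub_zero] at h0
        simpa [h00, h11] using h0
      · simp [h11]
    · refine ⟨w' 0 / w t 0, ?_⟩
      ext i
      fin_cases i
      · simp [h00]
      · simp
        field_simp
        linear_combination -h0
  obtain ⟨r, rfl⟩ := hw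
  have dw' := hasDerivAt_pi.1 dw
  have d2 : HasDerivAt (deriv γ) ((g' / g t + 2 * r.re) • deriv γ t) t := by
    have e : deriv γ =ᶠ[𝓝 t] fun s =>
        Matrix.of fun i j => (g s : ℂ) * (w s i * (starRingEnd ℂ) (w s j)) :=
      Filter.eventually_of_mem (hI.mem_nhds ht) hγ
    refine HasDerivAt.congr_of_eventuallyEq ?_ e
    refine hasDerivAt_matrix_iff.2 fun i j => ?_
    refine (dg.ofReal_comp.mul ((dw' i).mul (hasDerivAt_conj (dw' j)))).congr_deriv ?_
    rw [hγ t ht]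
    have hr : ((2 * r.re : ℝ) : ℂ) = r + (starRingEnd ℂ) r := (Complex.add_conj r).symm
    have hgc : (g t : ℂ) ≠ 0 := by exact_mod_cast hg
    rw [Matrix.smul_apply, Complex.real_smul, Complex.ofReal_add, hr, Matrix.of_apply,
      Complex.ofReal_div]
    simp only [Pi.mul_apply, Pi.smul_apply, smul_eq_mul, map_mul]
    field_simp
  have e2 : deriv (deriv γ) t = (g' / g t + 2 * r.re) • deriv γ t := d2.deriv
  have hl : lorentz (deriv (deriv γ) t) (γ t) = 0 := by
    have h1 := h.lorentz_deriv_self hI ht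
    rw [e2]
    rw [lorentz_apply] at h1 ⊢
    simp at h1 ⊢
    linear_combination (g' / g t + 2 * r.re) * h1
  have hLI := LinearIndependent.pair_iff.1 (h.noFlex t ht) (g' / g t + 2 * r.re) (-1) (by
    rw [covAccel, hl, zero_smul, sub_zero, e2]
    simp)
  simp at hLI

end IsNullCurve

theorem proj_colFrame_I_smul (v v' : Fin 2 → ℂ) (b : ℝ) :
    proj (colFrame (Complex.I • v) (Complex.I • v') (-b)) = -proj (colFrame v v' b) := by
  have hI : (starRingEnd ℂ) Complex.I = -Complex.I := Complex.conj_I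
  have e : colFrame (Complex.I • v) (Complex.I • v') (-b)
      = colFrame v v' b * !![-Complex.I, 0; 0, Complex.I] := by
    ext i j
    fin_cases i <;> fin_cases j <;> simp [colFrame] <;> ring
  have e2 : !![-Complex.I, 0; 0, Complex.I] * baseJ
      * (!![-Complex.I, 0; 0, Complex.I] : Mat2).conjTranspose = -baseJ := by
    ext i j
    fin_cases i <;> fin_cases j <;>
      simp only [Matrix.mul_apply, Fin.sum_univ_two, Matrix.conjTranspose_apply] <;>
      simp [baseJ]
  rw [e, proj, proj, Matrix.conjTranspose_mul]
  calc _ = colFrame v v' b * (!![-Complex.I, 0; 0, Complex.I] * baseJ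
      * (!![-Complex.I, 0; 0, Complex.I] : Mat2).conjTranspose)
      * (colFrame v v' b).conjTranspose := by simp only [Matrix.mul_assoc]
    _ = _ := by rw [e2]; simp

/-- Every null curve without flex points on an interval has a canonical frame. -/
theorem IsNullCurve.exists_isCanonicalFrame {I : Set ℝ} {γ : ℝ → Mat2} (h : IsNullCurve I γ)
    (hIo : IsOpen I) (hIc : I.OrdConnected) :
    ∃ (ε : ℝ) (Γ : ℝ → Mat2), IsCanonicalFrame I γ ε Γ := by
  have hγ' : ContDiffOn ℝ ∞ (deriv γ) I := h.smooth.deriv_infty hIo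
  obtain ⟨ξ, hξ⟩ := exists_mulVec_ne_zero hIc hγ' fun t ht => h.deriv_ne_zero ht
  set w : ℝ → Fin 2 → ℂ := fun t => (deriv γ t).mulVec ξ with hw
  set g : ℝ → ℝ := fun t => (star ξ ⬝ᵥ (deriv γ t).mulVec ξ).re⁻¹ with hg
  have hθ0 (t) (ht : t ∈ I) : (star ξ ⬝ᵥ (deriv γ t).mulVec ξ).re ≠ 0 :=
    re_dotProduct_mulVec_ne_zero (h.isHermitian_deriv hIo ht) (h.det_deriv hIo ht) (hξ t ht)
  have hg0 (t) (ht : t ∈ I) : g t ≠ 0 := inv_ne_zero (hθ0 t ht)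
  have sg : ContDiffOn ℝ ∞ g I := (hγ'.star_dotProduct_mulVec contDiffOn_const).inv hθ0
  have sw : ContDiffOn ℝ ∞ w I := hγ'.matrix_mulVec contDiffOn_const
  have sw' : ContDiffOn ℝ ∞ (deriv w) I := sw.deriv_infty hIo
  have hγw (t) (ht : t ∈ I) : deriv γ t
      = Matrix.of fun i j => (g t : ℂ) * (w t i * (starRingEnd ℂ) (w t j)) :=
    eq_inv_mul_mulVec (h.isHermitian_deriv hIo ht) (h.det_deriv hIo ht) (hθ0 t ht)
  set f : ℝ → ℂ := fun t => deriv w t 0 * w t 1 - deriv w t 1 * w t 0 with hf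
  have sf : ContDiffOn ℝ ∞ f I := by
    have h1 := contDiffOn_pi.1 sw
    have h2 := contDiffOn_pi.1 sw'
    exact ((h2 0).mul (h1 1)).sub ((h2 1).mul (h1 0))
  have hf0 (t) (ht : t ∈ I) : f t ≠ 0 :=
    h.wronskian_ne_zero hIo ht hγw (sw.hasDerivAt_infty hIo ht) (sg.hasDerivAt_infty hIo ht)
  set ρ : ℝ → ℝ := fun t => Complex.normSq (f t) / (4 * g t ^ 2) with hρ
  have hρ0 (t) (ht : t ∈ I) : 0 < ρ t :=
    div_pos (Complex.normSq_pos.2 (hf0 t ht)) (by have := hg0 t ht; positivity)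
  have sρ : ContDiffOn ℝ ∞ ρ I := by
    have : ContDiffOn ℝ ∞ (fun t => Complex.normSq (f t)) I := by
      simp only [Complex.normSq_apply]
      exact (sf.complex_re.mul sf.complex_re).add (sf.complex_im.mul sf.complex_im)
    exact this.div (contDiffOn_const.mul (sg.pow 2)) fun t ht => by
      have := hg0 t ht; positivity
  have hr0 (t) (ht : t ∈ I) : 0 < √(√(ρ t)) := Real.sqrt_pos.2 (Real.sqrt_pos.2 (hρ0 t ht))
  set σ : ℝ → ℝ := fun t => g t * √(√(ρ t)) with hσ
  have sσ : ContDiffOn ℝ ∞ σ I :=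
    sg.mul ((sρ.sqrt fun t ht => (hρ0 t ht).ne').sqrt fun t ht =>
      (Real.sqrt_pos.2 (hρ0 t ht)).ne')
  have hσ0 (t) (ht : t ∈ I) : σ t ≠ 0 := mul_ne_zero (hg0 t ht) (hr0 t ht).ne'
  obtain ⟨l, sl, hl⟩ := exists_contDiffOn_sq_eq hIo hIc
    (f := fun t => (σ t : ℂ) / f t)
    (by simpa [div_eq_mul_inv] using sσ.complex_ofReal.mul (sf.inv hf0))
    (fun t ht => div_ne_zero (by exact_mod_cast hσ0 t ht) (hf0 t ht))
  have hgl (t) (ht : t ∈ I) : g t = 2 * σ t * Complex.normSq (l t) := by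
    have h1 : Complex.normSq (l t) ^ 2 = (σ t) ^ 2 / Complex.normSq (f t) := by
      rw [← map_pow, hl t ht, map_div₀, Complex.normSq_ofReal, sq]
    have hr4 : √(√(ρ t)) ^ 4 = ρ t := by
      rw [show √(√(ρ t)) ^ 4 = (√(√(ρ t)) ^ 2) ^ 2 by ring,
        Real.sq_sqrt (Real.sqrt_nonneg _), Real.sq_sqrt (hρ0 t ht).le]
    have hn : Complex.normSq (f t) ≠ 0 := (Complex.normSq_pos.2 (hf0 t ht)).ne'
    have h2 : (2 * √(√(ρ t)) * Complex.normSq (l t)) ^ 2 = 1 := by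
      rw [mul_pow, h1, hσ]
      have : (2 * √(√(ρ t))) ^ 2 * ((g t * √(√(ρ t))) ^ 2 / Complex.normSq (f t))
          = 4 * g t ^ 2 * √(√(ρ t)) ^ 4 / Complex.normSq (f t) := by ring
      rw [this, hr4, hρ]
      have := hg0 t ht
      field_simp
    have h3 : 2 * √(√(ρ t)) * Complex.normSq (l t) = 1 := by
      have h4 : 0 ≤ 2 * √(√(ρ t)) * Complex.normSq (l t) :=
        mul_nonneg (by positivity) (Complex.normSq_nonneg _)
      nlinarith
    rw [hσ]
    linear_combination -g t * h3
  have key (ε : ℝ) (hε : ε = 1 ∨ ε = -1) (m : ℝ → ℂ) (sm : ContDiffOn ℝ ∞ m I)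
      (hm : ∀ t ∈ I, m t ^ 2 * f t = ((ε * σ t : ℝ) : ℂ))
      (hgm : ∀ t ∈ I, g t = 2 * σ t * Complex.normSq (m t)) :=
    isAdaptedFrame_smul hIo hε sw sw' sm (sm.deriv_infty hIo) sσ hσ0
      (fun t ht => sw.hasDerivAt_infty hIo ht) (fun t ht => sm.hasDerivAt_infty hIo ht) hm hgm
      (fun t ht => (h.hasDerivAt hIo ht).congr_deriv (hγw t ht))
  have k1 := key 1 (Or.inl rfl) l sl (fun t ht => by
    rw [hl t ht, div_mul_cancel₀ _ (hf0 t ht), one_mul]) hgl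
  set Γ : ℝ → Mat2 := fun t => colFrame (l t • w t) (deriv l t • w t + l t • deriv w t) (1 * σ t)
    with hΓ
  have hpm (t) (ht : t ∈ I) := k1.1.eq_proj_or_neg hIo h.mem
    (fun t ht => mul_ne_zero two_ne_zero (hσ0 t ht)) k1.2 ht
  set B : ℝ → ℂ := fun t => ((Γ t).adjugate * γ t * (Γ t).adjugate.conjTranspose) 0 1 with hB
  have cB : ContinuousOn B I :=
    (contDiffOn_matrix_iff.1 ((k1.1.smooth.adjugate.matrix_mul h.smooth).matrix_mul
      k1.1.smooth.adjugate.conjTranspose) 0 1).continuousOn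
  have hBJ (t) (ht : t ∈ I) (c : Mat2) (hc : γ t = Γ t * c * (Γ t).conjTranspose) :
      B t = c 0 1 := by
    have h1 := congr_adjugate (k1.1.det_eq_one t ht) (γ t)
    nth_rw 2 [hc] at h1
    rw [congr_eq_iff (k1.1.det_eq_one t ht)] at h1
    rw [hB, ← h1]
  have hneg (t) : -proj (Γ t) = Γ t * (-baseJ) * (Γ t).conjTranspose := by
    simp [proj]
  have hsq : EqOn (B ^ 2) ((fun _ => Complex.I) ^ 2) I := by
    intro t ht
    rcases hpm t ht with e | e
    · rw [Pi.pow_apply, hBJ t ht baseJ e]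
      simp [baseJ]
    · rw [Pi.pow_apply, hBJ t ht (-baseJ) (e.trans (hneg t))]
      simp [baseJ]
  rcases hIc.isPreconnected.eq_or_eq_neg_of_sq_eq cB continuousOn_const hsq
    (fun _ => Complex.I_ne_zero) with hs | hs
  · have hγn (t) (ht : t ∈ I) : γ t = -proj (Γ t) := by
      rcases hpm t ht with e | e
      · have := hs ht
        rw [hBJ t ht baseJ e] at this
        simp [baseJ, Complex.ext_iff] at this
        norm_num at this
      · exact e
    have sIl : ContDiffOn ℝ ∞ (fun t => Complex.I * l t) I := contDiffOn_const.mul sl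
    have k2 := key (-1) (Or.inr rfl) (fun t => Complex.I * l t) sIl
      (fun t ht => by
        rw [mul_pow, Complex.I_sq, hl t ht, neg_one_mul, neg_mul, div_mul_cancel₀ _ (hf0 t ht)]
        simp)
      (fun t ht => by rw [map_mul, Complex.normSq_I, one_mul, hgl t ht])
    refine ⟨-1, _, (k2.1.isCanonicalFrame hIo (Or.inr rfl) (fun t ht => ?_) k2.2).1⟩
    have dl : deriv (fun t => Complex.I * l t) t = Complex.I * deriv l t :=
      ((sl.hasDerivAt_infty hIo ht).const_mul Complex.I).deriv
    have := proj_colFrame_I_smul (l t • w t) (deriv l t • w t + l t • deriv w t) (1 * σ t)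
    rw [hγn t ht, hΓ, ← this, dl]
    congr 2
    · rw [smul_smul]
    · rw [smul_add, smul_smul, smul_smul]
    · ring
  · have hγp (t) (ht : t ∈ I) : γ t = proj (Γ t) := by
      rcases hpm t ht with e | e
      · exact e
      · have := hs ht
        rw [hBJ t ht (-baseJ) (e.trans (hneg t))] at this
        simp [baseJ, Complex.ext_iff] at this
        norm_num at this
    exact ⟨1, Γ, (k1.1.isCanonicalFrame hIo (Or.inl rfl) hγp k1.2).1⟩

theorem isCanonicalFrame_canonicalFrame {I : Set ℝ} {γ : ℝ → Mat2} (h : IsNullCurve I γ)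
    (hIo : IsOpen I) (hIc : I.OrdConnected) :
    ∃ ε, IsCanonicalFrame I γ ε (canonicalFrame I γ) := by
  obtain ⟨ε, Γ, hΓ⟩ := h.exists_isCanonicalFrame hIo hIc
  have hex : ∃ Γ : ℝ → Mat2, ∃ ε : ℝ, IsCanonicalFrame I γ ε Γ := ⟨Γ, ε, hΓ⟩
  rw [canonicalFrame, dif_pos hex]
  exact hex.choose_spec

/-! ### Canonical frames along a variation -/

/-- A smooth family of canonical frames along the curves `V (·, u)` of a variation, defined on a
neighbourhood of `I × {0}` and extending a given canonical frame `Γ₀` wherever the variation is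
trivial. -/
structure IsFrameFamily (I : Set ℝ) (γ : ℝ → Mat2) (V : ℝ × ℝ → Mat2) (ε : ℝ) (Γ₀ : ℝ → Mat2)
    (O : Set (ℝ × ℝ)) (Γ : ℝ × ℝ → Mat2) : Prop where
  isOpen : IsOpen O
  mem : ∀ t ∈ I, (t, 0) ∈ O
  smooth : ContDiffOn ℝ ∞ Γ O
  canonical : ∀ u, IsCanonicalFrame {t | (t, u) ∈ O} (fun t => V (t, u)) ε fun t => Γ (t, u)
  eq_of_eventuallyEq : ∀ t u, (t, u) ∈ O → (∀ᶠ s in 𝓝 t, V (s, u) = γ s) → Γ (t, u) = Γ₀ t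

theorem IsCompactVariation.exists_isFrameFamily {I : Set ℝ} {γ : ℝ → Mat2} {δ : ℝ}
    {V : ℝ × ℝ → Mat2} {a b ε : ℝ} {Γ₀ : ℝ → Mat2} (hV : IsCompactVariation I γ δ V a b)
    (hI : IsOpen I) (hc : IsCanonicalFrame I γ ε Γ₀) :
    ∃ O Γ, IsFrameFamily I γ V ε Γ₀ O Γ := by
  have hε0 := ne_zero_of_spin hc.spin
  have had := hc.isAdaptedFrame
  set σ₀ := arcElt Γ₀ with hσ₀
  have sσ₀ : ContDiffOn ℝ ∞ σ₀ I := hc.contDiffOn_arcElt hI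
  have hσ₀0 (t) (ht : t ∈ I) : σ₀ t ≠ 0 := hc.theta21 t ht
  set O₀ : Set (ℝ × ℝ) := I ×ˢ Ioo (-δ) δ with hO₀
  have oO₀ : IsOpen O₀ := hI.prod isOpen_Ioo
  have fstO₀ : ∀ p ∈ O₀, p.1 ∈ I := fun p hp => hp.1
  have sΓ₀ := contDiffOn_matrix_iff.1 hc.smooth
  -- the velocities and their directions
  set M : ℝ × ℝ → Mat2 := pderivFst V with hM
  have sM : ContDiffOn ℝ ∞ M O₀ := hV.smooth.pderivFst oO₀
  have dV (t u) (h : (t, u) ∈ O₀) : HasDerivAt (fun s => V (s, u)) (M (t, u)) t :=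
    hV.smooth.hasDerivAt_slice_fst oO₀ h
  have eM (t u) (h : (t, u) ∈ O₀) : deriv (fun s => V (s, u)) t = M (t, u) := (dV t u h).deriv
  have hMH (p) (h : p ∈ O₀) : (M p).IsHermitian := by
    have := (hV.nullCurve p.2 h.2).isHermitian_deriv hI h.1
    rwa [eM p.1 p.2 h] at this
  have hMd (p) (h : p ∈ O₀) : (M p).det = 0 := by
    have := (hV.nullCurve p.2 h.2).det_deriv hI h.1
    rwa [eM p.1 p.2 h] at this
  set η : ℝ → Fin 2 → ℂ := fun t => ((2 * σ₀ t : ℝ) : ℂ)⁻¹ •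
    ![-(starRingEnd ℂ) (Γ₀ t 1 0), (starRingEnd ℂ) (Γ₀ t 0 0)] with hη
  have sη : ContDiffOn ℝ ∞ η I := by
    refine ContDiffOn.smul (ContDiffOn.inv (contDiffOn_const.mul sσ₀).complex_ofReal ?_)
      (contDiffOn_pi.2 fun i => ?_)
    · intro t ht
      have := hσ₀0 t ht
      exact_mod_cast mul_ne_zero two_ne_zero this
    · fin_cases i
      · exact (contDiffOn_conj (sΓ₀ 1 0)).neg
      · exact contDiffOn_conj (sΓ₀ 0 0)
  have sη₂ : ContDiffOn ℝ ∞ (fun p : ℝ × ℝ => η p.1) O₀ := sη.comp_fst fstO₀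
  set w : ℝ × ℝ → Fin 2 → ℂ := fun p => (M p).mulVec (η p.1) with hw
  have sw : ContDiffOn ℝ ∞ w O₀ := sM.matrix_mulVec sη₂
  have sw' : ContDiffOn ℝ ∞ (pderivFst w) O₀ := sw.pderivFst oO₀
  set θ : ℝ × ℝ → ℝ := fun p => (star (η p.1) ⬝ᵥ (M p).mulVec (η p.1)).re with hθ
  have sθ : ContDiffOn ℝ ∞ θ O₀ := sM.star_dotProduct_mulVec sη₂
  set f : ℝ × ℝ → ℂ := fun p => pderivFst w p 0 * w p 1 - pderivFst w p 1 * w p 0 with hf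
  have sf : ContDiffOn ℝ ∞ f O₀ := by
    have h1 := contDiffOn_pi.1 sw
    have h2 := contDiffOn_pi.1 sw'
    exact ((h2 0).mul (h1 1)).sub ((h2 1).mul (h1 0))
  have sσ₀₂ : ContDiffOn ℝ ∞ (fun p : ℝ × ℝ => σ₀ p.1) O₀ := sσ₀.comp_fst fstO₀
  set R : ℝ × ℝ → ℂ := fun p => f p / ((ε * σ₀ p.1 : ℝ) : ℂ) with hR
  have hb0 (p) (hp : p ∈ O₀) : ((ε * σ₀ p.1 : ℝ) : ℂ) ≠ 0 := by
    exact_mod_cast mul_ne_zero hε0 (hσ₀0 p.1 hp.1)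
  have sR : ContDiffOn ℝ ∞ R O₀ := by
    simpa [hR, div_eq_mul_inv] using
      sf.mul ((contDiffOn_const.mul sσ₀₂).complex_ofReal.inv hb0)
  set S : ℝ × ℝ → ℝ := fun p => (2 * σ₀ p.1 * θ p)⁻¹ with hS
  -- the domain on which the frame is defined
  set O₁ : Set (ℝ × ℝ) := O₀ ∩ (fun p => σ₀ p.1 * θ p) ⁻¹' Ioi 0 with hO₁
  have oO₁ : IsOpen O₁ := (sσ₀₂.mul sθ).continuousOn.isOpen_inter_preimage oO₀ isOpen_Ioi
  have hS0 (p) (hp : p ∈ O₁) : 0 < 2 * σ₀ p.1 * θ p := by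
    have : 0 < σ₀ p.1 * θ p := hp.2
    linarith
  have sS : ContDiffOn ℝ ∞ S O₁ :=
    ContDiffOn.inv (((contDiffOn_const.mul sσ₀₂).mul sθ).mono inter_subset_left)
      fun p hp => (hS0 p hp).ne'
  set O₂ : Set (ℝ × ℝ) := O₁ ∩ R ⁻¹' {0}ᶜ with hO₂
  have oO₂ : IsOpen O₂ :=
    (sR.continuousOn.mono inter_subset_left).isOpen_inter_preimage oO₁ isOpen_compl_singleton
  have h₂₀ : O₂ ⊆ O₀ := inter_subset_left.trans inter_subset_left
  set N : ℝ × ℝ → ℝ := fun p => √(Complex.normSq (R p)) with hN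
  have hN0 (p) (hp : p ∈ O₂) : 0 < N p := Real.sqrt_pos.2 (Complex.normSq_pos.2 hp.2)
  have sN : ContDiffOn ℝ ∞ N O₂ := by
    have h1 := sR.mono h₂₀
    refine ContDiffOn.sqrt ?_ fun p hp => (Complex.normSq_pos.2 hp.2).ne'
    simp only [Complex.normSq_apply]
    exact (h1.complex_re.mul h1.complex_re).add (h1.complex_im.mul h1.complex_im)
  have hSN0 (p) (hp : p ∈ O₂) : 0 < S p * N p :=
    mul_pos (inv_pos.2 (hS0 p hp.1)) (hN0 p hp)
  set r : ℝ × ℝ → ℝ := fun p => √(S p * N p) with hr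
  have hr0 (p) (hp : p ∈ O₂) : 0 < r p := Real.sqrt_pos.2 (hSN0 p hp)
  have sr : ContDiffOn ℝ ∞ r O₂ :=
    ((sS.mono inter_subset_left).mul sN).sqrt fun p hp => (hSN0 p hp).ne'
  set z : ℝ × ℝ → ℂ := fun p => (r p : ℂ) / R p with hz
  have sz : ContDiffOn ℝ ∞ z O₂ := by
    simpa [hz, div_eq_mul_inv] using
      sr.complex_ofReal.mul ((sR.mono h₂₀).inv fun p hp => hp.2)
  set O₃ : Set (ℝ × ℝ) := O₂ ∩ z ⁻¹' Complex.slitPlane with hO₃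
  have oO₃ : IsOpen O₃ := sz.continuousOn.isOpen_inter_preimage oO₂ Complex.isOpen_slitPlane
  have h₃₀ : O₃ ⊆ O₀ := inter_subset_left.trans h₂₀
  set l : ℝ × ℝ → ℂ := fun p => Complex.exp (Complex.log (z p) / 2) with hl
  have sl : ContDiffOn ℝ ∞ l O₃ := by
    have h1 : ContDiffOn ℝ ∞ (fun p => Complex.log (z p)) O₃ := fun p hp =>
      (((Complex.contDiffAt_log hp.2).restrict_scalars ℝ).comp p
        (sz.contDiffAt (oO₂.mem_nhds hp.1))).contDiffWithinAt
    exact Complex.contDiff_exp.comp_contDiffOn (h1.div_const 2)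
  have hl2 (p) (hp : p ∈ O₃) : l p ^ 2 = z p := by
    rw [hl, ← Complex.exp_nat_mul]
    have : ((2 : ℕ) : ℂ) * (Complex.log (z p) / 2) = Complex.log (z p) := by push_cast; ring
    rw [this, Complex.exp_log (Complex.slitPlane_ne_zero hp.2)]
  set σ : ℝ × ℝ → ℝ := fun p => σ₀ p.1 * r p with hσ
  have sσ : ContDiffOn ℝ ∞ σ O₂ := (sσ₀₂.mono h₂₀).mul sr
  have hσ0 (p) (hp : p ∈ O₂) : σ p ≠ 0 := mul_ne_zero (hσ₀0 p.1 (h₂₀ hp).1) (hr0 p hp).ne'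
  set Γ : ℝ × ℝ → Mat2 := fun p =>
    colFrame (l p • w p) (pderivFst l p • w p + l p • pderivFst w p) (ε * σ p) with hΓ
  have sΓ : ContDiffOn ℝ ∞ Γ O₃ :=
    (sl.smul (sw.mono h₃₀)).colFrame
      (((sl.pderivFst oO₃).smul (sw.mono h₃₀)).add (sl.smul (sw'.mono h₃₀)))
      (contDiffOn_const.mul (sσ.mono inter_subset_left))
      fun p hp => mul_ne_zero hε0 (hσ0 p hp.1)
  set B : ℝ × ℝ → ℂ := fun p => ((Γ p).adjugate * V p * (Γ p).adjugate.conjTranspose) 0 1 with hB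
  have sB : ContDiffOn ℝ ∞ B O₃ :=
    contDiffOn_matrix_iff.1 ((sΓ.adjugate.matrix_mul (hV.smooth.mono h₃₀)).matrix_mul
      sΓ.adjugate.conjTranspose) 0 1
  set O : Set (ℝ × ℝ) := O₃ ∩ B ⁻¹' {Complex.I}ᶜ with hO
  have oO : IsOpen O := sB.continuousOn.isOpen_inter_preimage oO₃ isOpen_compl_singleton
  -- adapted frames on slices
  have adapted (u : ℝ) := isAdaptedFrame_smul (isOpen_slice oO₃ u) (γ := fun t => V (t, u))
    (g := fun t => (θ (t, u))⁻¹) hc.spin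
    ((sw.mono h₃₀).slice_fst u) ((sw'.mono h₃₀).slice_fst u) (sl.slice_fst u)
    ((sl.pderivFst oO₃).slice_fst u) ((sσ.mono (inter_subset_left (t := z ⁻¹' _))).slice_fst u)
    (fun t ht => hσ0 (t, u) ht.1)
    (fun t ht => sw.hasDerivAt_slice_fst oO₀ (h₃₀ ht))
    (fun t ht => sl.hasDerivAt_slice_fst oO₃ ht)
    (fun t ht => by
      have h1 : R (t, u) ≠ 0 := ht.1.2
      have h2 := hb0 (t, u) (h₃₀ ht)
      have h3 : f (t, u) = R (t, u) * ((ε * σ₀ t : ℝ) : ℂ) := by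
        rw [hR]; exact (div_mul_cancel₀ _ h2).symm
      change l (t, u) ^ 2 * f (t, u) = _
      rw [hl2 _ ht, h3, hz, hσ]
      push_cast
      field_simp)
    (fun t ht => by
      have hn : Complex.normSq (l (t, u)) = r (t, u) / N (t, u) := by
        rw [Complex.normSq_eq_norm_sq, ← norm_pow, hl2 _ ht, hz, norm_div, Complex.norm_real,
          Real.norm_of_nonneg (hr0 _ ht.1).le]
        rfl
      have h1 : r (t, u) * r (t, u) = S (t, u) * N (t, u) :=
        Real.mul_self_sqrt (hSN0 _ ht.1).le
      have h2 : N (t, u) ≠ 0 := (hN0 _ ht.1).ne'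
      have h3 := (hS0 _ ht.1.1).ne'
      have h4 : σ₀ t ≠ 0 := hσ₀0 t (h₃₀ ht).1
      have h5 : θ (t, u) ≠ 0 := right_ne_zero_of_mul h3
      rw [hn]
      calc (θ (t, u))⁻¹ = 2 * σ₀ t * S (t, u) := by rw [hS]; field_simp
        _ = 2 * σ₀ t * (S (t, u) * N (t, u)) / N (t, u) := by field_simp
        _ = 2 * σ (t, u) * (r (t, u) / N (t, u)) := by rw [← h1, hσ]; ring)
    (fun t ht => by
      have h3 := (hS0 _ ht.1.1).ne'
      have h5 : θ (t, u) ≠ 0 := right_ne_zero_of_mul h3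
      exact (dV t u (h₃₀ ht)).congr_deriv
        (eq_inv_mul_mulVec (hMH _ (h₃₀ ht)) (hMd _ (h₃₀ ht)) h5))
  have hdet (p) (hp : p ∈ O₃) : (Γ p).det = 1 := (adapted p.2).1.det_eq_one p.1 hp
  have hBJ (p) (hp : p ∈ O₃) (c : Mat2) (hc : V p = Γ p * c * (Γ p).conjTranspose) :
      B p = c 0 1 := by
    have h1 := congr_adjugate (hdet p hp) (V p)
    nth_rw 2 [hc] at h1
    rw [congr_eq_iff (hdet p hp)] at h1
    rw [hB, ← h1]
  have hproj (p) (hp : p ∈ O) : V p = proj (Γ p) := by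
    rcases (adapted p.2).1.eq_proj_or_neg (isOpen_slice oO₃ p.2)
      (fun t ht => (hV.nullCurve p.2 (h₃₀ ht).2).mem t (h₃₀ ht).1)
      (fun t ht => mul_ne_zero two_ne_zero (hσ0 _ ht.1)) (adapted p.2).2 (t := p.1) hp.1 with e | e
    · exact e
    · have e2 : V p = Γ p * (-baseJ) * (Γ p).conjTranspose := e.trans (by simp [hΓ, proj])
      refine absurd ?_ hp.2
      change B p = Complex.I
      rw [hBJ p hp.1 _ e2]
      simp [baseJ]
  -- where the variation is trivial
  have triv (t u) (h : (t, u) ∈ O₀) (hu : ∀ᶠ s in 𝓝 t, V (s, u) = γ s) :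
      w (t, u) = (fun i => Γ₀ t i 1) ∧ θ (t, u) = (2 * σ₀ t)⁻¹ := by
    have h1 : M (t, u) = Γ₀ t * !![0, 0; 0, ((2 * σ₀ t : ℝ) : ℂ)] * (Γ₀ t).conjTranspose := by
      have h2 : (fun s => V (s, u)) =ᶠ[𝓝 t] fun s => proj (Γ₀ s) := by
        filter_upwards [hu, hI.mem_nhds h.1] with s hs hsI
        rw [hs, hc.frame s hsI]
      exact (dV t u h).unique ((had.hasDerivAt_proj hI h.1).congr_of_eventuallyEq h2)
    have hd : (starRingEnd ℂ) (Γ₀ t 0 0 * Γ₀ t 1 1 - Γ₀ t 0 1 * Γ₀ t 1 0) = 1 := by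
      rw [← Matrix.det_fin_two, hc.det_eq_one t h.1, map_one]
    have hs2 : (σ₀ t : ℂ) ≠ 0 := by exact_mod_cast hσ₀0 t h.1
    have hw1 : w (t, u) = fun i => Γ₀ t i 1 := by
      simp only [map_sub, map_mul] at hd
      ext i
      simp only [hw, h1, hη, Matrix.mulVec, dotProduct, Fin.sum_univ_two, Matrix.mul_apply,
        Matrix.conjTranspose_apply]
      simp
      field_simp
      linear_combination Γ₀ t i 1 * hd
    refine ⟨hw1, ?_⟩
    have h3 : (M (t, u)).mulVec (η t) = fun i => Γ₀ t i 1 := hw1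
    simp only [hθ, h3]
    have h4 : star (η t) ⬝ᵥ (fun i => Γ₀ t i 1) = (((2 * σ₀ t)⁻¹ : ℝ) : ℂ) := by
      simp only [hη, dotProduct, Fin.sum_univ_two]
      have hd2 : Γ₀ t 0 0 * Γ₀ t 1 1 - Γ₀ t 0 1 * Γ₀ t 1 0 = 1 := by
        rw [← Matrix.det_fin_two, hc.det_eq_one t h.1]
      simp
      field_simp
      linear_combination hd2
    rw [h4, Complex.ofReal_re]
  have hnear (t u) (h : (t, u) ∈ O₀) : ∀ᶠ s in 𝓝 t, (s, u) ∈ O₀ :=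
    (isOpen_slice oO₀ u).mem_nhds h
  have triv' (t u) (h : (t, u) ∈ O₀) (hu : ∀ᶠ s in 𝓝 t, V (s, u) = γ s) (i : Fin 2) :
      pderivFst w (t, u) i = ((ε * σ₀ t : ℝ) : ℂ) * Γ₀ t i 0 := by
    have h1 := hasDerivAt_pi.1 (sw.hasDerivAt_slice_fst oO₀ h) i
    have h2 : (fun s => w (s, u) i) =ᶠ[𝓝 t] fun s => Γ₀ s i 1 := by
      filter_upwards [hu.eventually_nhds, hnear t u h] with s hs hsO
      rw [(triv s u hsO hs).1]
    have h3 := hasDerivAt_matrix_iff.1 (had.hasDerivAt hI h.1) i 1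
    have h4 := h1.unique (h3.congr_of_eventuallyEq h2)
    rw [h4]
    simp [Matrix.mul_apply, Fin.sum_univ_two]
    ring
  have trivR (t u) (h : (t, u) ∈ O₀) (hu : ∀ᶠ s in 𝓝 t, V (s, u) = γ s) :
      (t, u) ∈ O₃ ∧ r (t, u) = 1 ∧ l (t, u) = 1 := by
    have hd2 : Γ₀ t 0 0 * Γ₀ t 1 1 - Γ₀ t 0 1 * Γ₀ t 1 0 = 1 := by
      rw [← Matrix.det_fin_two, hc.det_eq_one t h.1]
    have hs0 := hσ₀0 t h.1
    have hR1 : R (t, u) = 1 := by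
      simp only [hR, hf]
      rw [div_eq_one_iff_eq (hb0 (t, u) h), triv' t u h hu, triv' t u h hu, (triv t u h hu).1]
      linear_combination ((ε * σ₀ t : ℝ) : ℂ) * hd2
    have hth := (triv t u h hu).2
    have hS1 : S (t, u) = 1 := by
      simp only [hS, hth]
      field_simp
    have hr1 : r (t, u) = 1 := by simp [hr, hN, hR1, hS1]
    have hz1 : z (t, u) = 1 := by simp [hz, hR1, hr1]
    have m1 : (t, u) ∈ O₁ := by
      refine ⟨h, ?_⟩
      change 0 < σ₀ t * θ (t, u)
      rw [hth]
      have : σ₀ t * (2 * σ₀ t)⁻¹ = 1 / 2 := by field_simp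
      rw [this]; norm_num
    have m2 : (t, u) ∈ O₂ := ⟨m1, by simp [hR1]⟩
    have m3 : (t, u) ∈ O₃ := ⟨m2, by simp [hz1]⟩
    exact ⟨m3, hr1, by simp [hl, hz1]⟩
  have trivΓ (t u) (h : (t, u) ∈ O₀) (hu : ∀ᶠ s in 𝓝 t, V (s, u) = γ s) :
      Γ (t, u) = Γ₀ t := by
    obtain ⟨m3, hr1, hl1⟩ := trivR t u h hu
    have hl' : pderivFst l (t, u) = 0 := by
      refine (sl.hasDerivAt_slice_fst oO₃ m3).unique
        ((hasDerivAt_const t (1 : ℂ)).congr_of_eventuallyEq ?_)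
      filter_upwards [hu.eventually_nhds, hnear t u h] with s hs hsO
      exact (trivR s u hsO hs).2.2
    have hε1 : (ε : ℂ) ≠ 0 := by exact_mod_cast hε0
    have hσ1 : (σ₀ t : ℂ) ≠ 0 := by exact_mod_cast hσ₀0 t h.1
    have e := triv' t u h hu
    simp only [hΓ, hl1, hl', (triv t u h hu).1, hσ, hr1, mul_one, zero_smul, zero_add, one_smul]
    ext i j
    fin_cases i <;> fin_cases j <;> simp [colFrame, e] <;> field_simp
  refine ⟨O, Γ, oO, fun t ht => ?_, sΓ.mono inter_subset_left,
    fun u => ?_, fun t u h hu => trivΓ t u (h₃₀ h.1) hu⟩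
  · have h0 : (t, (0 : ℝ)) ∈ O₀ := ⟨ht, by simpa using hV.pos⟩
    have hu : ∀ᶠ s in 𝓝 t, V (s, 0) = γ s :=
      Filter.eventually_of_mem (hI.mem_nhds ht) hV.initial
    refine ⟨(trivR t 0 h0 hu).1, ?_⟩
    have e : V (t, 0) = Γ (t, 0) * baseJ * (Γ (t, 0)).conjTranspose := by
      rw [trivΓ t 0 h0 hu, hV.initial t ht, hc.frame t ht, proj]
    change B (t, 0) ≠ Complex.I
    rw [hBJ _ (trivR t 0 h0 hu).1 _ e]
    simp [baseJ, Complex.ext_iff]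
    norm_num
  · have hsub : {t | (t, u) ∈ O} ⊆ {t | (t, u) ∈ O₃} := fun t ht => ht.1
    exact (((adapted u).1.mono hsub).isCanonicalFrame (isOpen_slice oO u) hc.spin
      (fun t ht => hproj (t, u) ht) fun t ht => (adapted u).2 t ht.1).1

/-! ### The first variation formula -/

theorem hasDerivAt_integral_of_contDiffOn {Φ : ℝ × ℝ → ℝ} {O : Set (ℝ × ℝ)} (hO : IsOpen O)
    (hΦ : ContDiffOn ℝ ∞ Φ O) {a b : ℝ} (hab : a ≤ b) (h0 : ∀ t ∈ Icc a b, (t, (0 : ℝ)) ∈ O) :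
    (∀ᶠ u in 𝓝 (0 : ℝ), ∀ t ∈ Icc a b, (t, u) ∈ O) ∧
    HasDerivAt (fun u => ∫ t in a..b, Φ (t, u)) (∫ t in a..b, pderivSnd Φ (t, 0)) 0 := by
  obtain ⟨A, B, oA, oB, hA, hB, hAB⟩ := generalized_tube_lemma (isCompact_Icc (a := a) (b := b))
    (isCompact_singleton (x := (0 : ℝ))) hO (by
      rintro ⟨t, u⟩ ⟨ht, hu⟩
      obtain rfl : u = 0 := hu
      exact h0 t ht)
  have hB0 : B ∈ 𝓝 (0 : ℝ) := oB.mem_nhds (hB rfl)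
  obtain ⟨r, hr, hrB⟩ := Metric.nhds_basis_closedBall.mem_iff.1 hB0
  have hmem (t) (ht : t ∈ Icc a b) (u) (hu : u ∈ Metric.closedBall (0 : ℝ) r) : (t, u) ∈ O :=
    hAB ⟨hA ht, hrB hu⟩
  have hball : Metric.closedBall (0 : ℝ) r ∈ 𝓝 (0 : ℝ) := Metric.closedBall_mem_nhds 0 hr
  refine ⟨Filter.eventually_of_mem hball fun u hu t ht => hmem t ht u hu, ?_⟩
  have hK : IsCompact (Icc a b ×ˢ Metric.closedBall (0 : ℝ) r) :=
    isCompact_Icc.prod (isCompact_closedBall 0 r)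
  have hKO : Icc a b ×ˢ Metric.closedBall (0 : ℝ) r ⊆ O := fun p hp => hmem p.1 hp.1 p.2 hp.2
  obtain ⟨C, hC⟩ := hK.exists_bound_of_continuousOn
    ((hΦ.pderivSnd hO).continuousOn.mono hKO)
  have hsl (u) (hu : u ∈ Metric.closedBall (0 : ℝ) r) (Ψ : ℝ × ℝ → ℝ) (hΨ : ContinuousOn Ψ O) :
      ContinuousOn (fun t => Ψ (t, u)) (uIcc a b) := by
    rw [uIcc_of_le hab]
    exact hΨ.comp (by fun_prop) fun t ht => hmem t ht u hu
  have h0r : (0 : ℝ) ∈ Metric.closedBall (0 : ℝ) r := Metric.mem_closedBall_self hr.le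
  have hIoc (t) (ht : t ∈ uIoc a b) : t ∈ Icc a b := by
    rw [uIoc_of_le hab] at ht
    exact Ioc_subset_Icc_self ht
  refine (intervalIntegral.hasDerivAt_integral_of_dominated_loc_of_deriv_le
    (F := fun u t => Φ (t, u)) (F' := fun u t => pderivSnd Φ (t, u)) (bound := fun _ => C)
    hball ?_ ((hsl 0 h0r _ hΦ.continuousOn).intervalIntegrable) ?_ ?_
    intervalIntegrable_const ?_).2
  · exact Filter.eventually_of_mem hball fun u hu =>
      (hsl u hu _ hΦ.continuousOn).intervalIntegrable.aestronglyMeasurable_restrict_uIoc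
  · exact (hsl 0 h0r _
      (hΦ.pderivSnd hO).continuousOn).intervalIntegrable.aestronglyMeasurable_restrict_uIoc
  · exact Filter.Eventually.of_forall fun t ht u hu => hC (t, u) ⟨hIoc t ht, hu⟩
  · exact Filter.Eventually.of_forall fun t ht u hu =>
      hΦ.hasDerivAt_slice_snd hO (hmem t (hIoc t ht) u hu)

/-- The left-hand side of the Euler–Lagrange equation. -/
noncomputable def eulerLagrangeLHS (m ε : ℝ) (Γ : ℝ → Mat2) (t : ℝ) : ℝ :=
  arcDeriv Γ (arcDeriv Γ (arcDeriv Γ (frameCurv Γ))) t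
    - 6 * ε * frameCurv Γ t * arcDeriv Γ (frameCurv Γ) t
    + 2 * ε * m * arcDeriv Γ (frameCurv Γ) t

theorem IsCanonicalFrame.contDiffOn_eulerLagrangeLHS {U : Set ℝ} {γ : ℝ → Mat2} {ε : ℝ}
    {Γ : ℝ → Mat2} (h : IsCanonicalFrame U γ ε Γ) (hU : IsOpen U) (m : ℝ) :
    ContDiffOn ℝ ∞ (eulerLagrangeLHS m ε Γ) U := by
  have h0 := h.contDiffOn_frameCurv hU
  have h1 := h.contDiffOn_arcDeriv hU h0
  have h3 := h.contDiffOn_arcDeriv hU (h.contDiffOn_arcDeriv hU h1)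
  exact (h3.sub ((contDiffOn_const.mul h0).mul h1)).add (contDiffOn_const.mul h1)

section Structure

variable {I : Set ℝ} {γ : ℝ → Mat2} {V : ℝ × ℝ → Mat2} {ε : ℝ} {Γ₀ : ℝ → Mat2}
  {O : Set (ℝ × ℝ)} {Γ : ℝ × ℝ → Mat2}

/-- The component `Γ⁻¹ ∂ₜ Γ` of the Maurer–Cartan form of a map of two variables. -/
noncomputable def formFst (Γ : ℝ × ℝ → Mat2) (p : ℝ × ℝ) : Mat2 :=
  maurerCartan (Γ p) (pderivFst Γ p)

/-- The component `Γ⁻¹ ∂ᵤ Γ` of the Maurer–Cartan form of a map of two variables. -/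
noncomputable def formSnd (Γ : ℝ × ℝ → Mat2) (p : ℝ × ℝ) : Mat2 :=
  maurerCartan (Γ p) (pderivSnd Γ p)

theorem ContDiffOn.formFst (hO : IsOpen O) (h : ContDiffOn ℝ ∞ Γ O) :
    ContDiffOn ℝ ∞ (formFst Γ) O :=
  h.adjugate.matrix_mul (h.pderivFst hO)

theorem ContDiffOn.formSnd (hO : IsOpen O) (h : ContDiffOn ℝ ∞ Γ O) :
    ContDiffOn ℝ ∞ (formSnd Γ) O :=
  h.adjugate.matrix_mul (h.pderivSnd hO)

theorem trace_formFst (hO : IsOpen O) (h : ContDiffOn ℝ ∞ Γ O) (hdet : ∀ p ∈ O, (Γ p).det = 1)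
    {p : ℝ × ℝ} (hp : p ∈ O) : formFst Γ p 0 0 + formFst Γ p 1 1 = 0 :=
  trace_maurerCartan_eq_zero (Γ := fun s => Γ (s, p.2)) (t := p.1) (h.hasDerivAt_slice_fst hO hp)
    (Filter.eventually_of_mem ((isOpen_slice hO p.2).mem_nhds hp) fun _ hs => hdet _ hs)

theorem isOpen_slice_snd (hO : IsOpen O) (t : ℝ) : IsOpen {u | (t, u) ∈ O} :=
  hO.preimage (by fun_prop)

theorem trace_formSnd (hO : IsOpen O) (h : ContDiffOn ℝ ∞ Γ O) (hdet : ∀ p ∈ O, (Γ p).det = 1)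
    {p : ℝ × ℝ} (hp : p ∈ O) : formSnd Γ p 0 0 + formSnd Γ p 1 1 = 0 :=
  trace_maurerCartan_eq_zero (Γ := fun s => Γ (p.1, s)) (t := p.2) (h.hasDerivAt_slice_snd hO hp)
    (Filter.eventually_of_mem ((isOpen_slice_snd hO p.1).mem_nhds hp) fun _ hs => hdet _ hs)

theorem adjugate_eq_neg_of_trace {X : Mat2} (h : X 0 0 + X 1 1 = 0) : X.adjugate = -X := by
  have h1 : X 1 1 = -X 0 0 := by linear_combination h
  ext i j
  fin_cases i <;> fin_cases j <;> simp [Matrix.adjugate_fin_two, h1]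

/-- The Maurer–Cartan structure equation. -/
theorem hasDerivAt_formSnd (hO : IsOpen O) (h : ContDiffOn ℝ ∞ Γ O)
    (hdet : ∀ p ∈ O, (Γ p).det = 1) {t u : ℝ} (hp : (t, u) ∈ O) :
    HasDerivAt (fun s => formSnd Γ (s, u))
      (pderivSnd (formFst Γ) (t, u) + formSnd Γ (t, u) * formFst Γ (t, u)
        - formFst Γ (t, u) * formSnd Γ (t, u)) t := by
  have hΓt (p) (hp : p ∈ O) : pderivFst Γ p = Γ p * formFst Γ p :=
    (mul_maurerCartan (hdet p hp) _).symm
  have hΓu (p) (hp : p ∈ O) : pderivSnd Γ p = Γ p * formSnd Γ p :=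
    (mul_maurerCartan (hdet p hp) _).symm
  have e1 : pderivFst (pderivSnd Γ) (t, u) = pderivSnd Γ (t, u) * formFst Γ (t, u)
      + Γ (t, u) * pderivSnd (formFst Γ) (t, u) := by
    rw [pderivFst_pderivSnd_comm hO h hp]
    have h1 := (h.pderivFst hO).hasDerivAt_slice_snd hO hp
    have h2 := (h.hasDerivAt_slice_snd hO hp).matrix_mul
      ((h.formFst hO).hasDerivAt_slice_snd hO hp)
    exact h1.unique (h2.congr_of_eventuallyEq
      (Filter.eventually_of_mem ((isOpen_slice_snd hO t).mem_nhds hp) fun _ hs => hΓt _ hs))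
  have h1 := (h.hasDerivAt_slice_fst hO hp).adjugate.matrix_mul
    ((h.pderivSnd hO).hasDerivAt_slice_fst hO hp)
  refine h1.congr_deriv ?_
  rw [e1, hΓt _ hp, Matrix.adjugate_mul_distrib,
    adjugate_eq_neg_of_trace (trace_formFst hO h hdet hp), Matrix.mul_add]
  have a1 : (Γ (t, u)).adjugate * (Γ (t, u) * pderivSnd (formFst Γ) (t, u))
      = pderivSnd (formFst Γ) (t, u) := maurerCartan_mul (hdet _ hp) _
  rw [a1]
  simp only [formSnd, maurerCartan, Matrix.neg_mul, Matrix.mul_assoc]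
  abel

namespace IsFrameFamily

theorem det_eq_one (h : IsFrameFamily I γ V ε Γ₀ O Γ) {p : ℝ × ℝ} (hp : p ∈ O) : (Γ p).det = 1 :=
  (h.canonical p.2).det_eq_one p.1 hp

theorem frameForm_slice (h : IsFrameFamily I γ V ε Γ₀ O Γ) {t u : ℝ} (hp : (t, u) ∈ O) :
    frameForm (fun s => Γ (s, u)) t = formFst Γ (t, u) := by
  have : deriv (fun s => Γ (s, u)) t = pderivFst Γ (t, u) :=
    (h.smooth.hasDerivAt_slice_fst h.isOpen hp).deriv
  rw [frameForm, this, formFst]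

theorem formFst_eq (h : IsFrameFamily I γ V ε Γ₀ O Γ) {p : ℝ × ℝ} (hp : p ∈ O) :
    formFst Γ p = !![0, ((ε * (formFst Γ p 1 0).im : ℝ) : ℂ); formFst Γ p 1 0, 0] := by
  have h1 := (h.canonical p.2).isAdaptedFrame.frameForm_eq (isOpen_slice h.isOpen p.2) (t := p.1) hp
  rw [arcElt, h.frameForm_slice hp] at h1
  exact h1

theorem pderivSnd_formFst (h : IsFrameFamily I γ V ε Γ₀ O Γ) {p : ℝ × ℝ} (hp : p ∈ O) :
    pderivSnd (formFst Γ) p 0 0 = 0 ∧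
    pderivSnd (formFst Γ) p 0 1 = ((ε * (pderivSnd (formFst Γ) p 1 0).im : ℝ) : ℂ) := by
  have d := hasDerivAt_matrix_iff.1
    ((h.smooth.formFst h.isOpen).hasDerivAt_slice_snd h.isOpen (t := p.1) (u := p.2) hp)
  have hev : ∀ᶠ u in 𝓝 p.2, (p.1, u) ∈ O := (isOpen_slice_snd h.isOpen p.1).mem_nhds hp
  constructor
  · refine (d 0 0).unique ((hasDerivAt_const p.2 (0 : ℂ)).congr_of_eventuallyEq ?_)
    filter_upwards [hev] with u hu
    rw [h.formFst_eq hu]; rfl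
  · refine (d 0 1).unique
      (((d 1 0).complex_im.const_mul ε).ofReal_comp.congr_of_eventuallyEq ?_)
    filter_upwards [hev] with u hu
    rw [h.formFst_eq hu]; rfl

end IsFrameFamily

end Structure

theorem adjugate_congr_deriv_proj {c : ℝ → Mat2} {c' V' : Mat2} {t : ℝ} (hdet : (c t).det = 1)
    (hc : HasDerivAt c c' t) (hd : HasDerivAt (fun u => proj (c u)) V' t) :
    ((c t).adjugate * V' * (c t).adjugate.conjTranspose) 0 0
      = ((-2 * (maurerCartan (c t) c' 0 1).im : ℝ) : ℂ) := by
  have d1 : HasDerivAt c (c t * maurerCartan (c t) c') t := by rwa [mul_maurerCartan hdet]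
  have e2 := hd.unique (hasDerivAt_congr_frame d1 (hasDerivAt_const t baseJ))
  have e3 := congr_adjugate hdet V'
  nth_rw 2 [e2] at e3
  rw [congr_eq_iff hdet] at e3
  rw [e3]
  simp only [Matrix.add_apply, Matrix.mul_apply, Fin.sum_univ_two, Matrix.conjTranspose_apply]
  apply Complex.ext <;> simp [baseJ]
  ring

/-- The boundary term of the first variation, for the infinitesimal variation `W = Γ⁻¹ ∂ᵤ Γ` of
the frame `Γ₀`. -/
noncomputable def boundaryTerm (m ε : ℝ) (Γ₀ : ℝ → Mat2) (W : ℝ → Mat2) (t : ℝ) : ℝ :=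
  (W t 1 0).re + ε / 2 * (m + frameCurv Γ₀ t) * (W t 0 1).re
    + 1 / 2 * (m - frameCurv Γ₀ t) * (W t 1 0).im
    - ε / 2 * arcDeriv Γ₀ (frameCurv Γ₀) t * (W t 0 0).im
    + (1 / 4 * arcDeriv Γ₀ (arcDeriv Γ₀ (frameCurv Γ₀)) t
      + ε / 2 * (m - frameCurv Γ₀ t) * frameCurv Γ₀ t - ε) * (W t 0 1).im

namespace IsFrameFamily

variable {I : Set ℝ} {γ : ℝ → Mat2} {V : ℝ × ℝ → Mat2} {ε : ℝ} {Γ₀ : ℝ → Mat2}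
  {O : Set (ℝ × ℝ)} {Γ : ℝ × ℝ → Mat2}

theorem eq_initial (h : IsFrameFamily I γ V ε Γ₀ O Γ) (hI : IsOpen I)
    (hV : ∀ t ∈ I, V (t, 0) = γ t) {t : ℝ} (ht : t ∈ I) : Γ (t, 0) = Γ₀ t :=
  h.eq_of_eventuallyEq t 0 (h.mem t ht) (Filter.eventually_of_mem (hI.mem_nhds ht) hV)

theorem formFst_initial (h : IsFrameFamily I γ V ε Γ₀ O Γ) (hI : IsOpen I)
    (hV : ∀ t ∈ I, V (t, 0) = γ t) (hc : IsCanonicalFrame I γ ε Γ₀) {t : ℝ} (ht : t ∈ I) :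
    formFst Γ (t, 0) = !![0, ((ε * arcElt Γ₀ t : ℝ) : ℂ);
      (frameCurv Γ₀ t + Complex.I) * arcElt Γ₀ t, 0] := by
  rw [← hc.form10 ht, ← hc.isAdaptedFrame.frameForm_eq hI ht, ← h.frameForm_slice (h.mem t ht),
    frameForm, frameForm, h.eq_initial hI hV ht]
  congr 1
  exact Filter.EventuallyEq.deriv_eq
    (Filter.eventually_of_mem (hI.mem_nhds ht) fun s hs => h.eq_initial hI hV hs)

theorem hasDerivAt_boundaryTerm (h : IsFrameFamily I γ V ε Γ₀ O Γ) (hI : IsOpen I)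
    (hV : ∀ t ∈ I, V (t, 0) = γ t) (hc : IsCanonicalFrame I γ ε Γ₀) (m : ℝ) {t : ℝ}
    (ht : t ∈ I) :
    HasDerivAt (boundaryTerm m ε Γ₀ fun s => formSnd Γ (s, 0))
      (m * (pderivSnd (formFst Γ) (t, 0) 1 0).im + (pderivSnd (formFst Γ) (t, 0) 1 0).re
        + 1 / 4 * eulerLagrangeLHS m ε Γ₀ t * arcElt Γ₀ t * (formSnd Γ (t, 0) 0 1).im) t := by
  have hp := h.mem t ht
  have hdet : ∀ p ∈ O, (Γ p).det = 1 := fun p hp => h.det_eq_one hp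
  have dW := hasDerivAt_matrix_iff.1 (hasDerivAt_formSnd h.isOpen h.smooth hdet hp)
  rw [h.formFst_initial hI hV hc ht] at dW
  obtain ⟨q00, q01⟩ := h.pderivSnd_formFst hp
  have htr : formSnd Γ (t, 0) 1 1 = -formSnd Γ (t, 0) 0 0 := by
    linear_combination trace_formSnd h.isOpen h.smooth hdet hp
  set D := pderivSnd (formFst Γ) (t, 0) with hD
  set x := formSnd Γ (t, 0) 0 0 with hx
  set y := formSnd Γ (t, 0) 0 1 with hy
  set z := formSnd Γ (t, 0) 1 0 with hz
  set k := frameCurv Γ₀ t with hk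
  set σ := arcElt Γ₀ t with hσ
  have d00 : HasDerivAt (fun s => formSnd Γ (s, 0) 0 0)
      (y * ((k + Complex.I) * σ) - ε * σ * z) t := by
    refine (dW 0 0).congr_deriv ?_
    simp only [Matrix.sub_apply, Matrix.add_apply, Matrix.mul_apply, Fin.sum_univ_two, q00]
    simp [← hx, ← hy, ← hz]
  have d01 : HasDerivAt (fun s => formSnd Γ (s, 0) 0 1)
      (ε * (D 1 0).im + 2 * ε * σ * x) t := by
    refine (dW 0 1).congr_deriv ?_
    simp only [Matrix.sub_apply, Matrix.add_apply, Matrix.mul_apply, Fin.sum_univ_two, q01, htr]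
    simp [← hx]
    ring
  have d10 : HasDerivAt (fun s => formSnd Γ (s, 0) 1 0)
      (D 1 0 - 2 * (k + Complex.I) * σ * x) t := by
    refine (dW 1 0).congr_deriv ?_
    simp only [Matrix.sub_apply, Matrix.add_apply, Matrix.mul_apply, Fin.sum_univ_two, htr]
    simp [← hx]
    ring
  have sk := hc.contDiffOn_frameCurv hI
  have sk1 := hc.contDiffOn_arcDeriv hI sk
  have sk2 := hc.contDiffOn_arcDeriv hI sk1
  have dk := hc.hasDerivAt_arcDeriv hI sk ht
  have dk1 := hc.hasDerivAt_arcDeriv hI sk1 ht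
  have dk2 := hc.hasDerivAt_arcDeriv hI sk2 ht
  have hε2 := sq_eq_one_of_spin hc.spin
  have hG := ((((d10.complex_re).add
    (((dk.const_add m).const_mul (ε / 2)).mul d01.complex_re)).add
    (((dk.const_sub m).const_mul (1 / 2)).mul d10.complex_im)).sub
    ((dk1.const_mul (ε / 2)).mul d00.complex_im)).add
    ((((dk2.const_mul (1 / 4)).add
      (((dk.const_sub m).const_mul (ε / 2)).mul dk)).sub_const ε).mul d01.complex_im)
  refine hG.congr_deriv ?_
  simp only [Pi.mul_apply, Pi.add_apply, Complex.sub_re, Complex.sub_im, Complex.add_re,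
    Complex.add_im, Complex.mul_re, Complex.mul_im, Complex.ofReal_re, Complex.ofReal_im,
    Complex.I_re, Complex.I_im, Complex.re_ofNat, Complex.im_ofNat, eulerLagrangeLHS, ← hk, ← hσ,
    ← hx, ← hy, ← hz]
  generalize arcDeriv Γ₀ (arcDeriv Γ₀ (arcDeriv Γ₀ (frameCurv Γ₀))) t = k3
  generalize arcDeriv Γ₀ (arcDeriv Γ₀ (frameCurv Γ₀)) t = k2
  generalize arcDeriv Γ₀ (frameCurv Γ₀) t = k1
  linear_combination (1 / 2 * (m + k) * ((D 1 0).im + 2 * σ * x.re) + 1 / 2 * k1 * σ * z.im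
    + ((m - k) * k - 2) * σ * x.im) * hε2

/-- The normal component of the variation field. -/
theorem formSnd_zero_one_im (h : IsFrameFamily I γ V ε Γ₀ O Γ) (hI : IsOpen I)
    (hV : ∀ t ∈ I, V (t, 0) = γ t) {t : ℝ} (ht : t ∈ I) {V' : Mat2}
    (hd : HasDerivAt (fun u => V (t, u)) V' 0) :
    ((Γ₀ t).adjugate * V' * (Γ₀ t).adjugate.conjTranspose) 0 0
      = ((-2 * (formSnd Γ (t, 0) 0 1).im : ℝ) : ℂ) := by
  have hp := h.mem t ht
  have e : (fun u => V (t, u)) =ᶠ[𝓝 0] fun u => proj (Γ (t, u)) := by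
    filter_upwards [(isOpen_slice_snd h.isOpen t).mem_nhds hp] with u hu
    exact (h.canonical u).frame t hu
  have h1 := adjugate_congr_deriv_proj (c := fun u => Γ (t, u)) (t := 0) (h.det_eq_one hp)
    (h.smooth.hasDerivAt_slice_snd h.isOpen hp) (hd.congr_of_eventuallyEq e.symm)
  rw [← h.eq_initial hI hV ht, h1, formSnd]

end IsFrameFamily

/-- The first variation of the action. -/
theorem IsCompactVariation.hasDerivAt_action {I : Set ℝ} {γ : ℝ → Mat2} {δ : ℝ}
    {V : ℝ × ℝ → Mat2} {a b ε : ℝ} {Γ₀ : ℝ → Mat2} (hV : IsCompactVariation I γ δ V a b)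
    (hI : IsOpen I) (hIc : I.OrdConnected) (hc : IsCanonicalFrame I γ ε Γ₀) (m : ℝ) :
    HasDerivAt (fun u : ℝ => action m I (fun t => V (t, u)) a b)
      (∫ t in a..b, 1 / 8 * eulerLagrangeLHS m ε Γ₀ t * arcElt Γ₀ t
        * (((Γ₀ t).adjugate * pderivSnd V (t, 0) * (Γ₀ t).adjugate.conjTranspose) 0 0).re) 0 := by
  obtain ⟨O, Γ, h⟩ := hV.exists_isFrameFamily hI hc
  set Φ : ℝ × ℝ → ℝ := fun p => m * (formFst Γ p 1 0).im + (formFst Γ p 1 0).re with hΦ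
  have sΩ := h.smooth.formFst h.isOpen
  have sΩ10 := contDiffOn_matrix_iff.1 sΩ 1 0
  have sΦ : ContDiffOn ℝ ∞ Φ O := (contDiffOn_const.mul sΩ10.complex_im).add sΩ10.complex_re
  obtain ⟨htube, hder⟩ := hasDerivAt_integral_of_contDiffOn h.isOpen sΦ hV.le
    fun t ht => h.mem t (hV.subset ht)
  have hδ : ∀ᶠ u in 𝓝 (0 : ℝ), u ∈ Ioo (-δ) δ :=
    isOpen_Ioo.mem_nhds (by simpa using hV.pos)
  have hact : (fun u : ℝ => action m I (fun t => V (t, u)) a b)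
      =ᶠ[𝓝 0] fun u => ∫ t in a..b, Φ (t, u) := by
    filter_upwards [htube, hδ] with u hu huδ
    obtain ⟨ε', hc'⟩ := isCanonicalFrame_canonicalFrame (hV.nullCurve u huδ) hI hIc
    refine intervalIntegral.integral_congr fun t ht => ?_
    rw [uIcc_of_le hV.le] at ht
    obtain ⟨e1, e2⟩ := hc'.arcElt_frameCurv_unique hI (isOpen_slice h.isOpen u) (h.canonical u)
      (hV.subset ht) (hu t ht)
    have e3 : arcElt (fun t => Γ (t, u)) t = (formFst Γ (t, u) 1 0).im := by
      rw [arcElt, h.frameForm_slice (hu t ht)]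
    have e4 : (formFst Γ (t, u) 1 0).im ≠ 0 := by
      rw [← e3]; exact (h.canonical u).theta21 t (hu t ht)
    simp only [e1, e2, hΦ]
    simp only [frameCurv, e3, h.frameForm_slice (hu t ht)]
    field_simp
  refine (hder.congr_of_eventuallyEq hact).congr_deriv ?_
  set G := boundaryTerm m ε Γ₀ fun s => formSnd Γ (s, 0) with hG
  have dG (t) (ht : t ∈ I) := h.hasDerivAt_boundaryTerm hI hV.initial hc m ht
  have e1 (t) (ht : t ∈ I) : pderivSnd Φ (t, 0) = m * (pderivSnd (formFst Γ) (t, 0) 1 0).im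
      + (pderivSnd (formFst Γ) (t, 0) 1 0).re := by
    have d := hasDerivAt_matrix_iff.1 (sΩ.hasDerivAt_slice_snd h.isOpen (h.mem t ht)) 1 0
    exact (sΦ.hasDerivAt_slice_snd h.isOpen (h.mem t ht)).unique
      ((d.complex_im.const_mul m).add d.complex_re)
  have e2 (t) (ht : t ∈ I) :
      (((Γ₀ t).adjugate * pderivSnd V (t, 0) * (Γ₀ t).adjugate.conjTranspose) 0 0).re
        = -2 * (formSnd Γ (t, 0) 0 1).im := by
    rw [h.formSnd_zero_one_im hI hV.initial ht (hV.smooth.hasDerivAt_slice_snd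
      (hI.prod isOpen_Ioo) ⟨ht, by simpa using hV.pos⟩), Complex.ofReal_re]
  have sW : ContDiffOn ℝ ∞ (fun t => (formSnd Γ (t, 0) 0 1).im) I :=
    (contDiffOn_matrix_iff.1 (((h.smooth.formSnd h.isOpen).slice_fst 0).mono
      fun t ht => h.mem t ht) 0 1).complex_im
  have hsub : uIcc a b ⊆ I := by rw [uIcc_of_le hV.le]; exact hV.subset
  have cEL : ContinuousOn (fun t => 1 / 4 * eulerLagrangeLHS m ε Γ₀ t * arcElt Γ₀ t
      * (formSnd Γ (t, 0) 0 1).im) I :=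
    (((contDiffOn_const.mul (hc.contDiffOn_eulerLagrangeLHS hI m)).mul
      (hc.contDiffOn_arcElt hI)).mul sW).continuousOn
  have cΦ : ContinuousOn (fun t => pderivSnd Φ (t, 0)) I :=
    (((sΦ.pderivSnd h.isOpen).slice_fst 0).mono fun t ht => h.mem t ht).continuousOn
  -- the boundary terms vanish
  have hzero (t) (ht : t ∈ I) (htab : t ∉ Icc a b) : G t = 0 := by
    have hW : formSnd Γ (t, 0) = 0 := by
      have hd := h.smooth.hasDerivAt_slice_snd h.isOpen (h.mem t ht)
      have : pderivSnd Γ (t, 0) = 0 := by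
        refine hd.unique ((hasDerivAt_const (0 : ℝ) (Γ₀ t)).congr_of_eventuallyEq ?_)
        filter_upwards [hδ, (isOpen_slice_snd h.isOpen t).mem_nhds (h.mem t ht)] with u hu huO
        refine h.eq_of_eventuallyEq t u huO ?_
        filter_upwards [hI.mem_nhds ht, isClosed_Icc.isOpen_compl.mem_nhds htab] with s hs hs2
        exact hV.support s hs hs2 u hu
      rw [formSnd, this, maurerCartan, Matrix.mul_zero]
    simp [hG, boundaryTerm, hW]
  have ha : a ∈ I := hV.subset (left_mem_Icc.2 hV.le)
  have hb : b ∈ I := hV.subset (right_mem_Icc.2 hV.le)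
  have hGa : G a = 0 := by
    have t1 : Tendsto G (𝓝[<] a) (𝓝 (G a)) :=
      (dG a ha).continuousAt.tendsto.mono_left nhdsWithin_le_nhds
    refine tendsto_nhds_unique t1 (tendsto_const_nhds.congr' ?_)
    filter_upwards [self_mem_nhdsWithin, nhdsWithin_le_nhds (hI.mem_nhds ha)] with t ht htI
    exact (hzero t htI fun h => (not_lt.2 h.1) ht).symm
  have hGb : G b = 0 := by
    have t1 : Tendsto G (𝓝[>] b) (𝓝 (G b)) :=
      (dG b hb).continuousAt.tendsto.mono_left nhdsWithin_le_nhds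
    refine tendsto_nhds_unique t1 (tendsto_const_nhds.congr' ?_)
    filter_upwards [self_mem_nhdsWithin, nhdsWithin_le_nhds (hI.mem_nhds hb)] with t ht htI
    exact (hzero t htI fun h => (not_lt.2 h.2) ht).symm
  have hintegral : ∫ t in a..b,
      (pderivSnd Φ (t, 0) + 1 / 4 * eulerLagrangeLHS m ε Γ₀ t * arcElt Γ₀ t
      * (formSnd Γ (t, 0) 0 1).im) = G b - G a := by
    refine intervalIntegral.integral_eq_sub_of_hasDerivAt (fun t ht => ?_)
      ((cΦ.add cEL).mono hsub).intervalIntegrable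
    rw [e1 t (hsub ht)]
    exact dG t (hsub ht)
  rw [intervalIntegral.integral_add (cΦ.mono hsub).intervalIntegrable
    (cEL.mono hsub).intervalIntegrable, hGa, hGb, sub_zero] at hintegral
  rw [eq_neg_of_add_eq_zero_left hintegral, ← intervalIntegral.integral_neg]
  refine intervalIntegral.integral_congr fun t ht => ?_
  simp only [e2 t (hsub ht)]
  ring

/-! ### Variations with prescribed normal component -/

/-- Every compactly supported function is the normal component of a variation. -/
theorem IsCanonicalFrame.exists_isCompactVariation {I : Set ℝ} {γ : ℝ → Mat2} {ε a b : ℝ}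
    {Γ₀ : ℝ → Mat2} (hc : IsCanonicalFrame I γ ε Γ₀) (hI : IsOpen I) (hab : a ≤ b)
    (habI : Icc a b ⊆ I) {φ : ℝ → ℝ} (hφ : ContDiffOn ℝ ∞ φ I)
    (hφ0 : ∀ t ∈ I, t ∉ Icc a b → φ t = 0) :
    ∃ δ V, IsCompactVariation I γ δ V a b ∧ ∀ t ∈ I,
      (((Γ₀ t).adjugate * pderivSnd V (t, 0) * (Γ₀ t).adjugate.conjTranspose) 0 0).re
        = -2 * φ t := by
  have hε0 := ne_zero_of_spin hc.spin
  have had := hc.isAdaptedFrame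
  set σ₀ := arcElt Γ₀ with hσ₀
  have sσ₀ : ContDiffOn ℝ ∞ σ₀ I := hc.contDiffOn_arcElt hI
  have hσ₀0 (t) (ht : t ∈ I) : σ₀ t ≠ 0 := hc.theta21 t ht
  have sΓ₀ := contDiffOn_matrix_iff.1 hc.smooth
  set O₀ : Set (ℝ × ℝ) := I ×ˢ univ with hO₀
  have oO₀ : IsOpen O₀ := hI.prod isOpen_univ
  have fstO₀ : ∀ p ∈ O₀, p.1 ∈ I := fun p hp => hp.1
  set w : ℝ × ℝ → Fin 2 → ℂ := fun p i =>
    Γ₀ p.1 i 1 + ((p.2 * φ p.1 : ℝ) : ℂ) * Complex.I * Γ₀ p.1 i 0 with hw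
  have sw : ContDiffOn ℝ ∞ w O₀ := contDiffOn_pi.2 fun i =>
    ((sΓ₀ i 1).comp_fst fstO₀).add (((contDiffOn_snd.mul (hφ.comp_fst fstO₀)).complex_ofReal.mul
      contDiffOn_const).mul ((sΓ₀ i 0).comp_fst fstO₀))
  have sw' : ContDiffOn ℝ ∞ (pderivFst w) O₀ := sw.pderivFst oO₀
  set f : ℝ × ℝ → ℂ := fun p => pderivFst w p 0 * w p 1 - pderivFst w p 1 * w p 0 with hf
  have sf : ContDiffOn ℝ ∞ f O₀ := by
    have h1 := contDiffOn_pi.1 sw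
    have h2 := contDiffOn_pi.1 sw'
    exact ((h2 0).mul (h1 1)).sub ((h2 1).mul (h1 0))
  have sb : ContDiffOn ℝ ∞ (fun p : ℝ × ℝ => ε * σ₀ p.1) O₀ :=
    contDiffOn_const.mul (sσ₀.comp_fst fstO₀)
  set R : ℝ × ℝ → ℂ := fun p => f p / ((ε * σ₀ p.1 : ℝ) : ℂ) with hR
  have hb0 (p) (hp : p ∈ O₀) : ((ε * σ₀ p.1 : ℝ) : ℂ) ≠ 0 := by
    exact_mod_cast mul_ne_zero hε0 (hσ₀0 p.1 hp.1)
  have sR : ContDiffOn ℝ ∞ R O₀ := by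
    simpa [hR, div_eq_mul_inv] using sf.mul (sb.complex_ofReal.inv hb0)
  set O₁ : Set (ℝ × ℝ) := O₀ ∩ R ⁻¹' Complex.slitPlane with hO₁
  have oO₁ : IsOpen O₁ := sR.continuousOn.isOpen_inter_preimage oO₀ Complex.isOpen_slitPlane
  have h₁₀ : O₁ ⊆ O₀ := inter_subset_left
  set l : ℝ × ℝ → ℂ := fun p => Complex.exp (-Complex.log (R p) / 2) with hl
  have sl : ContDiffOn ℝ ∞ l O₁ := by
    have h1 : ContDiffOn ℝ ∞ (fun p => Complex.log (R p)) O₁ := fun p hp =>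
      (((Complex.contDiffAt_log hp.2).restrict_scalars ℝ).comp p
        (sR.contDiffAt (oO₀.mem_nhds hp.1))).contDiffWithinAt
    exact Complex.contDiff_exp.comp_contDiffOn (h1.neg.div_const 2)
  have hl2 (p) (hp : p ∈ O₁) : l p ^ 2 * R p = 1 := by
    have h1 : R p ≠ 0 := Complex.slitPlane_ne_zero hp.2
    rw [hl, ← Complex.exp_nat_mul]
    have : ((2 : ℕ) : ℂ) * (-Complex.log (R p) / 2) = -Complex.log (R p) := by push_cast; ring
    rw [this, Complex.exp_neg, Complex.exp_log h1, inv_mul_cancel₀ h1]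
  set v : ℝ × ℝ → Fin 2 → ℂ := fun p => l p • w p with hv
  have sv : ContDiffOn ℝ ∞ v O₁ := sl.smul (sw.mono h₁₀)
  have sv' : ContDiffOn ℝ ∞ (pderivFst v) O₁ := sv.pderivFst oO₁
  set Γ : ℝ × ℝ → Mat2 := fun p => colFrame (v p) (pderivFst v p) (ε * σ₀ p.1) with hΓ
  have hbr0 (p) (hp : p ∈ O₁) : ε * σ₀ p.1 ≠ 0 := mul_ne_zero hε0 (hσ₀0 p.1 hp.1.1)
  have sΓ : ContDiffOn ℝ ∞ Γ O₁ := sv.colFrame sv' (sb.mono h₁₀) hbr0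
  have adapted (u : ℝ) : IsAdaptedFrame {t | (t, u) ∈ O₁} (fun t => Γ (t, u))
      fun t => ε * σ₀ t := by
    refine isAdaptedFrame_colFrame (isOpen_slice oO₁ u) (sv.slice_fst u) (sv'.slice_fst u)
      ((sb.mono h₁₀).slice_fst u) (fun t ht => hbr0 _ ht)
      (fun t ht => sv.hasDerivAt_slice_fst oO₁ ht) fun t ht => ?_
    have h1 := (sl.hasDerivAt_slice_fst oO₁ ht).smul (sw.hasDerivAt_slice_fst oO₀ (h₁₀ ht))
    have h2 : pderivFst v (t, u) = l (t, u) • pderivFst w (t, u) + pderivFst l (t, u) • w (t, u) :=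
      (sv.hasDerivAt_slice_fst oO₁ ht).unique h1
    have h3 : f (t, u) = R (t, u) * ((ε * σ₀ t : ℝ) : ℂ) := by
      rw [hR]; exact (div_mul_cancel₀ _ (hb0 _ (h₁₀ ht))).symm
    have h4 := hl2 _ ht
    rw [h2]
    simp only [hv, Pi.add_apply, Pi.smul_apply, smul_eq_mul]
    have h5 : f (t, u) = pderivFst w (t, u) 0 * w (t, u) 1 - pderivFst w (t, u) 1 * w (t, u) 0 :=
      rfl
    linear_combination -l (t, u) ^ 2 * h5 + l (t, u) ^ 2 * h3 + ((ε * σ₀ t : ℝ) : ℂ) * h4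
  have sΩ : ContDiffOn ℝ ∞ (fun p => (formFst Γ p 1 0).im) O₁ :=
    (contDiffOn_matrix_iff.1 (sΓ.formFst oO₁) 1 0).complex_im
  set O : Set (ℝ × ℝ) := O₁ ∩ (fun p => (formFst Γ p 1 0).im) ⁻¹' {0}ᶜ with hO
  have oO : IsOpen O := sΩ.continuousOn.isOpen_inter_preimage oO₁ isOpen_compl_singleton
  -- where the variation is trivial
  have trivw (t u) (hu : u * φ t = 0) (i) : w (t, u) i = Γ₀ t i 1 := by
    simp only [hw, hu, Complex.ofReal_zero, zero_mul, add_zero]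
  have trivw' (t u) (ht : t ∈ I) (hu : ∀ᶠ s in 𝓝 t, u * φ s = 0) (i : Fin 2) :
      pderivFst w (t, u) i = ((ε * σ₀ t : ℝ) : ℂ) * Γ₀ t i 0 := by
    have h1 := hasDerivAt_pi.1 (sw.hasDerivAt_slice_fst oO₀ (t := t) (u := u) ⟨ht, mem_univ _⟩) i
    have h2 : (fun s => w (s, u) i) =ᶠ[𝓝 t] fun s => Γ₀ s i 1 := by
      filter_upwards [hu] with s hs
      exact trivw s u hs i
    have h3 := hasDerivAt_matrix_iff.1 (had.hasDerivAt hI ht) i 1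
    have h4 := h1.unique (h3.congr_of_eventuallyEq h2)
    rw [h4]
    simp [Matrix.mul_apply, Fin.sum_univ_two]
    ring
  have trivl (t u) (ht : t ∈ I) (hu : ∀ᶠ s in 𝓝 t, u * φ s = 0) :
      (t, u) ∈ O₁ ∧ l (t, u) = 1 := by
    have hd2 : Γ₀ t 0 0 * Γ₀ t 1 1 - Γ₀ t 0 1 * Γ₀ t 1 0 = 1 := by
      rw [← Matrix.det_fin_two, hc.det_eq_one t ht]
    have hR1 : R (t, u) = 1 := by
      simp only [hR, hf]
      rw [div_eq_one_iff_eq (hb0 (t, u) ⟨ht, mem_univ _⟩), trivw' t u ht hu, trivw' t u ht hu,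
        trivw t u hu.self_of_nhds, trivw t u hu.self_of_nhds]
      linear_combination ((ε * σ₀ t : ℝ) : ℂ) * hd2
    exact ⟨⟨⟨ht, mem_univ _⟩, by simp [hR1]⟩, by simp [hl, hR1]⟩
  have trivv (t u) (ht : t ∈ I) (hu : ∀ᶠ s in 𝓝 t, u * φ s = 0) : v (t, u) = w (t, u) := by
    rw [hv]; simp only [(trivl t u ht hu).2, one_smul]
  have trivΓ (t u) (ht : t ∈ I) (hu : ∀ᶠ s in 𝓝 t, u * φ s = 0) : Γ (t, u) = Γ₀ t := by
    have hv' : pderivFst v (t, u) = pderivFst w (t, u) := by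
      refine (sv.hasDerivAt_slice_fst oO₁ (trivl t u ht hu).1).unique
        ((sw.hasDerivAt_slice_fst oO₀ ⟨ht, mem_univ _⟩).congr_of_eventuallyEq ?_)
      filter_upwards [hu.eventually_nhds, hI.mem_nhds ht] with s hs hsI
      exact trivv s u hsI hs
    have hε1 : (ε : ℂ) ≠ 0 := by exact_mod_cast hε0
    have hσ1 : (σ₀ t : ℂ) ≠ 0 := by exact_mod_cast hσ₀0 t ht
    have e := trivw' t u ht hu
    have e2 := trivw t u hu.self_of_nhds
    simp only [hΓ, trivv t u ht hu, hv']
    ext i j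
    fin_cases i <;> fin_cases j <;> simp [colFrame, e, e2] <;> field_simp
  have trivO (t u) (ht : t ∈ I) (hu : ∀ᶠ s in 𝓝 t, u * φ s = 0) : (t, u) ∈ O := by
    have hm := (trivl t u ht hu).1
    refine ⟨hm, ?_⟩
    have h1 : pderivFst Γ (t, u) = deriv Γ₀ t := by
      refine (sΓ.hasDerivAt_slice_fst oO₁ hm).unique
        ((hc.smooth.hasDerivAt_infty hI ht).congr_of_eventuallyEq ?_)
      filter_upwards [hu.eventually_nhds, hI.mem_nhds ht] with s hs hsI
      exact trivΓ s u hsI hs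
    have h2 : formFst Γ (t, u) = frameForm Γ₀ t := by
      rw [formFst, h1, trivΓ t u ht hu, frameForm]
    change (formFst Γ (t, u) 1 0).im ≠ 0
    rw [h2]
    exact hσ₀0 t ht
  have ev0 (t : ℝ) : ∀ᶠ s in 𝓝 t, (0 : ℝ) * φ s = 0 := Filter.Eventually.of_forall fun s => by simp
  have evout (t u) (ht : t ∈ I) (htab : t ∉ Icc a b) : ∀ᶠ s in 𝓝 t, u * φ s = 0 := by
    filter_upwards [hI.mem_nhds ht, isClosed_Icc.isOpen_compl.mem_nhds htab] with s hs hs2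
    rw [hφ0 s hs hs2, mul_zero]
  have htube := (hasDerivAt_integral_of_contDiffOn oO (contDiffOn_const (c := (0 : ℝ))) hab
    fun t ht => trivO t 0 (habI ht) (ev0 t)).1
  obtain ⟨δ, hδ, hδO⟩ := Metric.eventually_nhds_iff_ball.1 htube
  have hmem (t u) (ht : t ∈ I) (hu : u ∈ Ioo (-δ) δ) : (t, u) ∈ O := by
    by_cases htab : t ∈ Icc a b
    · exact hδO u (by simpa [abs_lt] using hu) t htab
    · exact trivO t u ht (evout t u ht htab)
  refine ⟨δ, fun p => proj (Γ p), ⟨hδ, ?_, fun u hu => ?_, fun t ht => ?_, hab, habI,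
    fun t ht htab u hu => ?_⟩, fun t ht => ?_⟩
  · exact (sΓ.mono fun p hp => (hmem p.1 p.2 hp.1 hp.2).1).proj
  · refine ((adapted u).mono fun t ht => (hmem t u ht hu).1).isNullCurve hI fun t ht => ?_
    have hm := hmem t u ht hu
    have h1 : deriv (fun s => Γ (s, u)) t = pderivFst Γ (t, u) :=
      (sΓ.hasDerivAt_slice_fst oO₁ hm.1).deriv
    rw [arcElt, frameForm, h1]
    exact hm.2
  · simp only [trivΓ t 0 ht (ev0 t), hc.frame t ht]
  · simp only [trivΓ t u ht (evout t u ht htab), hc.frame t ht]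
  · have hm := (trivl t 0 ht (ev0 t)).1
    have hΓ0 := trivΓ t 0 ht (ev0 t)
    have hd := sΓ.hasDerivAt_slice_snd oO₁ hm
    have h1 := adjugate_congr_deriv_proj (c := fun u => Γ (t, u))
      ((adapted 0).det_eq_one t hm) hd (sΓ.proj.hasDerivAt_slice_snd oO₁ hm)
    simp only [hΓ0] at h1
    rw [h1, Complex.ofReal_re]
    have hcol (i : Fin 2) : pderivSnd Γ (t, 0) i 1
        = pderivSnd l (t, 0) * Γ₀ t i 1 + φ t * Complex.I * Γ₀ t i 0 := by
      have d1 := hasDerivAt_matrix_iff.1 hd i 1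
      have dw : HasDerivAt (fun u => w (t, u) i) (φ t * Complex.I * Γ₀ t i 0) 0 := by
        have d2 : HasDerivAt (fun u : ℝ => ((u * φ t : ℝ) : ℂ)) (φ t : ℂ) 0 := by
          simpa using ((hasDerivAt_id (0 : ℝ)).mul_const (φ t)).ofReal_comp
        exact ((d2.mul_const Complex.I).mul_const (Γ₀ t i 0)).const_add (Γ₀ t i 1)
      have d3 := (sl.hasDerivAt_slice_snd oO₁ hm).mul dw
      have d4 : HasDerivAt (fun u => Γ (t, u) i 1) (pderivSnd l (t, 0) * w (t, 0) i
          + l (t, 0) * (φ t * Complex.I * Γ₀ t i 0)) 0 := by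
        have e : (fun u => Γ (t, u) i 1) = (fun s => l (t, s)) * fun u => w (t, u) i := by
          funext u
          fin_cases i <;> rfl
        rw [e]
        exact d3
      rw [d1.unique d4, (trivl t 0 ht (ev0 t)).2, trivw t 0 (by simp), one_mul]
    have hd2 : Γ₀ t 0 0 * Γ₀ t 1 1 - Γ₀ t 0 1 * Γ₀ t 1 0 = 1 := by
      rw [← Matrix.det_fin_two, hc.det_eq_one t ht]
    have h2 : maurerCartan (Γ₀ t) (pderivSnd Γ (t, 0)) 0 1 = φ t * Complex.I := by
      rw [maurerCartan, Matrix.mul_apply, Fin.sum_univ_two, hcol, hcol]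
      simp [Matrix.adjugate_fin_two]
      linear_combination (φ t * Complex.I) * hd2
    rw [h2]
    simp

theorem isExtremal_iff_eulerLagrangeEq {I : Set ℝ} {γ : ℝ → Mat2} {ε : ℝ} {Γ₀ : ℝ → Mat2}
    (hc : IsCanonicalFrame I γ ε Γ₀) (hI : IsOpen I) (hIc : I.OrdConnected) (m : ℝ) :
    IsExtremal m I γ ↔ EulerLagrangeEq m ε I Γ₀ := by
  constructor
  · intro hex t₀ ht₀
    change eulerLagrangeLHS m ε Γ₀ t₀ = 0
    by_contra hne
    obtain ⟨r, hr, hrI⟩ := Metric.nhds_basis_closedBall.mem_iff.1 (hI.mem_nhds ht₀)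
    let χ : ContDiffBump t₀ := ⟨r / 2, r, by positivity, by linarith⟩
    have hsub : Icc (t₀ - r) (t₀ + r) ⊆ I := by rwa [← Real.closedBall_eq_Icc]
    set E : ℝ → ℝ := fun t => eulerLagrangeLHS m ε Γ₀ t * arcElt Γ₀ t with hE
    have sE : ContDiffOn ℝ ∞ E I :=
      (hc.contDiffOn_eulerLagrangeLHS hI m).mul (hc.contDiffOn_arcElt hI)
    obtain ⟨δ, V, hV, hy⟩ := hc.exists_isCompactVariation hI
      (by linarith : t₀ - r ≤ t₀ + r) hsub (φ := fun t => χ t * E t)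
      (χ.contDiff.contDiffOn.mul sE) (fun t _ ht => by
        rw [← Real.closedBall_eq_Icc, Metric.mem_closedBall, not_le] at ht
        rw [χ.zero_of_le_dist ht.le, zero_mul])
    have h1 := (hV.hasDerivAt_action hI hIc hc m).unique (hex δ V _ _ hV)
    have h2 : ∫ t in (t₀ - r)..(t₀ + r), χ t * E t ^ 2 = 0 := by
      have : ∫ t in (t₀ - r)..(t₀ + r), 1 / 8 * eulerLagrangeLHS m ε Γ₀ t * arcElt Γ₀ t
          * (((Γ₀ t).adjugate * pderivSnd V (t, 0) * (Γ₀ t).adjugate.conjTranspose) 0 0).re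
          = ∫ t in (t₀ - r)..(t₀ + r), -(1 / 4) * (χ t * E t ^ 2) := by
        refine intervalIntegral.integral_congr fun t ht => ?_
        rw [uIcc_of_le (by linarith)] at ht
        simp only [hy t (hsub ht), hE]
        ring
      rw [this, intervalIntegral.integral_const_mul] at h1
      linarith
    have h3 : 0 < ∫ t in (t₀ - r)..(t₀ + r), χ t * E t ^ 2 := by
      refine intervalIntegral.integral_pos (by linarith) ?_ ?_ ?_
      · exact χ.continuous.continuousOn.mul ((sE.continuousOn.mono hsub).pow 2)
      · exact fun t _ => mul_nonneg χ.nonneg (sq_nonneg _)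
      · refine ⟨t₀, by constructor <;> linarith, ?_⟩
        have h4 : arcElt Γ₀ t₀ ≠ 0 := hc.theta21 t₀ ht₀
        rw [χ.one_of_mem_closedBall (Metric.mem_closedBall_self χ.rIn_pos.le), one_mul]
        have : E t₀ ≠ 0 := mul_ne_zero hne h4
        positivity
    exact h3.ne' h2
  · intro hEL δ V a b hV
    refine (hV.hasDerivAt_action hI hIc hc m).congr_deriv ?_
    rw [← intervalIntegral.integral_zero (a := a) (b := b)]
    refine intervalIntegral.integral_congr fun t ht => ?_
    rw [uIcc_of_le hV.le] at ht
    have h1 : eulerLagrangeLHS m ε Γ₀ t = 0 := hEL t (hV.subset ht)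
    simp [h1]

/-! ### The Cartan system -/

/-- The Liouville form at `((A, k); x)` as a function of the value `X` of the Maurer–Cartan form. -/
noncomputable def liouville (m ε k : ℝ) (x : Fin 5 → ℝ) (X : Mat2) : ℝ :=
  (m + k) * (X 1 0).im + x 0 * (X 0 0).im + x 1 * (X 0 1).im
    + x 2 * ((X 0 1).re - ε * (X 1 0).im) + x 3 * (X 0 0).re + x 4 * ((X 1 0).re - k * (X 1 0).im)

theorem muForm_apply (m ε : ℝ) (p v : Ambient) :
    muForm m ε p v = liouville m ε p.2.1 p.2.2 (maurerCartan p.1 v.1) := by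
  have ha (i j) : alphaForm i j p v = (maurerCartan p.1 v.1 i j).re := rfl
  have hb (i j) : betaForm i j p v = (maurerCartan p.1 v.1 i j).im := rfl
  have h : muForm m ε p v = (m + p.2.1) * betaForm 1 0 p v + (p.2.2 0 * betaForm 0 0 p v
      + p.2.2 1 * betaForm 0 1 p v + p.2.2 2 * (alphaForm 0 1 p v - ε * betaForm 1 0 p v)
      + p.2.2 3 * alphaForm 0 0 p v + p.2.2 4 * (alphaForm 1 0 p v - p.2.1 * betaForm 1 0 p v)) := by
    rw [muForm, Fin.sum_univ_five]
    rfl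
  rw [h, liouville]
  simp only [ha, hb]
  ring

theorem contDiff_muForm_apply (m ε : ℝ) (w : Ambient) :
    ContDiff ℝ ∞ fun q => muForm m ε q w := by
  simp only [muForm_apply, liouville]
  have hX (i j) : ContDiff ℝ ∞ fun q : Ambient => maurerCartan q.1 w.1 i j := by
    rw [← contDiffOn_univ]
    have h1 : ContDiffOn ℝ ∞ (fun q : Ambient => q.1) univ := contDiff_fst.contDiffOn
    exact contDiffOn_matrix_iff.1 (h1.adjugate.matrix_mul contDiffOn_const) i j
  have hre (i j) : ContDiff ℝ ∞ fun q : Ambient => (maurerCartan q.1 w.1 i j).re :=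
    Complex.reCLM.contDiff.comp (hX i j)
  have him (i j) : ContDiff ℝ ∞ fun q : Ambient => (maurerCartan q.1 w.1 i j).im :=
    Complex.imCLM.contDiff.comp (hX i j)
  have hk : ContDiff ℝ ∞ fun q : Ambient => q.2.1 := contDiff_fst.comp contDiff_snd
  have hx (j : Fin 5) : ContDiff ℝ ∞ fun q : Ambient => q.2.2 j :=
    (contDiff_apply ℝ ℝ j).comp (contDiff_snd.comp contDiff_snd)
  exact ((((((contDiff_const.add hk).mul (him 1 0)).add ((hx 0).mul (him 0 0))).add
    ((hx 1).mul (him 0 1))).add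
    ((hx 2).mul ((hre 0 1).sub (contDiff_const.mul (him 1 0))))).add ((hx 3).mul (hre 0 0))).add
    ((hx 4).mul ((hre 1 0).sub (hk.mul (him 1 0))))

/-- The directional derivative of the Liouville form, evaluated on a constant vector field. -/
theorem fderiv_muForm_apply (m ε : ℝ) (p v w : Ambient) :
    fderiv ℝ (fun q => muForm m ε q w) p v
      = v.2.1 * (maurerCartan p.1 w.1 1 0).im * (1 - p.2.2 4)
        + liouville 0 ε 0 v.2.2 (maurerCartan p.1 w.1)
        - v.2.2 4 * p.2.1 * (maurerCartan p.1 w.1 1 0).im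
        + liouville m ε p.2.1 p.2.2 (maurerCartan v.1 w.1) := by
  have hdiff : DifferentiableAt ℝ (fun q => muForm m ε q w) p :=
    (contDiff_muForm_apply m ε w).differentiable (by simp) p
  have hline : HasDerivAt (fun s : ℝ => p + s • v) v 0 :=
    (((hasDerivAt_id (0 : ℝ)).smul_const v).const_add p).congr_deriv (one_smul ℝ v)
  have h1 : HasDerivAt (fun s : ℝ => muForm m ε (p + s • v) w)
      (fderiv ℝ (fun q => muForm m ε q w) p v) 0 := by
    have e : p = p + (0 : ℝ) • v := by simp
    have h2 : HasFDerivAt (fun q => muForm m ε q w) (fderiv ℝ (fun q => muForm m ε q w) p)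
        (p + (0 : ℝ) • v) := by
      rw [← e]; exact hdiff.hasFDerivAt
    exact h2.comp_hasDerivAt 0 hline
  refine h1.unique ?_
  simp only [muForm_apply, liouville]
  have dA : HasDerivAt (fun s : ℝ => (p + s • v).1) v.1 0 := hline.fst
  have dk : HasDerivAt (fun s : ℝ => (p + s • v).2.1) v.2.1 0 := hline.snd.fst
  have dx (j : Fin 5) : HasDerivAt (fun s : ℝ => (p + s • v).2.2 j) (v.2.2 j) 0 :=
    hasDerivAt_pi.1 hline.snd.snd j
  have dX (i j) : HasDerivAt (fun s : ℝ => maurerCartan (p + s • v).1 w.1 i j)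
      (maurerCartan v.1 w.1 i j) 0 := by
    have h3 := hasDerivAt_matrix_iff.1 (dA.adjugate.matrix_mul (hasDerivAt_const 0 w.1)) i j
    refine h3.congr_deriv ?_
    simp [maurerCartan]
  have e0 : p + (0 : ℝ) • v = p := by simp
  have key := (((((((dk.const_add m).mul (dX 1 0).complex_im).add
    ((dx 0).mul (dX 0 0).complex_im)).add
    ((dx 1).mul (dX 0 1).complex_im)).add
    ((dx 2).mul ((dX 0 1).complex_re.sub ((dX 1 0).complex_im.const_mul ε)))).add
    ((dx 3).mul (dX 0 0).complex_re)).add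
    ((dx 4).mul ((dX 1 0).complex_re.sub (dk.mul (dX 1 0).complex_im))))
  refine key.congr_deriv ?_
  simp only [Pi.mul_apply, Pi.sub_apply, e0]
  ring

/-- The exterior derivative of a 1-form on constant vector fields. -/
theorem extDeriv_ofSubsingleton_apply {E : Type*} [NormedAddCommGroup E] [NormedSpace ℝ E]
    [FiniteDimensional ℝ E] {μ : E → E →L[ℝ] ℝ} (hμ : ∀ w, ContDiff ℝ ∞ fun q => μ q w)
    (p v w : E) :
    extDeriv (fun q => ContinuousAlternatingMap.ofSubsingleton ℝ E ℝ (0 : Fin 1) (μ q)) p ![v, w]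
      = fderiv ℝ (fun q => μ q w) p v - fderiv ℝ (fun q => μ q v) p w := by
  have hμ' : ContDiff ℝ ∞ μ := contDiff_clm_apply_iff.2 hμ
  have hdiff : DifferentiableAt ℝ (fun q : E =>
      ContinuousAlternatingMap.ofSubsingleton ℝ E ℝ (0 : Fin 1) (μ q)) p :=
    (ContinuousAlternatingMap.ofSubsingletonLIE (𝕜 := ℝ) (E := E) (F := ℝ)
      (0 : Fin 1)).toContinuousLinearEquiv.differentiableAt.comp p
      (hμ'.differentiable (by simp) p)
  have hr : Fin.removeNth 1 ![v, w] = ![v] := by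
    ext i
    fin_cases i
    rfl
  have happ (q z : E) :
      ContinuousAlternatingMap.ofSubsingleton ℝ E ℝ (0 : Fin 1) (μ q) ![z] = μ q z := rfl
  have hr0 : Fin.removeNth 0 ![v, w] = ![w] := rfl
  rw [extDeriv_apply hdiff, Fin.sum_univ_two, hr0, hr]
  simp only [happ]
  simp [sub_eq_add_neg]

theorem dMu_eq_sub (m ε : ℝ) (p v w : Ambient) :
    dMu m ε p v w = fderiv ℝ (fun q => muForm m ε q w) p v
      - fderiv ℝ (fun q => muForm m ε q v) p w :=
  extDeriv_ofSubsingleton_apply (contDiff_muForm_apply m ε) p v w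

theorem liouville_sub (m ε k : ℝ) (x : Fin 5 → ℝ) (X Y : Mat2) :
    liouville m ε k x X - liouville m ε k x Y = liouville m ε k x (X - Y) := by
  simp only [liouville, Matrix.sub_apply, Complex.sub_re, Complex.sub_im]
  ring

/-- The form `dμ` in terms of the Maurer–Cartan form. -/
theorem dMu_apply {m ε : ℝ} {p : Ambient} (hp : p.1.det = 1) {X Y : Mat2}
    (hX : X 0 0 + X 1 1 = 0) (hY : Y 0 0 + Y 1 1 = 0) (κ κ' : ℝ) (ξ ξ' : Fin 5 → ℝ) :
    dMu m ε p (p.1 * Y, κ', ξ') (p.1 * X, κ, ξ)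
      = (κ' * (X 1 0).im - κ * (Y 1 0).im) * (1 - p.2.2 4)
        + liouville 0 ε 0 ξ' X - ξ' 4 * p.2.1 * (X 1 0).im
        - liouville 0 ε 0 ξ Y + ξ 4 * p.2.1 * (Y 1 0).im
        + liouville m ε p.2.1 p.2.2 (X * Y - Y * X) := by
  rw [dMu_eq_sub, fderiv_muForm_apply, fderiv_muForm_apply]
  have e (X Y : Mat2) (hY : Y 0 0 + Y 1 1 = 0) : maurerCartan (p.1 * Y) (p.1 * X) = -(Y * X) := by
    rw [maurerCartan, Matrix.adjugate_mul_distrib, adjugate_eq_neg_of_trace hY, Matrix.mul_assoc,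
      ← Matrix.mul_assoc p.1.adjugate, adjugate_mul_of_det hp, Matrix.one_mul, Matrix.neg_mul]
  have h1 : X * Y - Y * X = -(Y * X) - -(X * Y) := by abel
  rw [h1, ← liouville_sub]
  simp only [maurerCartan_mul hp, e X Y hY, e Y X hX]
  ring

/-! ### Tangent vectors -/

theorem IsTangent.mono {S T : Set Ambient} (h : S ⊆ T) {p v : Ambient} (hv : IsTangent S p v) :
    IsTangent T p v := by
  obtain ⟨c, h1, h2, h3⟩ := hv
  exact ⟨c, h1, h2.mono fun _ ht => h ht, h3⟩

theorem IsTangent.mem {S : Set Ambient} {p v : Ambient} (hv : IsTangent S p v) : p ∈ S := by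
  obtain ⟨c, -, h2, h3, -⟩ := hv
  rw [← h3]
  exact h2.self_of_nhds

theorem IsTangent.trace_eq_zero {p v : Ambient} (hv : IsTangent bundleZ p v) :
    maurerCartan p.1 v.1 0 0 + maurerCartan p.1 v.1 1 1 = 0 := by
  obtain ⟨c, -, h2, h3, h4⟩ := hv
  have h := trace_maurerCartan_eq_zero (Γ := fun t => (c t).1) (t := 0) h4.fst h2
  simpa only [h3] using h

/-- A coordinate `xⱼ` that is constant on `S` is constant along tangent vectors of `S`. -/
theorem IsTangent.coord_eq_zero {S : Set Ambient} {p v : Ambient} (hv : IsTangent S p v)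
    {j : Fin 5} {d : ℝ} (h : ∀ q ∈ S, q.2.2 j = d) : v.2.2 j = 0 := by
  obtain ⟨c, -, h2, -, h4⟩ := hv
  exact (hasDerivAt_pi.1 h4.snd.snd j).unique
    ((hasDerivAt_const (0 : ℝ) d).congr_of_eventuallyEq (h2.mono fun t ht => h _ ht))

/-- Tangent vectors of subsets of `SL(2,ℂ) × ℝ⁶` defined by conditions on the second factor. -/
theorem isTangent_of_forall_mem {S : Set Ambient} {p : Ambient} (hp : p.1.det = 1) {X : Mat2}
    (hX : X 0 0 + X 1 1 = 0) (q : ℝ × (Fin 5 → ℝ))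
    (hS : ∀ (A : Mat2) (s : ℝ), A.det = 1 → (A, p.2 + s • q) ∈ S) :
    IsTangent S p (p.1 * X, q) := by
  have hX' : X 1 1 = -X 0 0 := by linear_combination hX
  set e : ℝ → ℂ := fun s => Complex.exp (s * X 0 0) with he
  set e' : ℝ → ℂ := fun s => Complex.exp (-(s * X 0 0)) with he'
  have hee (s) : e s * e' s = 1 := by rw [he, he', ← Complex.exp_add]; simp
  set E : ℝ → Mat2 := fun s => !![(1 + s * X 0 1 * (s * X 1 0)) * e s, s * X 0 1 * e' s;
    s * X 1 0 * e s, e' s] with hE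
  have hdet (s) : (E s).det = 1 := by
    rw [Matrix.det_fin_two]
    simp [hE]
    linear_combination hee s
  have hs : ContDiff ℝ ∞ fun s : ℝ => (s : ℂ) := Complex.ofRealCLM.contDiff
  have ce : ContDiff ℝ ∞ e := Complex.contDiff_exp.comp (hs.mul contDiff_const)
  have ce' : ContDiff ℝ ∞ e' := Complex.contDiff_exp.comp (hs.mul contDiff_const).neg
  have cE : ContDiff ℝ ∞ E := by
    rw [← contDiffOn_univ, contDiffOn_matrix_iff]
    intro i j
    fin_cases i <;> fin_cases j <;> simp only [contDiffOn_univ, hE]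
    · exact (contDiff_const.add ((hs.mul contDiff_const).mul (hs.mul contDiff_const))).mul ce
    · exact (hs.mul contDiff_const).mul ce'
    · exact (hs.mul contDiff_const).mul ce
    · exact ce'
  have d1 : HasDerivAt (fun s : ℝ => (s : ℂ)) 1 0 := by
    simpa using (hasDerivAt_id (0 : ℝ)).ofReal_comp
  have de : HasDerivAt e (X 0 0) 0 := by simpa using (d1.mul_const (X 0 0)).cexp
  have de' : HasDerivAt e' (-X 0 0) 0 := by simpa using (d1.mul_const (X 0 0)).neg.cexp
  have e0 : e 0 = 1 := by simp [he]
  have e0' : e' 0 = 1 := by simp [he']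
  have dE : HasDerivAt E X 0 := by
    rw [hasDerivAt_matrix_iff]
    intro i j
    fin_cases i <;> fin_cases j
    · refine ((((d1.mul_const (X 0 1)).mul (d1.mul_const (X 1 0))).const_add 1).mul
        de).congr_deriv ?_
      simp
    · refine ((d1.mul_const (X 0 1)).mul de').congr_deriv ?_
      simp [e0']
    · refine ((d1.mul_const (X 1 0)).mul de).congr_deriv ?_
      simp [e0]
    · refine de'.congr_deriv ?_
      simp [hX']
  refine ⟨fun s => (p.1 * E s, p.2 + s • q), ?_, ?_, ?_, ?_⟩
  · refine ContDiff.prodMk ?_ (contDiff_const.add (contDiff_id.smul contDiff_const))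
    rw [← contDiffOn_univ]
    exact contDiffOn_const.matrix_mul cE.contDiffOn
  · exact Filter.Eventually.of_forall fun s => hS _ _ (by rw [Matrix.det_mul, hp, hdet, one_mul])
  · have : E 0 = 1 := by
      ext i j
      fin_cases i <;> fin_cases j <;> simp [hE, e0, e0']
    simp [this]
  · refine HasDerivAt.prodMk ?_ ?_
    · refine ((hasDerivAt_const (0 : ℝ) p.1).matrix_mul dE).congr_deriv ?_
      simp
    · simpa using ((hasDerivAt_id (0 : ℝ)).smul_const q).const_add p.2

/-! ### Integral elements -/

/-- The value of the Maurer–Cartan form on the velocity of a canonical frame with pseudo-arc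
element `τ`, spin `ε` and curvature `k`. -/
noncomputable def canonicalForm (ε k τ : ℝ) : Mat2 :=
  !![0, (ε * τ : ℝ); ((k : ℂ) + Complex.I) * τ, 0]

/-- The equations of the integral elements with `ω = τ` of the Cartan system. -/
structure IsCartanVector (m ε : ℝ) (p v : Ambient) (τ : ℝ) : Prop where
  ne_zero : τ ≠ 0
  fst : v.1 = p.1 * canonicalForm ε p.2.1 τ
  x4 : p.2.2 4 = 1
  dx0 : v.2.2 0 = τ * (2 * p.2.1 * (m + p.2.1) - 2 * ε * p.2.2 1 - 2 * ε * p.2.1 * p.2.2 2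
    - 2 * (1 + p.2.1 ^ 2))
  dx1 : v.2.2 1 = τ * (p.2.2 3 - p.2.1 * p.2.2 0)
  dx2 : v.2.2 2 = τ * (-p.2.2 0 - p.2.1 * p.2.2 3)
  dx3 : v.2.2 3 = τ * (2 * (m + p.2.1) - 4 * ε * p.2.2 2)
  dx4 : v.2.2 4 = τ * ε * p.2.2 3

theorem IsIntegralElement.exists_isCartanVector {m ε : ℝ} {p v : Ambient}
    (h : IsIntegralElement m ε p v) : ∃ τ, IsCartanVector m ε p v τ := by
  obtain ⟨ht, hω, h⟩ := h
  have hp : p.1.det = 1 := ht.mem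
  obtain ⟨V, κ, ξ⟩ := v
  set X := maurerCartan p.1 V with hX
  have hV : V = p.1 * X := (mul_maurerCartan hp V).symm
  have htr : X 0 0 + X 1 1 = 0 := ht.trace_eq_zero
  have hω' : (X 1 0).im ≠ 0 := hω
  have H (Y : Mat2) (hY : Y 0 0 + Y 1 1 = 0) (κ' : ℝ) (ξ' : Fin 5 → ℝ) :
      (κ' * (X 1 0).im - κ * (Y 1 0).im) * (1 - p.2.2 4)
        + liouville 0 ε 0 ξ' X - ξ' 4 * p.2.1 * (X 1 0).im
        - liouville 0 ε 0 ξ Y + ξ 4 * p.2.1 * (Y 1 0).im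
        + liouville m ε p.2.1 p.2.2 (X * Y - Y * X) = 0 := by
    rw [← dMu_apply hp htr hY, ← hV]
    exact h _ (isTangent_of_forall_mem hp hY (κ', ξ') fun A s hA => hA)
  have g (j : Fin 5) := H 0 (by simp) 0 (Pi.single j 1)
  have g0 := g 0
  have g1 := g 1
  have g2 := g 2
  have g3 := g 3
  have g4 := g 4
  have gk := H 0 (by simp) 1 0
  simp [liouville] at g0 g1 g2 g3 g4 gk
  have x4 : p.2.2 4 = 1 := by
    rcases gk with gk | gk
    · exact absurd gk hω'
    · linarith
  set τ := (X 1 0).im with hτ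
  have hXe : X = canonicalForm ε p.2.1 τ := by
    have h11 : X 1 1 = - X 0 0 := by linear_combination htr
    ext i j
    fin_cases i <;> fin_cases j <;> apply Complex.ext <;>
      simp [canonicalForm, h11, g0, g1, g3, ← hτ] <;> linarith
  have a1 := H !![1, 0; 0, -1] (by simp) 0 0
  have a2 := H !![Complex.I, 0; 0, -Complex.I] (by simp) 0 0
  have b1 := H !![0, 1; 0, 0] (by simp) 0 0
  have b2 := H !![0, Complex.I; 0, 0] (by simp) 0 0
  have c1 := H !![0, 0; 1, 0] (by simp) 0 0
  have c2 := H !![0, 0; Complex.I, 0] (by simp) 0 0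
  rw [hXe] at a1 a2 b1 b2 c1 c2
  simp [liouville, canonicalForm, x4] at a1 a2 b1 b2 c1 c2
  refine ⟨τ, hω', by rw [hV, hXe], x4, ?_, ?_, ?_, ?_, ?_⟩ <;> simp only <;>
    linarith

theorem IsCartanVector.isIntegralElement {m ε : ℝ} {p v : Ambient}
    (hp : p.1.det = 1) {τ : ℝ} (h : IsCartanVector m ε p v τ) :
    IsIntegralElement m ε p v := by
  have htr : canonicalForm ε p.2.1 τ 0 0 + canonicalForm ε p.2.1 τ 1 1 = 0 := by
    simp [canonicalForm]
  have hv : v = (p.1 * canonicalForm ε p.2.1 τ, v.2.1, v.2.2) := by rw [← h.fst]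
  refine ⟨?_, ?_, fun w hw => ?_⟩
  · rw [hv]
    exact isTangent_of_forall_mem hp htr v.2 fun A s hA => hA
  · have : omegaForm p v = (maurerCartan p.1 v.1 1 0).im := rfl
    rw [this, h.fst, maurerCartan_mul hp]
    simpa [canonicalForm] using h.ne_zero
  · have hY := hw.trace_eq_zero
    obtain ⟨W, κ', ξ'⟩ := w
    have hW : W = p.1 * maurerCartan p.1 W := (mul_maurerCartan hp W).symm
    simp only at hY
    set Y := maurerCartan p.1 W
    rw [hv, hW, dMu_apply hp htr hY]
    have h11 : Y 1 1 = - Y 0 0 := by linear_combination hY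
    simp [liouville, canonicalForm, Matrix.mul_apply, Matrix.vecMul, dotProduct, Fin.sum_univ_two, h.x4,
      h.dx0, h.dx1, h.dx2, h.dx3, h.dx4, h11]
    ring

/-! ### The momentum space -/

theorem prolong_mono {m ε : ℝ} {S T : Set Ambient} (h : S ⊆ T) : prolong m ε S ⊆ prolong m ε T := by
  rintro p ⟨hp, v, hv, hi⟩
  exact ⟨h hp, v, hv.mono h, hi⟩

theorem momentumSpace_eq {m ε : ℝ} (hε : ε = 1 ∨ ε = -1) :
    momentumSpace m ε = {p | p.1.det = 1 ∧ p.2.2 4 = 1 ∧ p.2.2 3 = 0 ∧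
      p.2.2 2 = ε / 2 * (m + p.2.1)} := by
  have hε2 : ε * ε = 1 := sq_eq_one_of_spin hε
  set Y : Set Ambient := {p | p.1.det = 1 ∧ p.2.2 4 = 1 ∧ p.2.2 3 = 0 ∧
      p.2.2 2 = ε / 2 * (m + p.2.1)} with hY
  refine Subset.antisymm (fun p hp => ?_) (subset_iInter fun n => ?_)
  · set S : ℕ → Set Ambient := fun n => (prolong m ε)^[n] bundleZ with hS
    have hsucc (n : ℕ) : S (n + 1) = prolong m ε (S n) := Function.iterate_succ_apply' _ _ _
    have hsub (n : ℕ) : S (n + 1) ⊆ S n := by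
      rw [hsucc]
      exact fun q hq => hq.1
    have h1 : ∀ q ∈ S 1, q.2.2 4 = 1 := by
      rw [hsucc]
      rintro q ⟨-, v, -, hi⟩
      exact hi.exists_isCartanVector.choose_spec.x4
    have h2 : ∀ q ∈ S 2, q.2.2 3 = 0 := by
      rw [hsucc]
      rintro q ⟨-, v, hv, hi⟩
      obtain ⟨τ, h⟩ := hi.exists_isCartanVector
      have := h.dx4
      rw [hv.coord_eq_zero h1] at this
      simpa [h.ne_zero, ne_zero_of_spin hε] using this
    have h3 : ∀ q ∈ S 3, q.2.2 2 = ε / 2 * (m + q.2.1) := by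
      rw [hsucc]
      rintro q ⟨-, v, hv, hi⟩
      obtain ⟨τ, h⟩ := hi.exists_isCartanVector
      have h4 := h.dx3
      rw [hv.coord_eq_zero h2, eq_comm, mul_eq_zero] at h4
      have h5 := h4.resolve_left h.ne_zero
      linear_combination (-ε / 4) * h5 - q.2.2 2 * hε2
    have p3 : p ∈ S 3 := mem_iInter.1 hp 3
    have p0 : p ∈ S 0 := mem_iInter.1 hp 0
    exact ⟨p0, h1 p (hsub 1 (hsub 2 p3)), h2 p (hsub 2 p3), h3 p p3⟩
  · have hprol : Y ⊆ prolong m ε Y := by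
      rintro p ⟨hp, h4, h3, h2⟩
      set q : ℝ × (Fin 5 → ℝ) := (-2 * ε * p.2.2 0,
        ![2 * p.2.1 * (m + p.2.1) - 2 * ε * p.2.2 1 - 2 * ε * p.2.1 * p.2.2 2
          - 2 * (1 + p.2.1 ^ 2), -(p.2.1 * p.2.2 0), -p.2.2 0, 0, 0]) with hq
      refine ⟨⟨hp, h4, h3, h2⟩, (p.1 * canonicalForm ε p.2.1 1, q), ?_, ?_⟩
      · refine isTangent_of_forall_mem hp (by simp [canonicalForm]) q fun A s hA => ⟨hA, ?_, ?_, ?_⟩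
        · simp [hq, h4]
        · simp [hq, h3]
        · simp [hq, h2]
          linear_combination s * p.2.2 0 * hε2
      · refine IsCartanVector.isIntegralElement hp (τ := 1)
          ⟨one_ne_zero, rfl, h4, ?_, ?_, ?_, ?_, ?_⟩
        · simp [hq]
        · simp [hq, h3]
        · simp [hq, h3]
        · simp [hq, h2]
          linear_combination 2 * (m + p.2.1) * hε2
        · simp [hq, h3]
    induction n with
    | zero => exact fun p hp => hp.1
    | succ n ih =>
      rw [Function.iterate_succ_apply']
      exact hprol.trans (prolong_mono ih)

/-! ### Integral curves of the Euler–Lagrange system -/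

section EulerLagrangeCurves

variable {m ε : ℝ} {I : Set ℝ} {y : ℝ → Ambient}

theorem IsELCurve.isCartanVector (h : IsELCurve m ε I y) (hI : IsOpen I) {t : ℝ} (ht : t ∈ I) :
    frameForm (fun s => (y s).1) t
        = canonicalForm ε (y t).2.1 (arcElt (fun s => (y s).1) t) ∧
      IsCartanVector m ε (y t) (deriv y t) (arcElt (fun s => (y s).1) t) := by
  have hdet : (y t).1.det = 1 := (h.integral t ht).1.mem
  obtain ⟨τ, hτ⟩ := (h.integral t ht).exists_isCartanVector
  have hd : HasDerivAt y (deriv y t) t := h.smooth.hasDerivAt_infty hI ht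
  have e : deriv (fun s => (y s).1) t = (y t).1 * canonicalForm ε (y t).2.1 τ :=
    (show HasDerivAt (fun s => (y s).1) (deriv y t).1 t from hd.fst).deriv.trans hτ.fst
  have hf : frameForm (fun s => (y s).1) t = canonicalForm ε (y t).2.1 τ := by
    rw [frameForm, e, maurerCartan_mul hdet]
  have ha : arcElt (fun s => (y s).1) t = τ := by
    rw [arcElt, hf]
    simp [canonicalForm]
  rw [ha]
  exact ⟨hf, hτ⟩

theorem IsELCurve.isCanonicalFrame (h : IsELCurve m ε I y) (hI : IsOpen I)
    (hε : ε = 1 ∨ ε = -1) :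
    IsCanonicalFrame I (fun t => proj (y t).1) ε (fun t => (y t).1) where
  spin := hε
  smooth := contDiff_fst.comp_contDiffOn h.smooth
  det_eq_one t ht := (h.integral t ht).1.mem
  frame t ht := rfl
  theta11 t ht := by simp [(h.isCartanVector hI ht).1, canonicalForm]
  theta12 t ht := by simp [(h.isCartanVector hI ht).1, canonicalForm]
  theta21 t ht := (h.isCartanVector hI ht).2.ne_zero
  phi12 t ht := by simp [(h.isCartanVector hI ht).1, canonicalForm]
  phi11 t ht := by simp [(h.isCartanVector hI ht).1, canonicalForm]

theorem IsELCurve.frameCurv_eq (h : IsELCurve m ε I y) (hI : IsOpen I) {t : ℝ} (ht : t ∈ I) :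
    frameCurv (fun s => (y s).1) t = (y t).2.1 := by
  obtain ⟨h1, h2⟩ := h.isCartanVector hI ht
  rw [frameCurv, h1, div_eq_iff h2.ne_zero]
  simp [canonicalForm]

/-- A coordinate of an integral curve that is a function `f` on `I` has the derivative of `f`. -/
theorem IsELCurve.deriv_coord_eq (h : IsELCurve m ε I y) (hI : IsOpen I) {j : Fin 5} {f : ℝ → ℝ}
    (hf : ∀ t ∈ I, (y t).2.2 j = f t) {t f' : ℝ} (ht : t ∈ I) (hf' : HasDerivAt f f' t) :
    (deriv y t).2.2 j = f' := by
  have hd : HasDerivAt y (deriv y t) t := h.smooth.hasDerivAt_infty hI ht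
  exact (hasDerivAt_pi.1 hd.snd.snd j).unique
    (hf'.congr_of_eventuallyEq (by filter_upwards [hI.mem_nhds ht] with s hs using hf s hs))

/-- The momentum coordinates of an integral curve, and the Euler–Lagrange equation. -/
theorem IsELCurve.coord_eq (h : IsELCurve m ε I y) (hI : IsOpen I) (hε : ε = 1 ∨ ε = -1) :
    (∀ t ∈ I, y t = momentumLift m ε (fun s => (y s).1) t) ∧
      EulerLagrangeEq m ε I fun s => (y s).1 := by
  have hε2 : ε * ε = 1 := sq_eq_one_of_spin hε
  have hc := h.isCanonicalFrame hI hε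
  set Γ : ℝ → Mat2 := fun s => (y s).1 with hΓ
  set K := frameCurv Γ with hK
  set K1 := arcDeriv Γ K with hK1
  set K2 := arcDeriv Γ K1 with hK2
  have sK : ContDiffOn ℝ ∞ K I := hc.contDiffOn_frameCurv hI
  have sK1 : ContDiffOn ℝ ∞ K1 I := hc.contDiffOn_arcDeriv hI sK
  have sK2 : ContDiffOn ℝ ∞ K2 I := hc.contDiffOn_arcDeriv hI sK1
  have hk (t) (ht : t ∈ I) : (y t).2.1 = K t := (h.frameCurv_eq hI ht).symm
  have hmem (t) (ht : t ∈ I) := (momentumSpace_eq (m := m) hε).subset (h.mem t ht)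
  have x4 (t) (ht : t ∈ I) : (y t).2.2 4 = 1 := (hmem t ht).2.1
  have x3 (t) (ht : t ∈ I) : (y t).2.2 3 = 0 := (hmem t ht).2.2.1
  have x2 (t) (ht : t ∈ I) : (y t).2.2 2 = ε / 2 * (m + K t) := by
    rw [← hk t ht]
    exact (hmem t ht).2.2.2
  have x0 (t) (ht : t ∈ I) : (y t).2.2 0 = -(ε / 2) * K1 t := by
    obtain ⟨-, hv⟩ := h.isCartanVector hI ht
    have e := h.deriv_coord_eq hI x2 ht
      (((hc.hasDerivAt_arcDeriv hI sK ht).const_add m).const_mul (ε / 2))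
    rw [hv.dx2, x3 t ht] at e
    refine mul_right_cancel₀ hv.ne_zero ?_
    linear_combination -e
  have x1 (t) (ht : t ∈ I) :
      (y t).2.2 1 = 1 / 4 * K2 t - ε / 2 * (K t ^ 2 - m * K t + 2) := by
    obtain ⟨-, hv⟩ := h.isCartanVector hI ht
    have e := h.deriv_coord_eq hI x0 ht
      ((hc.hasDerivAt_arcDeriv hI sK1 ht).const_mul (-(ε / 2)))
    rw [hv.dx0, x2 t ht, hk t ht] at e
    refine mul_right_cancel₀ hv.ne_zero ?_
    linear_combination (-ε / 2) * e + arcElt Γ t * (K2 t / 4 - (y t).2.2 1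
      - ε / 2 * K t * (m + K t)) * hε2
  refine ⟨fun t ht => ?_, fun t ht => ?_⟩
  · refine Prod.ext rfl (Prod.ext (hk t ht) (funext fun j => ?_))
    fin_cases j
    · exact x0 t ht
    · exact x1 t ht
    · exact x2 t ht
    · exact x3 t ht
    · exact x4 t ht
  · obtain ⟨-, hv⟩ := h.isCartanVector hI ht
    have dK := hc.hasDerivAt_arcDeriv hI sK ht
    have e := h.deriv_coord_eq hI x1 ht
      (((hc.hasDerivAt_arcDeriv hI sK2 ht).const_mul (1 / 4)).sub
        ((((dK.pow 2).sub (dK.const_mul m)).add_const 2).const_mul (ε / 2)))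
    rw [hv.dx1, x3 t ht, x0 t ht, hk t ht] at e
    refine mul_right_cancel₀ hv.ne_zero ?_
    simp only [Nat.cast_ofNat, Nat.add_one_sub_one, pow_one] at e
    linear_combination (-4) * e

/-- The lift of a solution of the Euler–Lagrange equation is an integral curve. -/
theorem IsCanonicalFrame.isELCurve_momentumLift {γ Γ : ℝ → Mat2} (hc : IsCanonicalFrame I γ ε Γ)
    (hI : IsOpen I) (h : EulerLagrangeEq m ε I Γ) : IsELCurve m ε I (momentumLift m ε Γ) := by
  have hε2 : ε * ε = 1 := sq_eq_one_of_spin hc.spin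
  set K := frameCurv Γ with hK
  set K1 := arcDeriv Γ K with hK1
  set K2 := arcDeriv Γ K1 with hK2
  have sK : ContDiffOn ℝ ∞ K I := hc.contDiffOn_frameCurv hI
  have sK1 : ContDiffOn ℝ ∞ K1 I := hc.contDiffOn_arcDeriv hI sK
  have sK2 : ContDiffOn ℝ ∞ K2 I := hc.contDiffOn_arcDeriv hI sK1
  have hsm : ContDiffOn ℝ ∞ (momentumLift m ε Γ) I := by
    refine hc.smooth.prodMk (sK.prodMk (contDiffOn_pi.2 fun j => ?_))
    fin_cases j
    · exact contDiffOn_const.mul sK1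
    · exact (contDiffOn_const.mul sK2).sub
        (contDiffOn_const.mul (((sK.pow 2).sub (contDiffOn_const.mul sK)).add contDiffOn_const))
    · exact contDiffOn_const.mul (contDiffOn_const.add sK)
    · exact contDiffOn_const
    · exact contDiffOn_const
  refine ⟨hsm, fun t ht => ?_, fun t ht => ?_⟩
  · rw [momentumSpace_eq hc.spin]
    exact ⟨hc.det_eq_one t ht, rfl, rfl, rfl⟩
  · have hdet : (Γ t).det = 1 := hc.det_eq_one t ht
    have hd : HasDerivAt (momentumLift m ε Γ) (deriv (momentumLift m ε Γ) t) t :=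
      hsm.hasDerivAt_infty hI ht
    set v := deriv (momentumLift m ε Γ) t with hv
    have dΓ : HasDerivAt Γ v.1 t := hd.fst
    have eΓ : deriv Γ t = v.1 := dΓ.deriv
    have dK := hc.hasDerivAt_arcDeriv hI sK ht
    have dK1 := hc.hasDerivAt_arcDeriv hI sK1 ht
    have dK2 := hc.hasDerivAt_arcDeriv hI sK2 ht
    have dx (j : Fin 5) : HasDerivAt (fun s => (momentumLift m ε Γ s).2.2 j) (v.2.2 j) t :=
      hasDerivAt_pi.1 hd.snd.snd j
    have d0 : v.2.2 0 = _ := (dx 0).unique (dK1.const_mul (-(ε / 2)))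
    have d1 : v.2.2 1 = _ := (dx 1).unique ((dK2.const_mul (1 / 4)).sub
        ((((dK.pow 2).sub (dK.const_mul m)).add_const 2).const_mul (ε / 2)))
    have d2 : v.2.2 2 = _ := (dx 2).unique ((dK.const_add m).const_mul (ε / 2))
    have d3 : v.2.2 3 = 0 := (dx 3).unique (hasDerivAt_const t 0)
    have d4 : v.2.2 4 = 0 := (dx 4).unique (hasDerivAt_const t 1)
    have hEL := h t ht
    have hff : frameForm Γ t = canonicalForm ε (K t) (arcElt Γ t) := by
      rw [hc.isAdaptedFrame.frameForm_eq hI ht, hc.form10 ht]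
      rfl
    have e1 : (momentumLift m ε Γ t).1 = Γ t := rfl
    have ck : (momentumLift m ε Γ t).2.1 = K t := rfl
    have c0 : (momentumLift m ε Γ t).2.2 0 = -(ε / 2) * K1 t := rfl
    have c1 : (momentumLift m ε Γ t).2.2 1
      = 1 / 4 * K2 t - ε / 2 * (K t ^ 2 - m * K t + 2) := rfl
    have c2 : (momentumLift m ε Γ t).2.2 2 = ε / 2 * (m + K t) := rfl
    have c3 : (momentumLift m ε Γ t).2.2 3 = 0 := rfl
    suffices hcv : IsCartanVector m ε (momentumLift m ε Γ t) v (arcElt Γ t) from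
      hcv.isIntegralElement (e1 ▸ hdet)
    refine ⟨hc.theta21 t ht, ?_, rfl, ?_, ?_, ?_, ?_, ?_⟩
    · rw [← eΓ, ← mul_maurerCartan hdet (deriv Γ t)]
      exact congrArg (Γ t * ·) hff
    · rw [d0, ck, c1, c2]
      linear_combination arcElt Γ t * (2 * m * K t - 2) * hε2
    · rw [d1, ck, c0, c3]
      simp only [Nat.cast_ofNat, Nat.add_one_sub_one, pow_one]
      linear_combination arcElt Γ t / 4 * hEL
    · rw [d2, ck, c0, c3]
      ring
    · rw [d3, ck, c2]
      linear_combination 2 * arcElt Γ t * (m + K t) * hε2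
    · rw [d4, c3, mul_zero]

end EulerLagrangeCurves

/-! ### The main theorem -/

theorem mainTheorem2 (m : ℝ) (I : Set ℝ) (hIo : IsOpen I) (hIc : I.OrdConnected) :
    (∀ γ : ℝ → Mat2, IsNullCurve I γ →
      (∃ (ε : ℝ) (Γ : ℝ → Mat2), IsCanonicalFrame I γ ε Γ) ∧
      ∀ (ε : ℝ) (Γ : ℝ → Mat2), IsCanonicalFrame I γ ε Γ →
        (IsExtremal m I γ ↔ EulerLagrangeEq m ε I Γ) ∧
        (IsExtremal m I γ ↔ IsELCurve m ε I (momentumLift m ε Γ))) ∧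
    (∀ (ε : ℝ), ε = 1 ∨ ε = -1 → ∀ y : ℝ → Ambient, IsELCurve m ε I y →
      IsNullCurve I (fun t => proj (y t).1) ∧
      IsCanonicalFrame I (fun t => proj (y t).1) ε (fun t => (y t).1) ∧
      IsExtremal m I (fun t => proj (y t).1) ∧
      ∀ t ∈ I, y t = momentumLift m ε (fun s => (y s).1) t) := by
  refine ⟨fun γ hγ => ⟨hγ.exists_isCanonicalFrame hIo hIc, fun ε Γ hc => ?_⟩, fun ε hε y hy => ?_⟩
  · have hEL := isExtremal_iff_eulerLagrangeEq hc hIo hIc m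
    exact ⟨hEL, hEL.trans ⟨hc.isELCurve_momentumLift hIo, fun h => (h.coord_eq hIo hc.spin).2⟩⟩
  · have hc := hy.isCanonicalFrame hIo hε
    obtain ⟨hlift, hEL⟩ := hy.coord_eq hIo hε
    exact ⟨hc.isAdaptedFrame.isNullCurve hIo hc.theta21, hc,
      (isExtremal_iff_eulerLagrangeEq hc hIo hIc m).2 hEL, hlift⟩
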